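/- **Formulas.** Formulas are generated by $F ::= \mathbf N \mid \alpha \mid F\otimes F\mid F\multimap F\mid \forall\alpha.F\mid\ !F\mid \S F$, with $\alpha$ in a countable set of variables (bound variables may be renamed), and are taken modulo the congruence generated by the recursive equation $\mathbf N=\forall\alpha.(\alpha\multimap(\mathbf B\multimap\mathbf N\multimap\alpha)\multimap\alpha)$, where $\mathbf B=\forall\gamma.\gamma\multimap\gamma\multimap\gamma$. **Proof structures** of Light Affine Logic by Levels (LALL) are finite graphs with edges labelled by formulas, with inputs $\Gamma$ and one output $C$ (written $\Pi\triangleright\Gamma\vdash C$), generated inductively as follows. An axiom node $A\vdash A$ and a dæmon node $\vdash A$ are proof structures. If $\Pi\triangleright\Gamma\vdash C$ and $\Sigma\triangleright\Delta\vdash D$ are disjoint, the following are proof structures as well: - Cut: if $\Gamma=\Gamma',D$, a cut node from the output $D$ of $\Sigma$ to the input $D$ of $\Pi$, giving $\Gamma',\Delta\vdash C$. - Weakening: a weakening node with a new input $E$, giving $\Gamma,E\vdash C$. Contraction: two inputs $!A$ of $\Pi$ are merged into one input $!A$. - $\otimes_L$: two inputs $A,B$ are merged into $A\otimes B$. $\otimes_R$: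 $\Gamma,\Delta\vdash C\otimes D$. - $\multimap_L$: an input $A$ of $\Pi$ is replaced by $D\multimap A$, and the output $D$ of $\Sigma$ is its argument. $\multimap_R$: an input $A$ of $\Pi$ is discharged, giving output $A\multimap C$. - $\forall_L$: an input $A[B/\alpha]$ is replaced by $\forall\alpha.A$. $\forall_R$: the output becomes $\forall\alpha.C$, if $\alpha$ is not free in $\Gamma$. - $\S_L$, $!_L$: an input $A$ is replaced by $\S A$, respectively $!A$. $\S_R$: the output becomes $\S C$. - $!$-box: if $\Gamma$ is empty or a single $A$, the whole of $\Pi$ is enclosed in a box, with a node $!_R$ giving the output $!C$ and, if $\Gamma=A$, one node $!_L$ on the border giving the input $!A$. **Nets.** An indexing assigns an integer to every edge so that it decreases by $1$ from the incoming to the outgoing edge of $!_R$ and $\S_R$, increases by $1$ from the incoming to the outgoing edge of $!_L$ and $\S_L$, is equal on all the edges incident to any other node, and is equal on all the inputs and the output of the whole structure. A *net* is a proof structure that admits an indexing. **Cut elimination steps** (anywhere in a net, inside boxes too). - Linear steps: a cut with an axiom is contracted to an edge; a cut $\otimes_R/\otimes_L$ becomes the two cuts on the components; $\multimap_R/\multimap_L$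 becomes a cut of the argument with the abstracted input and a cut of the body with the result; $\S_R/\S_L$ becomes the cut of the premises; $\forall_R/\forall_L$ becomes the cut of the premises, with the eigenvariable replaced by the witness $B$ in the proof structure above $\forall_R$. - Exponential steps: for $!_R/!_L$, the cut becomes the cut of the premises, and the box of $!_R$ is merged into the box of which $!_L$ is the auxiliary port (if $!_L$ is not a port of a $!$-box, the box border of $!_R$ is erased); for $!_R$/contraction, the whole box is duplicated, each copy is cut with one output of the contraction, and if the box has an assumption, a contraction is put on it. - Garbage collection steps: dæmon/weakening is erased; a right node cut with a weakening is erased, its premises are cut with weakenings, and the discharged input of $\multimap_R$ is cut with a dæmon; a $!$-box cut with a weakening is erased with its content, with a weakening put on its assumption, if any; a left node cut with a dæmon is erased, its outgoing edges are cut with dæmons, and the argument of $\multimap_L$ is cut with a weakening. A net $\Pi$ *reduces* to $\Pi'$ if $\Pi'$ is obtained from $\Pi$ by finitely many such steps, up to renaming of eigenvariables of $\forall_R$ nodes, through nets with the same inputs and the same output. **Proposition (Cut-elimination).** Every LALL net reduces to a net, with the same inputs and output, that has no cut node. -/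

import Mathlib

namespace LALL

/-! ## Formulas -/

/-- Raw formulas, with de Bruijn binders. A formula is read with its free propositional variables
ranging over `ℕ`; under `all` the index `0` is the bound variable and the others are shifted. -/
inductive Fm : Type
  | nat : Fm
  | var : ℕ → Fm
  | tensor : Fm → Fm → Fm
  | imp : Fm → Fm → Fm
  | all : Fm → Fm
  | bang : Fm → Fm
  | par : Fm → Fm

namespace Fm

def upRen (f : ℕ → ℕ) : ℕ → ℕ
  | 0 => 0
  | k + 1 => f k + 1

def rename (f : ℕ → ℕ) : Fm → Fm
  | nat => nat
  | var k => var (f k)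
  | tensor A B => tensor (A.rename f) (B.rename f)
  | imp A B => imp (A.rename f) (B.rename f)
  | all A => all (A.rename (upRen f))
  | bang A => bang (A.rename f)
  | par A => par (A.rename f)

def upSub (s : ℕ → Fm) : ℕ → Fm
  | 0 => var 0
  | k + 1 => (s k).rename Nat.succ

/-- Capture-avoiding simultaneous substitution. -/
def sub (s : ℕ → Fm) : Fm → Fm
  | nat => nat
  | var k => s k
  | tensor A B => tensor (A.sub s) (B.sub s)
  | imp A B => imp (A.sub s) (B.sub s)
  | all A => all (A.sub (upSub s))
  | bang A => bang (A.sub s)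
  | par A => par (A.sub s)

/-- The free variables. -/
def fv : Fm → Set ℕ
  | nat => ∅
  | var k => {k}
  | tensor A B => A.fv ∪ B.fv
  | imp A B => A.fv ∪ B.fv
  | all A => {k | k + 1 ∈ A.fv}
  | bang A => A.fv
  | par A => A.fv

/-- The renaming that turns the named variable `a` into the variable of a new outermost binder. -/
def close (a : ℕ) (k : ℕ) : ℕ := if k = a then 0 else k + 1

/-- `∀a.A`, for a named variable `a`. -/
def forallVar (a : ℕ) (A : Fm) : Fm := all (A.rename (close a))

/-- `A[B/a]`. -/
def substVar (a : ℕ) (B A : Fm) : Fm := A.sub (Function.update var a B)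

/-- The type of booleans `∀γ. γ ⊸ γ ⊸ γ`. -/
def bool : Fm := all (imp (var 0) (imp (var 0) (var 0)))

/-- `∀α. α ⊸ (B ⊸ N ⊸ α) ⊸ α`, with `B` the booleans and `N` the constant `nat`. -/
def natUnfold : Fm :=
  all (imp (var 0) (imp (imp bool (imp nat (var 0))) (var 0)))

/-- The congruence generated by the recursive equation for the constant `nat`. -/
inductive Eqv : Fm → Fm → Prop
  | unfold : Eqv nat natUnfold
  | refl (A : Fm) : Eqv A A
  | symm {A B : Fm} : Eqv A B → Eqv B A
  | trans {A B C : Fm} : Eqv A B → Eqv B C → Eqv A C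
  | tensor {A A' B B' : Fm} : Eqv A A' → Eqv B B' → Eqv (tensor A B) (tensor A' B')
  | imp {A A' B B' : Fm} : Eqv A A' → Eqv B B' → Eqv (imp A B) (imp A' B')
  | all {A A' : Fm} : Eqv A A' → Eqv (all A) (all A')
  | bang {A A' : Fm} : Eqv A A' → Eqv (bang A) (bang A')
  | par {A A' : Fm} : Eqv A A' → Eqv (par A) (par A')

instance setoid : Setoid Fm := ⟨Eqv, Eqv.refl, Eqv.symm, Eqv.trans⟩

theorem Eqv.rename {A A' : Fm} (h : Eqv A A') :
    ∀ f : ℕ → ℕ, Eqv (A.rename f) (A'.rename f) := by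
  induction h with
  | unfold => intro f; exact Eqv.unfold
  | refl A => intro f; exact Eqv.refl _
  | symm _ ih => intro f; exact (ih f).symm
  | trans _ _ ih₁ ih₂ => intro f; exact (ih₁ f).trans (ih₂ f)
  | tensor _ _ ih₁ ih₂ => intro f; exact Eqv.tensor (ih₁ f) (ih₂ f)
  | imp _ _ ih₁ ih₂ => intro f; exact Eqv.imp (ih₁ f) (ih₂ f)
  | all _ ih => intro f; exact Eqv.all (ih _)
  | bang _ ih => intro f; exact Eqv.bang (ih f)
  | par _ ih => intro f; exact Eqv.par (ih f)

theorem Eqv.sub {A A' : Fm} (h : Eqv A A') :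
    ∀ s : ℕ → Fm, Eqv (A.sub s) (A'.sub s) := by
  induction h with
  | unfold => intro s; exact Eqv.unfold
  | refl A => intro s; exact Eqv.refl _
  | symm _ ih => intro s; exact (ih s).symm
  | trans _ _ ih₁ ih₂ => intro s; exact (ih₁ s).trans (ih₂ s)
  | tensor _ _ ih₁ ih₂ => intro s; exact Eqv.tensor (ih₁ s) (ih₂ s)
  | imp _ _ ih₁ ih₂ => intro s; exact Eqv.imp (ih₁ s) (ih₂ s)
  | all _ ih => intro s; exact Eqv.all (ih _)
  | bang _ ih => intro s; exact Eqv.bang (ih s)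
  | par _ ih => intro s; exact Eqv.par (ih s)

theorem Eqv.sub_pointwise (A : Fm) :
    ∀ s t : ℕ → Fm, (∀ k, Eqv (s k) (t k)) → Eqv (A.sub s) (A.sub t) := by
  induction A with
  | nat => intro s t _; exact Eqv.refl _
  | var k => intro s t h; exact h k
  | tensor A B ihA ihB => intro s t h; exact Eqv.tensor (ihA s t h) (ihB s t h)
  | imp A B ihA ihB => intro s t h; exact Eqv.imp (ihA s t h) (ihB s t h)
  | all A ih =>
    intro s t h
    refine Eqv.all (ih _ _ ?_)
    intro k
    cases k with
    | zero => exact Eqv.refl _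
    | succ k => exact (h k).rename _
  | bang A ih => intro s t h; exact Eqv.bang (ih s t h)
  | par A ih => intro s t h; exact Eqv.par (ih s t h)

theorem Eqv.substVar {B B' A A' : Fm} (a : ℕ) (hB : Eqv B B') (hA : Eqv A A') :
    Eqv (substVar a B A) (substVar a B' A') := by
  refine (hA.sub _).trans (Eqv.sub_pointwise A' _ _ ?_)
  intro k
  by_cases hk : k = a
  · subst hk; simpa using hB
  · simpa [Function.update_of_ne hk] using Eqv.refl _

theorem Eqv.fv_eq {A A' : Fm} (h : Eqv A A') : A.fv = A'.fv := by
  induction h with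
  | unfold => ext k; simp [fv, natUnfold, bool]
  | refl A => rfl
  | symm _ ih => exact ih.symm
  | trans _ _ ih₁ ih₂ => exact ih₁.trans ih₂
  | tensor _ _ ih₁ ih₂ => simp only [fv, ih₁, ih₂]
  | imp _ _ ih₁ ih₂ => simp only [fv, ih₁, ih₂]
  | all _ ih => simp only [fv, ih]
  | bang _ ih => simpa only [fv] using ih
  | par _ ih => simpa only [fv] using ih

end Fm

/-- Formulas modulo the recursive equation `N = ∀α. α ⊸ (B ⊸ N ⊸ α) ⊸ α`. -/
def Formula : Type := Quotient Fm.setoid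

namespace Formula

def nat : Formula := Quotient.mk _ Fm.nat

def var (a : ℕ) : Formula := Quotient.mk _ (Fm.var a)

def tensor : Formula → Formula → Formula :=
  Quotient.map₂ Fm.tensor fun _ _ h _ _ h' => Fm.Eqv.tensor h h'

def imp : Formula → Formula → Formula :=
  Quotient.map₂ Fm.imp fun _ _ h _ _ h' => Fm.Eqv.imp h h'

def bang : Formula → Formula := Quotient.map Fm.bang fun _ _ h => Fm.Eqv.bang h

def par : Formula → Formula := Quotient.map Fm.par fun _ _ h => Fm.Eqv.par h

/-- `∀a.A`. -/
def all (a : ℕ) : Formula → Formula :=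
  Quotient.map (Fm.forallVar a) fun _ _ h => Fm.Eqv.all (h.rename _)

/-- `A.subst a B` is `A[B/a]`. -/
def subst (A : Formula) (a : ℕ) (B : Formula) : Formula :=
  Quotient.map₂ (Fm.substVar a) (fun _ _ h _ _ h' => Fm.Eqv.substVar a h h') B A

def fv : Formula → Set ℕ := Quotient.lift Fm.fv fun _ _ h => Fm.Eqv.fv_eq h

end Formula

/-! ## Graphs -/

/-- An edge: its name (its identity in the graph) and the formula that labels it. -/
structure Edge : Type where
  name : ℕ
  label : Formula

namespace Edge

def rename (f : ℕ → ℕ) (e : Edge) : Edge := ⟨f e.name, e.label⟩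

/-- Substitute `B` for `a` in the label. -/
def subst (a : ℕ) (B : Formula) (e : Edge) : Edge := ⟨e.name, e.label.subst a B⟩

/-- `redirect x y e` is `y` if `e` is the edge `x`, and `e` otherwise. -/
def redirect (x y e : Edge) : Edge := if e.name = x.name then y else e

end Edge

/-- The nodes, each with the edges incident to it (`i`: incoming, `o`: outgoing).
* In `impL f a o` the edge `f` is the incoming function, `a` the incoming argument, and `o` the
  outgoing result.
* In `impR b v o` the edge `b` is the incoming body, `v` the outgoing edge of the abstracted
  input, and `o` the outgoing function.
* `allR i o a` records its eigenvariable `a`.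
* `bangR i o b` is the principal port of the `!`-box named `b`.
* `bangL i o (some b)` is the auxiliary port of the `!`-box `b`, and `bangL i o none` is not a port
  of any `!`-box. -/
inductive Node : Type
  | ax (i o : Edge)
  | cut (i o : Edge)
  | weak (i : Edge)
  | daemon (o : Edge)
  | contr (i o₁ o₂ : Edge)
  | tensorL (i o₁ o₂ : Edge)
  | tensorR (i₁ i₂ o : Edge)
  | impL (f a o : Edge)
  | impR (b v o : Edge)
  | allL (i o : Edge)
  | allR (i o : Edge) (a : ℕ)
  | parL (i o : Edge)
  | parR (i o : Edge)
  | bangL (i o : Edge) (port : Option ℕ)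
  | bangR (i o : Edge) (b : ℕ)

namespace Node

/-- The edges incident to a node. -/
def edges : Node → List Edge
  | ax i o => [i, o]
  | cut i o => [i, o]
  | weak i => [i]
  | daemon o => [o]
  | contr i o₁ o₂ => [i, o₁, o₂]
  | tensorL i o₁ o₂ => [i, o₁, o₂]
  | tensorR i₁ i₂ o => [i₁, i₂, o]
  | impL f a o => [f, a, o]
  | impR b v o => [b, v, o]
  | allL i o => [i, o]
  | allR i o _ => [i, o]
  | parL i o => [i, o]
  | parR i o => [i, o]
  | bangL i o _ => [i, o]
  | bangR i o _ => [i, o]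

/-- Apply `fe` to the edges, `fb` to the box names, and `fa` to the eigenvariable of a node. -/
def map (fe : Edge → Edge) (fb fa : ℕ → ℕ) : Node → Node
  | ax i o => ax (fe i) (fe o)
  | cut i o => cut (fe i) (fe o)
  | weak i => weak (fe i)
  | daemon o => daemon (fe o)
  | contr i o₁ o₂ => contr (fe i) (fe o₁) (fe o₂)
  | tensorL i o₁ o₂ => tensorL (fe i) (fe o₁) (fe o₂)
  | tensorR i₁ i₂ o => tensorR (fe i₁) (fe i₂) (fe o)
  | impL f a o => impL (fe f) (fe a) (fe o)
  | impR b v o => impR (fe b) (fe v) (fe o)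
  | allL i o => allL (fe i) (fe o)
  | allR i o a => allR (fe i) (fe o) (fa a)
  | parL i o => parL (fe i) (fe o)
  | parR i o => parR (fe i) (fe o)
  | bangL i o p => bangL (fe i) (fe o) (p.map fb)
  | bangR i o b => bangR (fe i) (fe o) (fb b)

/-- The constraint that an indexing `I` of the edges has to satisfy at a node. -/
def Respects (I : ℕ → ℤ) : Node → Prop
  | bangL i o _ => I o.name = I i.name + 1
  | parL i o => I o.name = I i.name + 1
  | bangR i o _ => I i.name = I o.name + 1
  | parR i o => I i.name = I o.name + 1
  | n => ∀ e ∈ n.edges, ∀ e' ∈ n.edges, I e.name = I e'.name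

end Node

/-- A node placed in a graph, with the names of the `!`-boxes that contain it. The ports of a box
lie on its border, hence not inside it. -/
structure Cell : Type where
  node : Node
  boxes : Finset ℕ

/-- A finite graph with `!`-boxes, given by its nodes. -/
abbrev Graph : Type := Multiset Cell

namespace Graph

def edges (P : Graph) : Set Edge := {e | ∃ x ∈ P, e ∈ x.node.edges}

def edgeNames (P : Graph) : Set ℕ := {n | ∃ e ∈ edges P, e.name = n}

/-- The names of the `!`-boxes of `P`, one for each `bangR` node. -/
def boxNames (P : Graph) : Set ℕ := {b | ∃ x ∈ P, ∃ i o, x.node = .bangR i o b}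

def eigenvars (P : Graph) : Set ℕ := {a | ∃ x ∈ P, ∃ i o, x.node = .allR i o a}

def map (fe : Edge → Edge) (fb fa : ℕ → ℕ) (P : Graph) : Graph :=
  Multiset.map (fun x => ⟨x.node.map fe fb fa, x.boxes.image fb⟩) P

/-- Put the whole of `P` inside the boxes `K`. -/
def inside (K : Finset ℕ) (P : Graph) : Graph :=
  Multiset.map (fun x => ⟨x.node, x.boxes ∪ K⟩) P

/-- Replace the edge `x` by the edge `y`. -/
def redirect (x y : Edge) (P : Graph) : Graph := map (Edge.redirect x y) id id P

/-- Erase the border of the box `b`: what was inside `b`, and the auxiliary port of `b`, now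
belongs to the box `p` if there is one, and to no new box if `p = none`. -/
def dissolve (b : ℕ) (p : Option ℕ) (P : Graph) : Graph :=
  Multiset.map (fun x =>
    ⟨match x.node with
      | .bangL i o q => .bangL i o (if q = some b then p else q)
      | n => n,
     if b ∈ x.boxes then x.boxes.erase b ∪ p.toFinset else x.boxes⟩) P

/-- `P` and `Q` have no edge and no box in common. -/
def Apart (P Q : Graph) : Prop :=
  Disjoint (edgeNames P) (edgeNames Q) ∧ Disjoint (boxNames P) (boxNames Q)

def CutFree (P : Graph) : Prop := ∀ x ∈ P, ∀ i o, x.node ≠ .cut i o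

end Graph

open _root_.LALL.Graph

/-! ## Proof structures and nets -/

/-- `Proves P Γ c`: the graph `P` is a proof structure with input edges `Γ` and output edge `c`. -/
inductive Proves : Graph → Multiset Edge → Edge → Prop
  | ax {i o : Edge} (hn : i.name ≠ o.name) (hl : i.label = o.label) :
      Proves {⟨.ax i o, ∅⟩} {i} o
  | daemon (o : Edge) : Proves {⟨.daemon o, ∅⟩} 0 o
  | cut {P Q : Graph} {Γ Δ : Multiset Edge} {c d e : Edge}
      (hP : Proves P (e ::ₘ Γ) c) (hQ : Proves Q Δ d) (hPQ : Apart P Q)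
      (hl : d.label = e.label) :
      Proves (⟨.cut d e, ∅⟩ ::ₘ (P + Q)) (Γ + Δ) c
  | weak {P : Graph} {Γ : Multiset Edge} {c i : Edge}
      (hP : Proves P Γ c) (hi : i.name ∉ edgeNames P) :
      Proves (⟨.weak i, ∅⟩ ::ₘ P) (i ::ₘ Γ) c
  | contr {P : Graph} {Γ : Multiset Edge} {c i o₁ o₂ : Edge} {A : Formula}
      (hP : Proves P (o₁ ::ₘ o₂ ::ₘ Γ) c) (hi : i.name ∉ edgeNames P)
      (hl : i.label = A.bang) (hl₁ : o₁.label = A.bang) (hl₂ : o₂.label = A.bang) :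
      Proves (⟨.contr i o₁ o₂, ∅⟩ ::ₘ P) (i ::ₘ Γ) c
  | tensorL {P : Graph} {Γ : Multiset Edge} {c i o₁ o₂ : Edge}
      (hP : Proves P (o₁ ::ₘ o₂ ::ₘ Γ) c) (hi : i.name ∉ edgeNames P)
      (hl : i.label = o₁.label.tensor o₂.label) :
      Proves (⟨.tensorL i o₁ o₂, ∅⟩ ::ₘ P) (i ::ₘ Γ) c
  | tensorR {P Q : Graph} {Γ Δ : Multiset Edge} {c d o : Edge}
      (hP : Proves P Γ c) (hQ : Proves Q Δ d) (hPQ : Apart P Q)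
      (ho : o.name ∉ edgeNames (P + Q)) (hl : o.label = c.label.tensor d.label) :
      Proves (⟨.tensorR c d o, ∅⟩ ::ₘ (P + Q)) (Γ + Δ) o
  | impL {P Q : Graph} {Γ Δ : Multiset Edge} {c d e f : Edge}
      (hP : Proves P (e ::ₘ Γ) c) (hQ : Proves Q Δ d) (hPQ : Apart P Q)
      (hf : f.name ∉ edgeNames (P + Q)) (hl : f.label = d.label.imp e.label) :
      Proves (⟨.impL f d e, ∅⟩ ::ₘ (P + Q)) (f ::ₘ (Γ + Δ)) c
  | impR {P : Graph} {Γ : Multiset Edge} {c v o : Edge}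
      (hP : Proves P (v ::ₘ Γ) c) (ho : o.name ∉ edgeNames P)
      (hl : o.label = v.label.imp c.label) :
      Proves (⟨.impR c v o, ∅⟩ ::ₘ P) Γ o
  | allL {P : Graph} {Γ : Multiset Edge} {c i o : Edge} {a : ℕ} {A B : Formula}
      (hP : Proves P (o ::ₘ Γ) c) (hi : i.name ∉ edgeNames P)
      (hl : i.label = A.all a) (hl' : o.label = A.subst a B) :
      Proves (⟨.allL i o, ∅⟩ ::ₘ P) (i ::ₘ Γ) c
  | allR {P : Graph} {Γ : Multiset Edge} {c o : Edge} {a : ℕ}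
      (hP : Proves P Γ c) (ho : o.name ∉ edgeNames P)
      (ha : ∀ e ∈ Γ, a ∉ e.label.fv) (hl : o.label = c.label.all a) :
      Proves (⟨.allR c o a, ∅⟩ ::ₘ P) Γ o
  | parL {P : Graph} {Γ : Multiset Edge} {c i o : Edge}
      (hP : Proves P (o ::ₘ Γ) c) (hi : i.name ∉ edgeNames P) (hl : i.label = o.label.par) :
      Proves (⟨.parL i o, ∅⟩ ::ₘ P) (i ::ₘ Γ) c
  | parR {P : Graph} {Γ : Multiset Edge} {c o : Edge}
      (hP : Proves P Γ c) (ho : o.name ∉ edgeNames P) (hl : o.label = c.label.par) :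
      Proves (⟨.parR c o, ∅⟩ ::ₘ P) Γ o
  | bangL {P : Graph} {Γ : Multiset Edge} {c i o : Edge}
      (hP : Proves P (o ::ₘ Γ) c) (hi : i.name ∉ edgeNames P) (hl : i.label = o.label.bang) :
      Proves (⟨.bangL i o none, ∅⟩ ::ₘ P) (i ::ₘ Γ) c
  /-- A `!`-box without assumption. -/
  | box₀ {P : Graph} {c o : Edge} {b : ℕ}
      (hP : Proves P 0 c) (ho : o.name ∉ edgeNames P) (hl : o.label = c.label.bang)
      (hb : b ∉ boxNames P) :
      Proves (⟨.bangR c o b, ∅⟩ ::ₘ inside {b} P) 0 o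
  /-- A `!`-box with one assumption. -/
  | box₁ {P : Graph} {c o i e : Edge} {b : ℕ}
      (hP : Proves P {e} c) (ho : o.name ∉ edgeNames P) (hl : o.label = c.label.bang)
      (hi : i.name ∉ edgeNames P) (hio : i.name ≠ o.name) (hl' : i.label = e.label.bang)
      (hb : b ∉ boxNames P) :
      Proves (⟨.bangR c o b, ∅⟩ ::ₘ ⟨.bangL i e (some b), ∅⟩ ::ₘ inside {b} P) {i} o

/-- An indexing of the proof structure `P`, with inputs `Γ` and output `c`. -/
structure IsIndexing (P : Graph) (Γ : Multiset Edge) (c : Edge) (I : ℕ → ℤ) : Prop where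
  respects : ∀ x ∈ P, x.node.Respects I
  input : ∀ e ∈ Γ, I e.name = I c.name

/-- `P` is a net, with inputs `Γ` and output `c`. -/
def IsNet (P : Graph) (Γ : Multiset Edge) (c : Edge) : Prop :=
  Proves P Γ c ∧ ∃ I : ℕ → ℤ, IsIndexing P Γ c I

/-! ## Cut elimination -/

/-- `X` is the content of the box `b`, and `R` lies outside `b` and has no auxiliary port of `b`. -/
structure IsContent (b : ℕ) (X R : Graph) : Prop where
  mem : ∀ x ∈ X, b ∈ x.boxes
  notMem : ∀ x ∈ R, b ∉ x.boxes
  noPort : ∀ x ∈ R, ∀ i o, x.node ≠ .bangL i o (some b)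

/-- The renamings `f` of edges and `g` of boxes turn `B`, a part of `P` placed inside the boxes
`K`, into a fresh copy inside the same boxes. -/
structure IsCopy (P B : Graph) (K : Finset ℕ) (f g : ℕ → ℕ) : Prop where
  edge_inj : Set.InjOn f (edgeNames B)
  edge_fresh : ∀ n ∈ edgeNames B, f n ∉ edgeNames P
  box_inj : Set.InjOn g (boxNames B)
  box_fresh : ∀ b ∈ boxNames B, g b ∉ boxNames P
  outer : ∀ b ∈ K, g b = b

/-- One cut elimination step. In each rule `K` is the set of the boxes around the cut, and `R` is
the rest of the graph. -/
inductive Step : Graph → Graph → Prop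
  -- Linear steps.
  | axL {K : Finset ℕ} {R : Graph} {e₀ e₁ e₂ : Edge} :
      Step (⟨.ax e₀ e₁, K⟩ ::ₘ ⟨.cut e₁ e₂, K⟩ ::ₘ R) (redirect e₂ e₀ R)
  | axR {K : Finset ℕ} {R : Graph} {e₁ e₂ e₃ : Edge} :
      Step (⟨.cut e₁ e₂, K⟩ ::ₘ ⟨.ax e₂ e₃, K⟩ ::ₘ R) (redirect e₁ e₃ R)
  | tensor {K : Finset ℕ} {R : Graph} {i₁ i₂ d e o₁ o₂ : Edge} :
      Step (⟨.tensorR i₁ i₂ d, K⟩ ::ₘ ⟨.cut d e, K⟩ ::ₘ ⟨.tensorL e o₁ o₂, K⟩ ::ₘ R)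
        (⟨.cut i₁ o₁, K⟩ ::ₘ ⟨.cut i₂ o₂, K⟩ ::ₘ R)
  | imp {K : Finset ℕ} {R : Graph} {b v d e a o : Edge} :
      Step (⟨.impR b v d, K⟩ ::ₘ ⟨.cut d e, K⟩ ::ₘ ⟨.impL e a o, K⟩ ::ₘ R)
        (⟨.cut a v, K⟩ ::ₘ ⟨.cut b o, K⟩ ::ₘ R)
  | par {K : Finset ℕ} {R : Graph} {c d e o : Edge} :
      Step (⟨.parR c d, K⟩ ::ₘ ⟨.cut d e, K⟩ ::ₘ ⟨.parL e o, K⟩ ::ₘ R)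
        (⟨.cut c o, K⟩ ::ₘ R)
  /-- `S` is a proof structure above the `allR` node, in which `B` replaces the eigenvariable. -/
  | all {K : Finset ℕ} {S R : Graph} {Γ : Multiset Edge} {c d e o : Edge} {a : ℕ} {B : Formula}
      (hS : Proves S Γ c) (ha : ∀ x ∈ Γ, a ∉ x.label.fv)
      (hB : ∀ a' ∈ eigenvars S, a' ≠ a ∧ a' ∉ B.fv) (ho : o.label = c.label.subst a B) :
      Step (⟨.allR c d a, K⟩ ::ₘ ⟨.cut d e, K⟩ ::ₘ ⟨.allL e o, K⟩ ::ₘ (inside K S + R))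
        (⟨.cut (c.subst a B) o, K⟩ ::ₘ (inside K (Graph.map (Edge.subst a B) id id S) + R))
  -- Exponential steps.
  | bang {K : Finset ℕ} {R : Graph} {c d e o : Edge} {b : ℕ} {p : Option ℕ} :
      Step (⟨.bangR c d b, K⟩ ::ₘ ⟨.cut d e, K⟩ ::ₘ ⟨.bangL e o p, K⟩ ::ₘ R)
        (⟨.cut c o, K ∪ p.toFinset⟩ ::ₘ dissolve b p R)
  | contr₀ {K : Finset ℕ} {P B X R : Graph} {c d e o₁ o₂ : Edge} {b : ℕ} {f g : ℕ → ℕ}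
      (hX : IsContent b X R) (hB : B = ⟨.bangR c d b, K⟩ ::ₘ X)
      (hP : P = ⟨.cut d e, K⟩ ::ₘ ⟨.contr e o₁ o₂, K⟩ ::ₘ (B + R))
      (hc : IsCopy P B K f g) :
      Step P
        (⟨.cut d o₁, K⟩ ::ₘ ⟨.cut (d.rename f) o₂, K⟩ ::ₘ
          (B + Graph.map (Edge.rename f) g id B + R))
  | contr₁ {K : Finset ℕ} {P B X R : Graph} {c d e o₁ o₂ i i₁ i₂ x : Edge} {b : ℕ} {f g : ℕ → ℕ}
      (hX : IsContent b X R) (hB : B = ⟨.bangR c d b, K⟩ ::ₘ X)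
      (hP : P = ⟨.cut d e, K⟩ ::ₘ ⟨.contr e o₁ o₂, K⟩ ::ₘ ⟨.bangL i x (some b), K⟩ ::ₘ (B + R))
      (hc : IsCopy P B K f g)
      (hn : i₁.name ≠ i₂.name)
      (hi₁ : i₁.name ∉ edgeNames P ∪ f '' edgeNames B) (hl₁ : i₁.label = i.label)
      (hi₂ : i₂.name ∉ edgeNames P ∪ f '' edgeNames B) (hl₂ : i₂.label = i.label) :
      Step P
        (⟨.cut d o₁, K⟩ ::ₘ ⟨.cut (d.rename f) o₂, K⟩ ::ₘ ⟨.contr i i₁ i₂, K⟩ ::ₘ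
          ⟨.bangL i₁ x (some b), K⟩ ::ₘ ⟨.bangL i₂ (x.rename f) (some (g b)), K⟩ ::ₘ
          (B + Graph.map (Edge.rename f) g id B + R))
  -- Garbage collection.
  | daemonWeak {K : Finset ℕ} {R : Graph} {d e : Edge} :
      Step (⟨.daemon d, K⟩ ::ₘ ⟨.cut d e, K⟩ ::ₘ ⟨.weak e, K⟩ ::ₘ R) R
  | tensorWeak {K : Finset ℕ} {P R : Graph} {i₁ i₂ d e x₁ x₂ : Edge}
      (hP : P = ⟨.tensorR i₁ i₂ d, K⟩ ::ₘ ⟨.cut d e, K⟩ ::ₘ ⟨.weak e, K⟩ ::ₘ R)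
      (hn : x₁.name ≠ x₂.name)
      (hx₁ : x₁.name ∉ edgeNames P) (hl₁ : x₁.label = i₁.label)
      (hx₂ : x₂.name ∉ edgeNames P) (hl₂ : x₂.label = i₂.label) :
      Step P
        (⟨.cut i₁ x₁, K⟩ ::ₘ ⟨.weak x₁, K⟩ ::ₘ ⟨.cut i₂ x₂, K⟩ ::ₘ ⟨.weak x₂, K⟩ ::ₘ R)
  | impWeak {K : Finset ℕ} {P R : Graph} {b v d e x y : Edge}
      (hP : P = ⟨.impR b v d, K⟩ ::ₘ ⟨.cut d e, K⟩ ::ₘ ⟨.weak e, K⟩ ::ₘ R)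
      (hn : x.name ≠ y.name)
      (hx : x.name ∉ edgeNames P) (hlx : x.label = b.label)
      (hy : y.name ∉ edgeNames P) (hly : y.label = v.label) :
      Step P
        (⟨.cut b x, K⟩ ::ₘ ⟨.weak x, K⟩ ::ₘ ⟨.daemon y, K⟩ ::ₘ ⟨.cut y v, K⟩ ::ₘ R)
  | allWeak {K : Finset ℕ} {P R : Graph} {c d e x : Edge} {a : ℕ}
      (hP : P = ⟨.allR c d a, K⟩ ::ₘ ⟨.cut d e, K⟩ ::ₘ ⟨.weak e, K⟩ ::ₘ R)
      (hx : x.name ∉ edgeNames P) (hl : x.label = c.label) :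
      Step P (⟨.cut c x, K⟩ ::ₘ ⟨.weak x, K⟩ ::ₘ R)
  | parWeak {K : Finset ℕ} {P R : Graph} {c d e x : Edge}
      (hP : P = ⟨.parR c d, K⟩ ::ₘ ⟨.cut d e, K⟩ ::ₘ ⟨.weak e, K⟩ ::ₘ R)
      (hx : x.name ∉ edgeNames P) (hl : x.label = c.label) :
      Step P (⟨.cut c x, K⟩ ::ₘ ⟨.weak x, K⟩ ::ₘ R)
  | bangWeak₀ {K : Finset ℕ} {X R : Graph} {c d e : Edge} {b : ℕ} (hX : IsContent b X R) :
      Step (⟨.bangR c d b, K⟩ ::ₘ ⟨.cut d e, K⟩ ::ₘ ⟨.weak e, K⟩ ::ₘ (X + R)) R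
  | bangWeak₁ {K : Finset ℕ} {X R : Graph} {c d e i x : Edge} {b : ℕ} (hX : IsContent b X R) :
      Step (⟨.bangR c d b, K⟩ ::ₘ ⟨.bangL i x (some b), K⟩ ::ₘ ⟨.cut d e, K⟩ ::ₘ
          ⟨.weak e, K⟩ ::ₘ (X + R))
        (⟨.weak i, K⟩ ::ₘ R)
  | daemonContr {K : Finset ℕ} {P R : Graph} {d e o₁ o₂ y₁ y₂ : Edge}
      (hP : P = ⟨.daemon d, K⟩ ::ₘ ⟨.cut d e, K⟩ ::ₘ ⟨.contr e o₁ o₂, K⟩ ::ₘ R)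
      (hn : y₁.name ≠ y₂.name)
      (hy₁ : y₁.name ∉ edgeNames P) (hl₁ : y₁.label = o₁.label)
      (hy₂ : y₂.name ∉ edgeNames P) (hl₂ : y₂.label = o₂.label) :
      Step P
        (⟨.daemon y₁, K⟩ ::ₘ ⟨.cut y₁ o₁, K⟩ ::ₘ ⟨.daemon y₂, K⟩ ::ₘ ⟨.cut y₂ o₂, K⟩ ::ₘ R)
  | daemonTensor {K : Finset ℕ} {P R : Graph} {d e o₁ o₂ y₁ y₂ : Edge}
      (hP : P = ⟨.daemon d, K⟩ ::ₘ ⟨.cut d e, K⟩ ::ₘ ⟨.tensorL e o₁ o₂, K⟩ ::ₘ R)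
      (hn : y₁.name ≠ y₂.name)
      (hy₁ : y₁.name ∉ edgeNames P) (hl₁ : y₁.label = o₁.label)
      (hy₂ : y₂.name ∉ edgeNames P) (hl₂ : y₂.label = o₂.label) :
      Step P
        (⟨.daemon y₁, K⟩ ::ₘ ⟨.cut y₁ o₁, K⟩ ::ₘ ⟨.daemon y₂, K⟩ ::ₘ ⟨.cut y₂ o₂, K⟩ ::ₘ R)
  | daemonImp {K : Finset ℕ} {P R : Graph} {d e a o x y : Edge}
      (hP : P = ⟨.daemon d, K⟩ ::ₘ ⟨.cut d e, K⟩ ::ₘ ⟨.impL e a o, K⟩ ::ₘ R)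
      (hn : x.name ≠ y.name)
      (hx : x.name ∉ edgeNames P) (hlx : x.label = a.label)
      (hy : y.name ∉ edgeNames P) (hly : y.label = o.label) :
      Step P
        (⟨.cut a x, K⟩ ::ₘ ⟨.weak x, K⟩ ::ₘ ⟨.daemon y, K⟩ ::ₘ ⟨.cut y o, K⟩ ::ₘ R)
  | daemonAll {K : Finset ℕ} {P R : Graph} {d e o y : Edge}
      (hP : P = ⟨.daemon d, K⟩ ::ₘ ⟨.cut d e, K⟩ ::ₘ ⟨.allL e o, K⟩ ::ₘ R)
      (hy : y.name ∉ edgeNames P) (hl : y.label = o.label) :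
      Step P (⟨.daemon y, K⟩ ::ₘ ⟨.cut y o, K⟩ ::ₘ R)
  | daemonPar {K : Finset ℕ} {P R : Graph} {d e o y : Edge}
      (hP : P = ⟨.daemon d, K⟩ ::ₘ ⟨.cut d e, K⟩ ::ₘ ⟨.parL e o, K⟩ ::ₘ R)
      (hy : y.name ∉ edgeNames P) (hl : y.label = o.label) :
      Step P (⟨.daemon y, K⟩ ::ₘ ⟨.cut y o, K⟩ ::ₘ R)
  | daemonBang {K : Finset ℕ} {P R : Graph} {d e o y : Edge} {p : Option ℕ}
      (hP : P = ⟨.daemon d, K⟩ ::ₘ ⟨.cut d e, K⟩ ::ₘ ⟨.bangL e o p, K⟩ ::ₘ R)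
      (hy : y.name ∉ edgeNames P) (hl : y.label = o.label) :
      Step P (⟨.daemon y, K ∪ p.toFinset⟩ ::ₘ ⟨.cut y o, K ∪ p.toFinset⟩ ::ₘ R)

/-- Renaming of the eigenvariable `a` of one `allR` node to `a'`. Nets are, as usual, considered up
to the names of their eigenvariables: `a` is bound in a proof structure `S` above the node. -/
inductive EigenRename : Graph → Graph → Prop
  | mk {K : Finset ℕ} {S R : Graph} {Γ : Multiset Edge} {c d : Edge} {a a' : ℕ}
      (hS : Proves S Γ c) (ha : ∀ x ∈ Γ, a ∉ x.label.fv)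
      (ha' : ∀ x ∈ edges S, a' ∉ x.label.fv) (he : a' ∉ eigenvars S) :
      EigenRename (⟨.allR c d a, K⟩ ::ₘ (inside K S + R))
        (⟨.allR (c.subst a (.var a')) d a', K⟩ ::ₘ
          (inside K (Graph.map (Edge.subst a (.var a')) id (fun k => if k = a then a' else k) S)
            + R))

/-- The net `P` reduces to the net `P'`: finitely many cut elimination steps, up to the names of
eigenvariables, through nets with the same inputs `Γ` and the same output `c`. -/
def Reduces (Γ : Multiset Edge) (c : Edge) : Graph → Graph → Prop :=
  Relation.ReflTransGen fun P P' => (Step P P' ∨ EigenRename P P') ∧ IsNet P' Γ c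

end LALL

/-! Neither the size of formulas nor the number of nodes can serve as a global termination measure:
`N` is recursive, quantification is impredicative, and contraction duplicates boxes. The indexing
replaces them. The edges of a cut share one level, no step moves a cut to a lower level, and opening
a `!`-box moves the cut strictly up. Cuts are therefore removed level by level, from the lowest one,
and since levels are bounded this ends.

`Good I j P` says that all cuts of `P` have level at least `j`; the core is the passage from `j` to
`j + 1` (`Net.evt_good`), in two phases. (1) As long as some cut is not a cut with a `!`-box, a step
is available that lowers a simple node count and creates no lower cut (`evt_principal`,
`evt_cut_of_not_bangOut`, `Proves.bangCuts_or_lighter`). This leaves cuts with boxes only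
(`Net.evt_bangCuts`). (2) The boxes cut at level `j` are treated with the innermost ones first
(`Proves.evt_good`). A box whose content has only cuts above `j` is pushed up through the structure
`P` it is cut with: contractions duplicate it, weakenings erase it, axioms absorb the cut, and a
`!`-left node or another box opens it, with the new cut at level at least `j + 1`. This is an
induction on the derivation of `P`, and it terminates because `P` has no cut of level `j` itself.
Contraction turns one box into two, so the induction hypothesis concerns a whole family of boxes cut
with inputs of `P` (`Boxes`, `Absorbs`, `Proves.absorbs`).

Proof structures are graphs, so moving a cut past a rule that does not act on its edge leaves the
graph unchanged: there are no commutative conversions, and inductions on a derivation simply regroup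
multisets of nodes. The price is bookkeeping. Steps act on the whole net, and names must be fresh
for the whole net, so every reduction is stated in all contexts at once (`Evt`), and `Evt.frame`
makes it compatible with each rule. Moving a structure past a `∀`-right node needs its inputs to
avoid the eigenvariable, which `Proves.evt_eigenvars` arranges by renaming.

A single function `I` indexes all the nets of a reduction. To give a new edge any required level,
the indexing is first made periodic in the edge names (`IsIndexing.mod`, `Recurrent`): every level
then occurs on infinitely many names, and levels stay bounded. With levels in `[-B, B]`, raising the
lower bound on cuts `2 * B + 1` times leaves no room for a cut (`IsNet.exists_reduces_cutFree`). -/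

namespace LALL

/-! ### Substitution and the recursive congruence on raw formulas -/

namespace Fm

theorem rename_congr (A : Fm) : ∀ {f g : ℕ → ℕ}, (∀ k ∈ A.fv, f k = g k) →
    A.rename f = A.rename g := by
  induction A with
  | nat => intros; rfl
  | var k => intro f g h; simp [rename, h k (by simp [fv])]
  | tensor A B ihA ihB =>
    intro f g h; simp only [rename]
    rw [ihA fun k hk => h k (Or.inl hk), ihB fun k hk => h k (Or.inr hk)]
  | imp A B ihA ihB =>
    intro f g h; simp only [rename]
    rw [ihA fun k hk => h k (Or.inl hk), ihB fun k hk => h k (Or.inr hk)]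
  | all A ih =>
    intro f g h; simp only [rename]
    rw [ih]
    rintro (_ | k) hk
    · rfl
    · simp [upRen, h k hk]
  | bang A ih => intro f g h; simp only [rename]; rw [ih h]
  | par A ih => intro f g h; simp only [rename]; rw [ih h]

theorem sub_congr (A : Fm) : ∀ {s t : ℕ → Fm}, (∀ k ∈ A.fv, s k = t k) → A.sub s = A.sub t := by
  induction A with
  | nat => intros; rfl
  | var k => intro f g h; simp [sub, h k (by simp [fv])]
  | tensor A B ihA ihB =>
    intro f g h; simp only [sub]
    rw [ihA fun k hk => h k (Or.inl hk), ihB fun k hk => h k (Or.inr hk)]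
  | imp A B ihA ihB =>
    intro f g h; simp only [sub]
    rw [ihA fun k hk => h k (Or.inl hk), ihB fun k hk => h k (Or.inr hk)]
  | all A ih =>
    intro f g h; simp only [sub]
    rw [ih]
    rintro (_ | k) hk
    · rfl
    · simp [upSub, h k hk]
  | bang A ih => intro f g h; simp only [sub]; rw [ih h]
  | par A ih => intro f g h; simp only [sub]; rw [ih h]

theorem sub_var (A : Fm) : A.sub var = A := by
  have hup : upSub var = var := by funext k; cases k <;> rfl
  induction A <;> simp_all [sub]

theorem rename_sub (A : Fm) : ∀ (f : ℕ → ℕ) (t : ℕ → Fm),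
    (A.rename f).sub t = A.sub (fun k => t (f k)) := by
  induction A with
  | all A ih =>
    intro f t; simp only [rename, sub, ih]
    congr 2; funext k; cases k <;> rfl
  | _ => intros; simp_all [rename, sub]

theorem rename_rename (A : Fm) : ∀ (f g : ℕ → ℕ),
    (A.rename f).rename g = A.rename (fun k => g (f k)) := by
  induction A with
  | all A ih =>
    intro f t; simp only [rename, ih]
    congr 2; funext k; cases k <;> rfl
  | _ => intros; simp_all [rename]

theorem sub_rename (A : Fm) : ∀ (s : ℕ → Fm) (f : ℕ → ℕ),
    (A.sub s).rename f = A.sub (fun k => (s k).rename f) := by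
  induction A with
  | all A ih =>
    intro s f; simp only [rename, sub, ih]
    congr 2; funext k
    cases k with
    | zero => rfl
    | succ k => simp only [upSub, rename_rename]; rfl
  | _ => intros; simp_all [rename, sub]

theorem sub_sub (A : Fm) : ∀ (s t : ℕ → Fm),
    (A.sub s).sub t = A.sub (fun k => (s k).sub t) := by
  induction A with
  | all A ih =>
    intro s t; simp only [sub, ih]
    congr 2; funext k
    cases k with
    | zero => rfl
    | succ k => simp only [upSub, rename_sub, sub_rename]
  | _ => intros; simp_all [sub]

theorem fv_rename (A : Fm) : ∀ (f : ℕ → ℕ), (A.rename f).fv ⊆ f '' A.fv := by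
  induction A with
  | nat => intro f; simp [rename, fv]
  | var k => intro f; simp [rename, fv]
  | tensor A B ihA ihB =>
    intro f; simp only [rename, fv, Set.image_union]; exact Set.union_subset_union (ihA f) (ihB f)
  | imp A B ihA ihB =>
    intro f; simp only [rename, fv, Set.image_union]; exact Set.union_subset_union (ihA f) (ihB f)
  | all A ih =>
    intro f m hm
    obtain ⟨k, hk, hk'⟩ := ih _ hm
    cases k with
    | zero => simp [upRen] at hk'
    | succ k => exact ⟨k, hk, by simpa [upRen] using hk'⟩
  | bang A ih => exact ih
  | par A ih => exact ih

theorem fv_sub (A : Fm) : ∀ (s : ℕ → Fm), ∀ m ∈ (A.sub s).fv, ∃ k ∈ A.fv, m ∈ (s k).fv := by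
  induction A with
  | nat => intro s m hm; simp [sub, fv] at hm
  | var k => intro s m hm; exact ⟨k, rfl, hm⟩
  | tensor A B ihA ihB =>
    rintro s m (hm | hm)
    · obtain ⟨k, hk, h⟩ := ihA s m hm; exact ⟨k, Or.inl hk, h⟩
    · obtain ⟨k, hk, h⟩ := ihB s m hm; exact ⟨k, Or.inr hk, h⟩
  | imp A B ihA ihB =>
    rintro s m (hm | hm)
    · obtain ⟨k, hk, h⟩ := ihA s m hm; exact ⟨k, Or.inl hk, h⟩
    · obtain ⟨k, hk, h⟩ := ihB s m hm; exact ⟨k, Or.inr hk, h⟩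
  | all A ih =>
    intro s m hm
    obtain ⟨k, hk, h⟩ := ih _ _ hm
    cases k with
    | zero => simp [upSub, fv] at h
    | succ k =>
      obtain ⟨l, hl, hl'⟩ := fv_rename _ _ h
      obtain rfl : l = m := by simpa using hl'
      exact ⟨k, hk, hl⟩
  | bang A ih => exact ih
  | par A ih => exact ih

theorem finite_fv (A : Fm) : A.fv.Finite := by
  induction A with
  | nat => exact Set.finite_empty
  | var k => exact Set.finite_singleton k
  | tensor A B ihA ihB => exact ihA.union ihB
  | imp A B ihA ihB => exact ihA.union ihB
  | all A ih => exact ih.preimage (f := fun k => k + 1) (fun _ _ _ _ h => by simpa using h)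
  | bang A ih => exact ih
  | par A ih => exact ih

/-- The outermost connective, `nat` being read as its unfolding. -/
def head : Fm → ℕ
  | nat => 0
  | var _ => 1
  | tensor _ _ => 2
  | imp _ _ => 3
  | all _ => 0
  | bang _ => 4
  | par _ => 5

theorem Eqv.head_eq {A B : Fm} (h : Eqv A B) : A.head = B.head := by
  induction h with
  | symm _ ih => exact ih.symm
  | trans _ _ ih₁ ih₂ => exact ih₁.trans ih₂
  | _ => rfl

/-- The two formulas have the same outermost connective and equivalent immediate subformulas,
`nat` being read as its unfolding. -/
inductive Match : Fm → Fm → Prop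
  | nat : Match nat nat
  | natAll {A : Fm} : Eqv (imp (var 0) (imp (imp bool (imp nat (var 0))) (var 0))) A →
      Match nat (all A)
  | allNat {A : Fm} : Eqv A (imp (var 0) (imp (imp bool (imp nat (var 0))) (var 0))) →
      Match (all A) nat
  | var (k : ℕ) : Match (var k) (var k)
  | tensor {A A' B B' : Fm} : Eqv A A' → Eqv B B' → Match (tensor A B) (tensor A' B')
  | imp {A A' B B' : Fm} : Eqv A A' → Eqv B B' → Match (imp A B) (imp A' B')
  | all {A A' : Fm} : Eqv A A' → Match (all A) (all A')
  | bang {A A' : Fm} : Eqv A A' → Match (bang A) (bang A')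
  | par {A A' : Fm} : Eqv A A' → Match (par A) (par A')

theorem Match.refl (A : Fm) : Match A A := by
  cases A <;> constructor <;> exact Eqv.refl _

theorem Match.symm {A B : Fm} (h : Match A B) : Match B A := by
  cases h <;> constructor <;> apply Eqv.symm <;> assumption

theorem Match.trans {A B C : Fm} (h : Match A B) (h' : Match B C) : Match A C := by
  cases h <;> cases h' <;> constructor <;>
    first | assumption | exact Eqv.refl _ | (apply Eqv.trans <;> assumption)

/-- `Match` is an equivalence relation containing all the generators of the congruence. Only
transitivity through `nat` is delicate: two quantified formulas matched with `nat` both have a body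
equivalent to that of the unfolding, so their bodies are equivalent to each other. This inverts the
congruence: connectives are injective modulo the recursive equation, and distinct connectives never
become equal. -/
theorem Eqv.match {A B : Fm} (h : Eqv A B) : Match A B := by
  induction h with
  | unfold => exact .natAll (Eqv.refl _)
  | refl A => exact Match.refl A
  | symm _ ih => exact ih.symm
  | trans _ _ ih₁ ih₂ => exact ih₁.trans ih₂
  | tensor h₁ h₂ => exact .tensor h₁ h₂
  | imp h₁ h₂ => exact .imp h₁ h₂
  | all h => exact .all h
  | bang h => exact .bang h
  | par h => exact .par h

end Fm

/-! ### Connectives and substitution modulo the recursive equation -/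

namespace Formula

/-- Since the two edges of a cut carry the same formula, comparing heads rules out a cut between
nodes of different connectives. -/
def head : Formula → ℕ := Quotient.lift Fm.head fun _ _ h => Fm.Eqv.head_eq h

@[simp] theorem head_tensor (A B : Formula) : (A.tensor B).head = 2 := by
  induction A using Quotient.inductionOn; induction B using Quotient.inductionOn; rfl
@[simp] theorem head_imp (A B : Formula) : (A.imp B).head = 3 := by
  induction A using Quotient.inductionOn; induction B using Quotient.inductionOn; rfl
@[simp] theorem head_all (A : Formula) (a : ℕ) : (A.all a).head = 0 := by
  induction A using Quotient.inductionOn; rfl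
@[simp] theorem head_bang (A : Formula) : A.bang.head = 4 := by
  induction A using Quotient.inductionOn; rfl
@[simp] theorem head_par (A : Formula) : A.par.head = 5 := by
  induction A using Quotient.inductionOn; rfl

theorem tensor_inj {A B A' B' : Formula} (h : A.tensor B = A'.tensor B') : A = A' ∧ B = B' := by
  induction A using Quotient.inductionOn; induction B using Quotient.inductionOn
  induction A' using Quotient.inductionOn; induction B' using Quotient.inductionOn
  have h' := (Quotient.exact h : Fm.Eqv _ _).match
  cases h' with
  | tensor h₁ h₂ => exact ⟨Quotient.sound h₁, Quotient.sound h₂⟩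

theorem imp_inj {A B A' B' : Formula} (h : A.imp B = A'.imp B') : A = A' ∧ B = B' := by
  induction A using Quotient.inductionOn; induction B using Quotient.inductionOn
  induction A' using Quotient.inductionOn; induction B' using Quotient.inductionOn
  have h' := (Quotient.exact h : Fm.Eqv _ _).match
  cases h' with
  | imp h₁ h₂ => exact ⟨Quotient.sound h₁, Quotient.sound h₂⟩

theorem bang_inj {A A' : Formula} (h : A.bang = A'.bang) : A = A' := by
  induction A using Quotient.inductionOn; induction A' using Quotient.inductionOn
  have h' := (Quotient.exact h : Fm.Eqv _ _).match
  cases h' with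
  | bang h₁ => exact Quotient.sound h₁

theorem par_inj {A A' : Formula} (h : A.par = A'.par) : A = A' := by
  induction A using Quotient.inductionOn; induction A' using Quotient.inductionOn
  have h' := (Quotient.exact h : Fm.Eqv _ _).match
  cases h' with
  | par h₁ => exact Quotient.sound h₁

/-- Substituting for a named variable is the same as instantiating index `0` in the body of the
closed formula, and equal quantified formulas have equivalent bodies. In a quantifier cut it
reconciles the formula above `∀`-right with the instance below `∀`-left, where the bound variables
may be named differently. -/
theorem subst_eq_of_all_eq {A A' : Formula} {a a' : ℕ} (h : A.all a = A'.all a') (B : Formula) :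
    A.subst a B = A'.subst a' B := by
  induction A using Quotient.inductionOn with | h A => ?_
  induction A' using Quotient.inductionOn with | h A' => ?_
  induction B using Quotient.inductionOn with | h B => ?_
  have h' := (Quotient.exact h : Fm.Eqv _ _).match
  cases h' with
  | all h₁ =>
    -- Substitution for `b` factors through the closure of `b`; the right-hand side depends only on
    -- the body of the quantified formula.
    have key : ∀ (C : Fm) (b : ℕ), Fm.substVar b B C =
        (C.rename (Fm.close b)).sub (fun k => Nat.casesOn k B Fm.var) := by
      intro C b
      rw [Fm.rename_sub]
      refine Fm.sub_congr C fun k _ => ?_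
      by_cases hk : k = b <;> simp [Fm.close, hk]
    refine Quotient.sound ?_
    show Fm.Eqv (Fm.substVar a B A) (Fm.substVar a' B A')
    rw [key, key]
    exact h₁.sub _

theorem subst_of_notMem {A : Formula} {a : ℕ} (h : a ∉ A.fv) (B : Formula) :
    A.subst a B = A := by
  induction A using Quotient.inductionOn with | h A => ?_
  induction B using Quotient.inductionOn with | h B => ?_
  refine congrArg (Quotient.mk _) ?_
  show A.sub _ = A
  conv_rhs => rw [← Fm.sub_var A]
  refine Fm.sub_congr A fun k hk => ?_
  rw [Function.update_of_ne]
  rintro rfl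
  exact h hk

theorem all_subst_var {A : Formula} {a a' : ℕ} (h : a' ∉ A.fv) :
    (A.subst a (var a')).all a' = A.all a := by
  induction A using Quotient.inductionOn with | h A => ?_
  refine congrArg (Quotient.mk _) ?_
  show Fm.all ((A.sub _).rename _) = Fm.all _
  rw [Fm.sub_rename]
  have : A.rename (Fm.close a) = A.sub (fun k => Fm.var (Fm.close a k)) := by
    rw [← Fm.rename_sub, Fm.sub_var]
  rw [this]
  congr 1
  refine Fm.sub_congr A fun k hk => ?_
  by_cases hka : k = a
  · subst hka; simp [Fm.rename, Fm.close]
  · have : k ≠ a' := by rintro rfl; exact h hk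
    simp [Fm.rename, Fm.close, hka, this]

theorem subst_all {A B : Formula} {a b : ℕ} (hab : a ≠ b) (ha : a ∉ B.fv) :
    (A.all a).subst b B = (A.subst b B).all a := by
  induction A using Quotient.inductionOn with | h A => ?_
  induction B using Quotient.inductionOn with | h B => ?_
  refine congrArg (Quotient.mk _) ?_
  show Fm.all ((A.rename _).sub _) = Fm.all ((A.sub _).rename _)
  rw [Fm.rename_sub, Fm.sub_rename]
  congr 1
  refine Fm.sub_congr A fun k hk => ?_
  by_cases hka : k = a
  · subst hka; simp [Function.update_of_ne hab, Fm.rename, Fm.close, Fm.upSub]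
  · simp only [Fm.close, hka, if_false, Fm.upSub]
    by_cases hkb : k = b
    · subst hkb
      simp only [Function.update_self]
      refine Fm.rename_congr B fun m hm => ?_
      have : m ≠ a := by rintro rfl; exact ha hm
      simp [this, Fm.close]
    · simp [Function.update_of_ne hkb, Fm.rename, Fm.close, hka]

theorem subst_subst {A B C : Formula} {a b : ℕ} (hab : a ≠ b) (ha : a ∉ C.fv) :
    (A.subst a B).subst b C = (A.subst b C).subst a (B.subst b C) := by
  induction A using Quotient.inductionOn with | h A => ?_
  induction B using Quotient.inductionOn with | h B => ?_
  induction C using Quotient.inductionOn with | h C => ?_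
  refine congrArg (Quotient.mk _) ?_
  show (A.sub _).sub _ = (A.sub _).sub _
  rw [Fm.sub_sub, Fm.sub_sub]
  refine Fm.sub_congr A fun k _ => ?_
  by_cases hka : k = a
  · subst hka; simp [Function.update_of_ne hab, Fm.sub, Fm.substVar]
  · by_cases hkb : k = b
    · subst hkb
      simp only [Function.update_of_ne hka, Function.update_self, Fm.sub]
      conv_lhs => rw [← Fm.sub_var C]
      refine Fm.sub_congr C fun m hm => ?_
      have : m ≠ a := by rintro rfl; exact ha hm
      simp [Function.update_of_ne this]
    · simp [Function.update_of_ne hka, Function.update_of_ne hkb, Fm.sub]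

theorem notMem_fv_subst {A B : Formula} {a b : ℕ} (h : a ∉ A.fv) (h' : a ∉ B.fv) :
    a ∉ (A.subst b B).fv := by
  induction A using Quotient.inductionOn with | h A => ?_
  induction B using Quotient.inductionOn with | h B => ?_
  intro ha
  obtain ⟨k, hk, hk'⟩ := Fm.fv_sub A _ a ha
  by_cases hkb : k = b
  · subst hkb; simp only [Function.update_self] at hk'; exact h' hk'
  · simp only [Function.update_of_ne hkb, Fm.fv, Set.mem_singleton_iff] at hk'
    subst hk'; exact h hk

theorem finite_fv (A : Formula) : A.fv.Finite := by
  induction A using Quotient.inductionOn with | h A => exact Fm.finite_fv A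

/-- A `∀`-left node remains a `∀`-left node under any substitution: if its bound variable would
clash with `b` or be captured in `C`, it is renamed to a fresh one. Hence substitution in proof
structures restricts eigenvariables only. -/
theorem exists_subst_all (A B C : Formula) (a b : ℕ) :
    ∃ (A' B' : Formula) (a' : ℕ), (A.all a).subst b C = A'.all a' ∧
      (A.subst a B).subst b C = A'.subst a' B' := by
  obtain ⟨a', ha'⟩ := ((A.finite_fv.union C.finite_fv).union (Set.finite_singleton b)).exists_notMem
  simp only [Set.mem_union, Set.mem_singleton_iff, not_or] at ha'
  obtain ⟨⟨h₁, h₂⟩, h₃⟩ := ha'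
  have h := all_subst_var (a := a) h₁
  refine ⟨(A.subst a (var a')).subst b C, B.subst b C, a', ?_, ?_⟩
  · rw [← h, subst_all h₃ h₂]
  · rw [← subst_eq_of_all_eq h B, subst_subst h₃ h₂]

theorem subst_tensor (A B C : Formula) (a : ℕ) :
    (A.tensor B).subst a C = (A.subst a C).tensor (B.subst a C) := by
  induction A using Quotient.inductionOn; induction B using Quotient.inductionOn
  induction C using Quotient.inductionOn; rfl
theorem subst_imp (A B C : Formula) (a : ℕ) :
    (A.imp B).subst a C = (A.subst a C).imp (B.subst a C) := by
  induction A using Quotient.inductionOn; induction B using Quotient.inductionOn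
  induction C using Quotient.inductionOn; rfl
theorem subst_bang (A C : Formula) (a : ℕ) : A.bang.subst a C = (A.subst a C).bang := by
  induction A using Quotient.inductionOn; induction C using Quotient.inductionOn; rfl
theorem subst_par (A C : Formula) (a : ℕ) : A.par.subst a C = (A.subst a C).par := by
  induction A using Quotient.inductionOn; induction C using Quotient.inductionOn; rfl

theorem fv_var (a : ℕ) : (var a).fv = {a} := rfl

end Formula

open _root_.LALL.Graph

/-! ## Names -/

/-- The names of the edges incident to a node. -/
def Node.names (n : Node) : Set ℕ := {m | ∃ e ∈ n.edges, e.name = m}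

/-- The box of which the node is the principal port. -/
def Node.owns : Node → Set ℕ
  | .bangR _ _ b => {b}
  | _ => ∅

/-- The boxes of which the node is a port. -/
def Node.uses : Node → Set ℕ
  | .bangR _ _ b => {b}
  | .bangL _ _ (some b) => {b}
  | _ => ∅

/-- The eigenvariable of a node. -/
def Node.eigen : Node → Set ℕ
  | .allR _ _ a => {a}
  | _ => ∅

/-- The boxes that are mentioned in a graph. -/
def boxUses (P : Graph) : Set ℕ := {b | ∃ x ∈ P, b ∈ x.boxes ∨ b ∈ x.node.uses}

/-- The names of the edges in a multiset. -/
def namesOf (Γ : Multiset Edge) : Set ℕ := {n | ∃ e ∈ Γ, e.name = n}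

@[simp] theorem mem_namesOf_zero (n : ℕ) : n ∈ namesOf 0 ↔ False := by simp [namesOf]
@[simp] theorem mem_namesOf_cons (n : ℕ) (e : Edge) (Γ : Multiset Edge) :
    n ∈ namesOf (e ::ₘ Γ) ↔ n = e.name ∨ n ∈ namesOf Γ := by simp [namesOf, eq_comm]
@[simp] theorem mem_namesOf_singleton (n : ℕ) (e : Edge) :
    n ∈ namesOf {e} ↔ n = e.name := by simp [namesOf, eq_comm]
@[simp] theorem mem_namesOf_add (n : ℕ) (Γ Δ : Multiset Edge) :
    n ∈ namesOf (Γ + Δ) ↔ n ∈ namesOf Γ ∨ n ∈ namesOf Δ := by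
  simp [namesOf, or_and_right, exists_or]

section
variable (n : ℕ) (x : Cell) (P Q : Graph) (K : Finset ℕ)

theorem mem_edgeNames : n ∈ edgeNames P ↔ ∃ x ∈ P, n ∈ x.node.names := by
  simp only [edgeNames, edges, Node.names, Set.mem_ofPred_eq]
  constructor
  · rintro ⟨e, ⟨x, hx, he⟩, rfl⟩; exact ⟨x, hx, e, he, rfl⟩
  · rintro ⟨x, hx, e, he, rfl⟩; exact ⟨e, ⟨x, hx, he⟩, rfl⟩
theorem mem_boxNames : n ∈ boxNames P ↔ ∃ x ∈ P, n ∈ x.node.owns := by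
  simp only [boxNames, Set.mem_ofPred_eq]
  refine exists_congr fun x => and_congr_right fun _ => ?_
  cases x.node <;> simp [Node.owns, eq_comm]
theorem mem_eigenvars : n ∈ eigenvars P ↔ ∃ x ∈ P, n ∈ x.node.eigen := by
  simp only [eigenvars, Set.mem_ofPred_eq]
  refine exists_congr fun x => and_congr_right fun _ => ?_
  cases x.node <;> simp [Node.eigen, eq_comm]

@[simp] theorem mem_edgeNames_zero : n ∈ edgeNames 0 ↔ False := by simp [mem_edgeNames]
@[simp] theorem mem_edgeNames_cons :
    n ∈ edgeNames (x ::ₘ P) ↔ n ∈ x.node.names ∨ n ∈ edgeNames P := by simp [mem_edgeNames]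
@[simp] theorem mem_edgeNames_singleton :
    n ∈ edgeNames {x} ↔ n ∈ x.node.names := by simp [mem_edgeNames]
@[simp] theorem mem_edgeNames_add :
    n ∈ edgeNames (P + Q) ↔ n ∈ edgeNames P ∨ n ∈ edgeNames Q := by
  simp [mem_edgeNames, or_and_right, exists_or]
@[simp] theorem mem_edgeNames_inside : n ∈ edgeNames (inside K P) ↔ n ∈ edgeNames P := by
  simp [mem_edgeNames, inside]

@[simp] theorem mem_boxNames_zero : n ∈ boxNames 0 ↔ False := by simp [mem_boxNames]
@[simp] theorem mem_boxNames_cons :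
    n ∈ boxNames (x ::ₘ P) ↔ n ∈ x.node.owns ∨ n ∈ boxNames P := by simp [mem_boxNames]
@[simp] theorem mem_boxNames_singleton :
    n ∈ boxNames {x} ↔ n ∈ x.node.owns := by simp [mem_boxNames]
@[simp] theorem mem_boxNames_add :
    n ∈ boxNames (P + Q) ↔ n ∈ boxNames P ∨ n ∈ boxNames Q := by
  simp [mem_boxNames, or_and_right, exists_or]
@[simp] theorem mem_boxNames_inside : n ∈ boxNames (inside K P) ↔ n ∈ boxNames P := by
  simp [mem_boxNames, inside]

@[simp] theorem mem_eigenvars_cons :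
    n ∈ eigenvars (x ::ₘ P) ↔ n ∈ x.node.eigen ∨ n ∈ eigenvars P := by simp [mem_eigenvars]
@[simp] theorem mem_eigenvars_singleton :
    n ∈ eigenvars {x} ↔ n ∈ x.node.eigen := by simp [mem_eigenvars]
@[simp] theorem mem_eigenvars_add :
    n ∈ eigenvars (P + Q) ↔ n ∈ eigenvars P ∨ n ∈ eigenvars Q := by
  simp [mem_eigenvars, or_and_right, exists_or]
@[simp] theorem mem_eigenvars_inside : n ∈ eigenvars (inside K P) ↔ n ∈ eigenvars P := by
  simp [mem_eigenvars, inside]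

@[simp] theorem mem_boxUses_zero : n ∈ boxUses 0 ↔ False := by simp [boxUses]
@[simp] theorem mem_boxUses_cons :
    n ∈ boxUses (x ::ₘ P) ↔ (n ∈ x.boxes ∨ n ∈ x.node.uses) ∨ n ∈ boxUses P := by
  simp [boxUses]
@[simp] theorem mem_boxUses_singleton :
    n ∈ boxUses {x} ↔ n ∈ x.boxes ∨ n ∈ x.node.uses := by simp [boxUses]
@[simp] theorem mem_boxUses_add :
    n ∈ boxUses (P + Q) ↔ n ∈ boxUses P ∨ n ∈ boxUses Q := by
  simp [boxUses, or_and_right, exists_or]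
theorem mem_boxUses_inside (h : n ∈ boxUses (inside K P)) : n ∈ boxUses P ∨ n ∈ K := by
  simp only [boxUses, inside, Set.mem_ofPred_eq, Multiset.mem_map] at h ⊢
  obtain ⟨_, ⟨x, hx, rfl⟩, h⟩ := h
  simp only [Finset.mem_union] at h
  rcases h with (h | h) | h
  · exact Or.inl ⟨x, hx, Or.inl h⟩
  · exact Or.inr h
  · exact Or.inl ⟨x, hx, Or.inr h⟩
theorem mem_boxUses_of_boxNames (h : n ∈ boxNames P) : n ∈ boxUses P := by
  obtain ⟨x, hx, h⟩ := (mem_boxNames _ _).1 h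
  refine ⟨x, hx, Or.inr ?_⟩
  generalize x.node = m at h
  cases m <;> simp_all [Node.owns, Node.uses]

@[simp] theorem inside_cons : inside K (x ::ₘ P) = ⟨x.node, x.boxes ∪ K⟩ ::ₘ inside K P := by
  simp [inside]
@[simp] theorem inside_singleton : inside K {x} = {⟨x.node, x.boxes ∪ K⟩} := by
  simp [inside]
@[simp] theorem inside_add : inside K (P + Q) = inside K P + inside K Q := by
  simp [inside]
@[simp] theorem inside_inside (K' : Finset ℕ) :
    inside K (inside K' P) = inside (K' ∪ K) P := by
  simp [inside, Finset.union_assoc]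
@[simp] theorem inside_empty : inside ∅ P = P := by
  simp [inside]
end

@[simp] theorem mem_edges_cons (e : Edge) (x : Cell) (P : Graph) :
    e ∈ edges (x ::ₘ P) ↔ e ∈ x.node.edges ∨ e ∈ edges P := by simp [edges]
@[simp] theorem mem_edges_singleton (e : Edge) (x : Cell) :
    e ∈ edges {x} ↔ e ∈ x.node.edges := by simp [edges]
@[simp] theorem mem_edges_add (e : Edge) (P Q : Graph) :
    e ∈ edges (P + Q) ↔ e ∈ edges P ∨ e ∈ edges Q := by
  simp [edges, or_and_right, exists_or]
@[simp] theorem mem_edges_inside (e : Edge) (K : Finset ℕ) (P : Graph) :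
    e ∈ edges (inside K P) ↔ e ∈ edges P := by simp [edges, inside]

theorem name_mem_edgeNames {e : Edge} {P : Graph} (h : e ∈ edges P) : e.name ∈ edgeNames P :=
  ⟨e, h, rfl⟩

theorem finite_edges (P : Graph) : (edges P).Finite := by
  induction P using Multiset.induction with
  | empty => simp [edges]
  | cons x P ih =>
    have : edges (x ::ₘ P) = {e | e ∈ x.node.edges} ∪ edges P := by
      ext e; simp
    rw [this]
    exact (List.finite_toSet _).union ih

theorem finite_edgeNames (P : Graph) : (edgeNames P).Finite :=
  ((finite_edges P).image Edge.name).subset (by rintro n ⟨e, he, rfl⟩; exact ⟨e, he, rfl⟩)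

theorem finite_boxUses (P : Graph) : (boxUses P).Finite := by
  induction P using Multiset.induction with
  | empty => simp [boxUses]
  | cons x P ih =>
    have : boxUses (x ::ₘ P) = (↑x.boxes ∪ x.node.uses) ∪ boxUses P := by
      ext e; simp
    rw [this]
    refine (Set.Finite.union x.boxes.finite_toSet ?_).union ih
    cases x.node with
    | bangL i o p => cases p <;> simp [Node.uses]
    | _ => simp [Node.uses]

theorem finite_eigenvars (P : Graph) : (eigenvars P).Finite := by
  induction P using Multiset.induction with
  | empty => simp [eigenvars]
  | cons x P ih =>
    have : eigenvars (x ::ₘ P) = x.node.eigen ∪ eigenvars P := by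
      ext e; simp
    rw [this]
    refine Set.Finite.union ?_ ih
    cases x.node <;> simp [Node.eigen]

theorem Graph.Apart.names {P Q : Graph} (h : Apart P Q) {n : ℕ} (hP : n ∈ edgeNames P) :
    n ∉ edgeNames Q := Set.disjoint_left.1 h.1 hP
theorem Graph.Apart.boxes {P Q : Graph} (h : Apart P Q) {n : ℕ} (hP : n ∈ boxNames P) :
    n ∉ boxNames Q := Set.disjoint_left.1 h.2 hP
theorem apart_iff {P Q : Graph} : Apart P Q ↔
    (∀ n ∈ edgeNames P, n ∉ edgeNames Q) ∧ ∀ n ∈ boxNames P, n ∉ boxNames Q := by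
  simp only [Apart, Set.disjoint_left]
theorem Graph.Apart.symm {P Q : Graph} (h : Apart P Q) : Apart Q P := ⟨h.1.symm, h.2.symm⟩

/-! ## The rules, grouped -/

/-- The left rules with one premise: the inputs `A` are replaced by the input `i`. -/
inductive LeftRule : Node → Edge → Multiset Edge → Prop
  | weak (i : Edge) : LeftRule (.weak i) i 0
  | contr {i o₁ o₂ : Edge} {A : Formula} (hl : i.label = A.bang) (hl₁ : o₁.label = A.bang)
      (hl₂ : o₂.label = A.bang) : LeftRule (.contr i o₁ o₂) i {o₁, o₂}
  | tensorL {i o₁ o₂ : Edge} (hl : i.label = o₁.label.tensor o₂.label) :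
      LeftRule (.tensorL i o₁ o₂) i {o₁, o₂}
  | allL {i o : Edge} {a : ℕ} {A B : Formula} (hl : i.label = A.all a)
      (hl' : o.label = A.subst a B) : LeftRule (.allL i o) i {o}
  | parL {i o : Edge} (hl : i.label = o.label.par) : LeftRule (.parL i o) i {o}
  | bangL {i o : Edge} (hl : i.label = o.label.bang) : LeftRule (.bangL i o none) i {o}

/-- The right rules with one premise, except for boxes: the inputs `A` are discharged, and the
output `c` is replaced by `o`. -/
inductive RightRule : Node → Multiset Edge → Edge → Edge → Prop
  | impR {c v o : Edge} (hl : o.label = v.label.imp c.label) : RightRule (.impR c v o) {v} c o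
  | allR {c o : Edge} {a : ℕ} (hl : o.label = c.label.all a) : RightRule (.allR c o a) 0 c o
  | parR {c o : Edge} (hl : o.label = c.label.par) : RightRule (.parR c o) 0 c o

theorem LeftRule.edges_eq {n : Node} {i : Edge} {A : Multiset Edge} (h : LeftRule n i A) :
    (n.edges : Multiset Edge) = i ::ₘ A := by
  cases h <;> rfl

theorem RightRule.edges_eq {n : Node} {c o : Edge} {A : Multiset Edge} (h : RightRule n A c o) :
    (n.edges : Multiset Edge) = c ::ₘ o ::ₘ A := by
  cases h
  case impR =>
    exact Multiset.coe_eq_coe.2 (List.Perm.cons _ (List.Perm.swap _ _ _))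
  all_goals rfl

theorem Node.names_eq {n : Node} : n.names = namesOf (n.edges : Multiset Edge) := by
  ext m; simp [Node.names, namesOf]

@[simp] theorem LeftRule.mem_names {n : Node} {i : Edge} {A : Multiset Edge} (h : LeftRule n i A)
    (m : ℕ) : m ∈ n.names ↔ m = i.name ∨ m ∈ namesOf A := by
  rw [Node.names_eq, h.edges_eq]; simp

theorem RightRule.mem_names {n : Node} {c o : Edge} {A : Multiset Edge} (h : RightRule n A c o)
    (m : ℕ) : m ∈ n.names ↔ m = c.name ∨ m = o.name ∨ m ∈ namesOf A := by
  rw [Node.names_eq, h.edges_eq]; simp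

theorem LeftRule.uses_eq {n : Node} {i : Edge} {A : Multiset Edge} (h : LeftRule n i A) :
    n.uses = ∅ := by cases h <;> rfl
theorem LeftRule.eigen_eq {n : Node} {i : Edge} {A : Multiset Edge} (h : LeftRule n i A) :
    n.eigen = ∅ := by cases h <;> rfl
theorem RightRule.uses_eq {n : Node} {c o : Edge} {A : Multiset Edge} (h : RightRule n A c o) :
    n.uses = ∅ := by cases h <;> rfl

theorem LeftRule.proves {n : Node} {i : Edge} {A Γ : Multiset Edge} {P : Graph} {c : Edge}
    (h : LeftRule n i A) (hP : Proves P (A + Γ) c) (hi : i.name ∉ edgeNames P) :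
    Proves (⟨n, ∅⟩ ::ₘ P) (i ::ₘ Γ) c := by
  cases h with
  | weak => rw [zero_add] at hP; exact .weak hP hi
  | contr hl hl₁ hl₂ => exact .contr (by simpa using hP) hi hl hl₁ hl₂
  | tensorL hl => exact .tensorL (by simpa using hP) hi hl
  | allL hl hl' => exact .allL (by simpa using hP) hi hl hl'
  | parL hl => exact .parL (by simpa using hP) hi hl
  | bangL hl => exact .bangL (by simpa using hP) hi hl

theorem RightRule.proves {n : Node} {c o : Edge} {A Γ : Multiset Edge} {P : Graph}
    (h : RightRule n A c o) (hP : Proves P (A + Γ) c) (ho : o.name ∉ edgeNames P)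
    (ha : ∀ a ∈ n.eigen, ∀ e ∈ Γ, a ∉ e.label.fv) :
    Proves (⟨n, ∅⟩ ::ₘ P) Γ o := by
  cases h with
  | impR hl => exact .impR (by simpa using hP) ho hl
  | allR hl => exact .allR (by simpa using hP) ho (ha _ rfl) hl
  | parR hl => exact .parR (by simpa using hP) ho hl

/-- Induction on proof structures, with the one-premise rules grouped. -/
theorem Proves.rules {M : ∀ (P : Graph) (Γ : Multiset Edge) (c : Edge), Proves P Γ c → Prop}
    (ax : ∀ {i o : Edge} (hn : i.name ≠ o.name) (hl : i.label = o.label), M _ _ _ (.ax hn hl))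
    (daemon : ∀ o : Edge, M _ _ _ (.daemon o))
    (left : ∀ {n i A P Γ c} (hr : LeftRule n i A) (hP : Proves P (A + Γ) c)
      (hi : i.name ∉ edgeNames P), M _ _ _ hP → M _ _ _ (hr.proves hP hi))
    (right : ∀ {n A c o P Γ} (hr : RightRule n A c o) (hP : Proves P (A + Γ) c)
      (ho : o.name ∉ edgeNames P) (ha : ∀ a ∈ n.eigen, ∀ e ∈ Γ, a ∉ e.label.fv), M _ _ _ hP →
      M _ _ _ (hr.proves hP ho ha))
    (cut : ∀ {P Q : Graph} {Γ Δ : Multiset Edge} {c d e : Edge} (hP : Proves P (e ::ₘ Γ) c) (hQ : Proves Q Δ d) (hPQ : Apart P Q)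
      (hl : d.label = e.label), M _ _ _ hP → M _ _ _ hQ → M _ _ _ (.cut hP hQ hPQ hl))
    (tensorR : ∀ {P Q : Graph} {Γ Δ : Multiset Edge} {c d o : Edge} (hP : Proves P Γ c) (hQ : Proves Q Δ d) (hPQ : Apart P Q)
      (ho : o.name ∉ edgeNames (P + Q)) (hl : o.label = c.label.tensor d.label),
      M _ _ _ hP → M _ _ _ hQ → M _ _ _ (.tensorR hP hQ hPQ ho hl))
    (impL : ∀ {P Q : Graph} {Γ Δ : Multiset Edge} {c d e f : Edge} (hP : Proves P (e ::ₘ Γ) c) (hQ : Proves Q Δ d)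
      (hPQ : Apart P Q) (hf : f.name ∉ edgeNames (P + Q)) (hl : f.label = d.label.imp e.label),
      M _ _ _ hP → M _ _ _ hQ → M _ _ _ (.impL hP hQ hPQ hf hl))
    (box₀ : ∀ {P : Graph} {c o : Edge} {b : ℕ} (hP : Proves P 0 c) (ho : o.name ∉ edgeNames P)
      (hl : o.label = c.label.bang) (hb : b ∉ boxNames P), M _ _ _ hP →
      M _ _ _ (.box₀ hP ho hl hb))
    (box₁ : ∀ {P : Graph} {c o i e : Edge} {b : ℕ} (hP : Proves P {e} c) (ho : o.name ∉ edgeNames P)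
      (hl : o.label = c.label.bang) (hi : i.name ∉ edgeNames P) (hio : i.name ≠ o.name)
      (hl' : i.label = e.label.bang) (hb : b ∉ boxNames P), M _ _ _ hP →
      M _ _ _ (.box₁ hP ho hl hi hio hl' hb))
    {P : Graph} {Γ : Multiset Edge} {c : Edge} (h : Proves P Γ c) : M P Γ c h := by
  have e₂ : ∀ (a b : Edge) (Γ : Multiset Edge), a ::ₘ b ::ₘ Γ = ({a, b} : Multiset Edge) + Γ := by
    simp
  have e₁ : ∀ (a : Edge) (Γ : Multiset Edge), a ::ₘ Γ = ({a} : Multiset Edge) + Γ := by simp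
  have e₀ : ∀ (Γ : Multiset Edge), Γ = 0 + Γ := by simp
  -- The constructors list inputs with `::ₘ`, the grouped rules with `+`; the motive depends on the
  -- proof and has to be transported between the two forms.
  have tr : ∀ {P Γ Γ' c} (h : Γ = Γ') {hP : Proves P Γ c}, M P Γ c hP →
      M P Γ' c (h ▸ hP) := by
    rintro P Γ _ c rfl hP h; exact h
  induction h with
  | ax hn hl => exact ax hn hl
  | daemon o => exact daemon o
  | cut hP hQ hPQ hl ihP ihQ => exact cut hP hQ hPQ hl ihP ihQ
  | weak hP hi ih => exact left (.weak _) _ hi (tr (e₀ _) ih)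
  | contr hP hi hl hl₁ hl₂ ih => exact left (.contr hl hl₁ hl₂) _ hi (tr (e₂ _ _ _) ih)
  | tensorL hP hi hl ih => exact left (.tensorL hl) _ hi (tr (e₂ _ _ _) ih)
  | tensorR hP hQ hPQ ho hl ihP ihQ => exact tensorR hP hQ hPQ ho hl ihP ihQ
  | impL hP hQ hPQ hf hl ihP ihQ => exact impL hP hQ hPQ hf hl ihP ihQ
  | impR hP ho hl ih =>
    exact right (.impR hl) _ ho (by simp [Node.eigen]) (tr (e₁ _ _) ih)
  | allL hP hi hl hl' ih => exact left (.allL hl hl') _ hi (tr (e₁ _ _) ih)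
  | allR hP ho ha hl ih =>
    exact right (.allR hl) _ ho (by rintro a rfl; exact ha) (tr (e₀ _) ih)
  | parL hP hi hl ih => exact left (.parL hl) _ hi (tr (e₁ _ _) ih)
  | parR hP ho hl ih =>
    exact right (.parR hl) _ ho (by simp [Node.eigen]) (tr (e₀ _) ih)
  | bangL hP hi hl ih => exact left (.bangL hl) _ hi (tr (e₁ _ _) ih)
  | box₀ hP ho hl hb ih => exact box₀ hP ho hl hb ih
  | box₁ hP ho hl hi hio hl' hb ih => exact box₁ hP ho hl hi hio hl' hb ih

/-! ## Interfaces -/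

@[simp] theorem names_ax (i o : Edge) (m : ℕ) :
    m ∈ (Node.ax i o).names ↔ m = i.name ∨ m = o.name := by simp [Node.names, Node.edges, eq_comm]
@[simp] theorem names_cut (i o : Edge) (m : ℕ) :
    m ∈ (Node.cut i o).names ↔ m = i.name ∨ m = o.name := by simp [Node.names, Node.edges, eq_comm]
@[simp] theorem names_weak (i : Edge) (m : ℕ) :
    m ∈ (Node.weak i).names ↔ m = i.name := by simp [Node.names, Node.edges, eq_comm]
@[simp] theorem names_daemon (i : Edge) (m : ℕ) :
    m ∈ (Node.daemon i).names ↔ m = i.name := by simp [Node.names, Node.edges, eq_comm]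
@[simp] theorem names_contr (i a b : Edge) (m : ℕ) :
    m ∈ (Node.contr i a b).names ↔ m = i.name ∨ m = a.name ∨ m = b.name := by
  simp [Node.names, Node.edges, eq_comm]
@[simp] theorem names_tensorL (i a b : Edge) (m : ℕ) :
    m ∈ (Node.tensorL i a b).names ↔ m = i.name ∨ m = a.name ∨ m = b.name := by
  simp [Node.names, Node.edges, eq_comm]
@[simp] theorem names_tensorR (i a b : Edge) (m : ℕ) :
    m ∈ (Node.tensorR i a b).names ↔ m = i.name ∨ m = a.name ∨ m = b.name := by
  simp [Node.names, Node.edges, eq_comm]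
@[simp] theorem names_impL (i a b : Edge) (m : ℕ) :
    m ∈ (Node.impL i a b).names ↔ m = i.name ∨ m = a.name ∨ m = b.name := by
  simp [Node.names, Node.edges, eq_comm]
@[simp] theorem names_impR (i a b : Edge) (m : ℕ) :
    m ∈ (Node.impR i a b).names ↔ m = i.name ∨ m = a.name ∨ m = b.name := by
  simp [Node.names, Node.edges, eq_comm]
@[simp] theorem names_allL (i o : Edge) (m : ℕ) :
    m ∈ (Node.allL i o).names ↔ m = i.name ∨ m = o.name := by simp [Node.names, Node.edges, eq_comm]
@[simp] theorem names_allR (i o : Edge) (a m : ℕ) :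
    m ∈ (Node.allR i o a).names ↔ m = i.name ∨ m = o.name := by
  simp [Node.names, Node.edges, eq_comm]
@[simp] theorem names_parL (i o : Edge) (m : ℕ) :
    m ∈ (Node.parL i o).names ↔ m = i.name ∨ m = o.name := by simp [Node.names, Node.edges, eq_comm]
@[simp] theorem names_parR (i o : Edge) (m : ℕ) :
    m ∈ (Node.parR i o).names ↔ m = i.name ∨ m = o.name := by simp [Node.names, Node.edges, eq_comm]
@[simp] theorem names_bangL (i o : Edge) (p : Option ℕ) (m : ℕ) :
    m ∈ (Node.bangL i o p).names ↔ m = i.name ∨ m = o.name := by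
  simp [Node.names, Node.edges, eq_comm]
@[simp] theorem names_bangR (i o : Edge) (b m : ℕ) :
    m ∈ (Node.bangR i o b).names ↔ m = i.name ∨ m = o.name := by
  simp [Node.names, Node.edges, eq_comm]

theorem mem_map_name {Γ : Multiset Edge} {n : ℕ} : n ∈ Γ.map Edge.name ↔ n ∈ namesOf Γ := by
  simp [namesOf]

theorem LeftRule.mem_edges {n : Node} {i : Edge} {A : Multiset Edge} (h : LeftRule n i A)
    (e : Edge) : e ∈ n.edges ↔ e = i ∨ e ∈ A := by
  rw [← Multiset.mem_coe, h.edges_eq]; simp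

theorem RightRule.mem_edges {n : Node} {c o : Edge} {A : Multiset Edge} (h : RightRule n A c o)
    (e : Edge) : e ∈ n.edges ↔ e = c ∨ e = o ∨ e ∈ A := by
  rw [← Multiset.mem_coe, h.edges_eq]; simp

/-- The inputs and the output of a proof structure are edges of it. -/
theorem Proves.mem_edges {P : Graph} {Γ : Multiset Edge} {c : Edge} (h : Proves P Γ c) :
    c ∈ edges P ∧ ∀ e ∈ Γ, e ∈ edges P := by
  induction h using Proves.rules with
  | ax => simp [Node.edges]
  | daemon => simp [Node.edges]
  | left hr _ _ ih =>
    refine ⟨by simp [ih.1], fun e he => ?_⟩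
    have := ih.2 e
    simp only [mem_edges_cons, hr.mem_edges, Multiset.mem_cons, Multiset.mem_add] at this he ⊢
    tauto
  | right hr _ _ _ ih =>
    refine ⟨by simp [hr.mem_edges], fun e he => ?_⟩
    have := ih.2 e
    simp only [mem_edges_cons, Multiset.mem_add] at this he ⊢
    tauto
  | cut _ _ _ _ ihP ihQ =>
    refine ⟨by simp [ihP.1], fun e he => ?_⟩
    have := ihP.2 e
    have := ihQ.2 e
    simp only [mem_edges_cons, Multiset.mem_add, Multiset.mem_cons, mem_edges_add] at *
    tauto
  | tensorR _ _ _ _ _ ihP ihQ =>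
    refine ⟨by simp [Node.edges], fun e he => ?_⟩
    have := ihP.2 e
    have := ihQ.2 e
    simp only [mem_edges_cons, Multiset.mem_add, mem_edges_add] at *
    tauto
  | impL _ _ _ _ _ ihP ihQ =>
    refine ⟨by simp [ihP.1], fun e he => ?_⟩
    have := ihP.2 e
    have := ihQ.2 e
    simp only [mem_edges_cons, Multiset.mem_add, Multiset.mem_cons, mem_edges_add, Node.edges,
      List.mem_cons] at *
    tauto
  | box₀ => simp [Node.edges]
  | box₁ => simp [Node.edges]

theorem Proves.mem_names {P : Graph} {Γ : Multiset Edge} {c : Edge} (h : Proves P Γ c) {n : ℕ}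
    (hn : n = c.name ∨ n ∈ namesOf Γ) : n ∈ edgeNames P := by
  rcases hn with rfl | ⟨e, he, rfl⟩
  · exact name_mem_edgeNames h.mem_edges.1
  · exact name_mem_edgeNames (h.mem_edges.2 e he)

/-- The inputs and the output of a proof structure are distinct. -/
theorem Proves.nodup {P : Graph} {Γ : Multiset Edge} {c : Edge} (h : Proves P Γ c) :
    ((c ::ₘ Γ).map Edge.name).Nodup := by
  induction h using Proves.rules with
  | ax h => simpa using h.symm
  | daemon => simp
  | left hr hP hi ih =>
    have := mt hP.mem_names hi
    simp only [Multiset.map_cons, Multiset.map_add, Multiset.nodup_cons, Multiset.nodup_add,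
      Multiset.mem_cons, Multiset.mem_add, mem_map_name, mem_namesOf_add] at ih this ⊢
    grind
  | right hr hP hi _ ih =>
    have := mt hP.mem_names hi
    simp only [Multiset.map_cons, Multiset.map_add, Multiset.nodup_cons, Multiset.nodup_add,
      Multiset.mem_add, mem_map_name, mem_namesOf_add] at ih this ⊢
    grind
  | cut hP hQ hPQ _ ihP ihQ =>
    have h₁ := fun n h => hPQ.names (hP.mem_names (n := n) h)
    have h₂ := fun n h => (hQ.mem_names (n := n) h)
    simp only [Multiset.map_cons, Multiset.map_add, Multiset.nodup_cons, Multiset.nodup_add,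
      Multiset.mem_cons, Multiset.mem_add, mem_map_name, mem_namesOf_cons,
      Multiset.disjoint_left] at ihP ihQ h₁ h₂ ⊢
    grind
  | tensorR hP hQ hPQ ho _ ihP ihQ =>
    have h₁ := fun n h => hPQ.names (hP.mem_names (n := n) h)
    have h₂ := fun n h => (hQ.mem_names (n := n) h)
    have h₃ := fun n h => (hP.mem_names (n := n) h)
    simp only [Multiset.map_cons, Multiset.map_add, Multiset.nodup_cons, Multiset.nodup_add,
      Multiset.mem_add, mem_map_name, mem_edgeNames_add,
      Multiset.disjoint_left] at ihP ihQ h₁ h₂ h₃ ho ⊢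
    grind
  | impL hP hQ hPQ ho _ ihP ihQ =>
    have h₁ := fun n h => hPQ.names (hP.mem_names (n := n) h)
    have h₂ := fun n h => (hQ.mem_names (n := n) h)
    have h₃ := fun n h => (hP.mem_names (n := n) h)
    simp only [Multiset.map_cons, Multiset.map_add, Multiset.nodup_cons, Multiset.nodup_add,
      Multiset.mem_cons, Multiset.mem_add, mem_map_name, mem_namesOf_cons, mem_edgeNames_add,
      Multiset.disjoint_left] at ihP ihQ h₁ h₂ h₃ ho ⊢
    grind
  | box₀ => simp
  | box₁ _ _ _ _ h => simpa using h.symm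

theorem Proves.out_notMem {P : Graph} {Γ : Multiset Edge} {c : Edge} (h : Proves P Γ c) :
    c.name ∉ namesOf Γ := by
  have := h.nodup
  simp only [Multiset.map_cons, Multiset.nodup_cons, mem_map_name] at this
  exact this.1

theorem Proves.head_notMem {P : Graph} {Γ : Multiset Edge} {c e : Edge}
    (h : Proves P (e ::ₘ Γ) c) : e.name ∉ namesOf Γ ∧ e.name ≠ c.name := by
  have := h.nodup
  simp only [Multiset.map_cons, Multiset.nodup_cons, mem_map_name, Multiset.mem_cons,
    not_or] at this
  exact ⟨this.2.1, fun h => this.1.1 h.symm⟩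

/-- The boxes mentioned in a proof structure are boxes of it. -/
theorem Proves.boxUses_sub {P : Graph} {Γ : Multiset Edge} {c : Edge} (h : Proves P Γ c) {b : ℕ} :
    b ∈ boxUses P → b ∈ boxNames P := by
  induction h using Proves.rules with
  | ax => simp [Node.uses]
  | daemon => simp [Node.uses]
  | left hr _ _ ih => simpa [hr.uses_eq] using fun h => Or.inr (ih h)
  | right hr _ _ _ ih => simpa [hr.uses_eq] using fun h => Or.inr (ih h)
  | cut _ _ _ _ ihP ihQ => simp [Node.uses]; tauto
  | tensorR _ _ _ _ _ ihP ihQ => simp [Node.uses]; tauto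
  | impL _ _ _ _ _ ihP ihQ => simp [Node.uses]; tauto
  | box₀ _ _ _ _ ih =>
    have := fun P K => mem_boxUses_inside b P K
    simp only [mem_boxUses_cons, mem_boxNames_cons, Node.uses, Node.owns, mem_boxNames_inside]
    rintro (h | h)
    · simpa using Or.inl h
    · rcases this _ _ h with h | h
      · exact Or.inr (ih h)
      · left; simpa using h
  | box₁ _ _ _ _ _ _ _ ih =>
    have := fun P K => mem_boxUses_inside b P K
    simp only [mem_boxUses_cons, mem_boxNames_cons, Node.uses, Node.owns, mem_boxNames_inside]
    rintro (h | h | h)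
    · simpa using Or.inl h
    · left; simpa using h
    · rcases this _ _ h with h | h
      · exact Or.inr (Or.inr (ih h))
      · left; simpa using h

/-! ## Reduction in context -/

/-- The nodes of `P` satisfy the constraints of the indexing `I`. -/
def Resp (I : ℕ → ℤ) (P : Graph) : Prop := ∀ x ∈ P, x.node.Respects I

@[simp] theorem resp_zero (I : ℕ → ℤ) : Resp I 0 := by simp [Resp]
@[simp] theorem resp_cons (I : ℕ → ℤ) (x : Cell) (P : Graph) :
    Resp I (x ::ₘ P) ↔ x.node.Respects I ∧ Resp I P := by simp [Resp]
@[simp] theorem resp_singleton (I : ℕ → ℤ) (x : Cell) :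
    Resp I {x} ↔ x.node.Respects I := by simp [Resp]
@[simp] theorem resp_add (I : ℕ → ℤ) (P Q : Graph) :
    Resp I (P + Q) ↔ Resp I P ∧ Resp I Q := by simp [Resp, or_imp, forall_and]
@[simp] theorem resp_inside (I : ℕ → ℤ) (K : Finset ℕ) (P : Graph) :
    Resp I (inside K P) ↔ Resp I P := by simp [Resp, inside]

/-- A proof structure for which `I` satisfies the constraints at the nodes. -/
structure Net (I : ℕ → ℤ) (P : Graph) (Γ : Multiset Edge) (c : Edge) : Prop where
  proves : Proves P Γ c
  resp : Resp I P

/-- `P`, with inputs `Γ` and output `c`, has nothing else in common with `R`, in which it is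
placed inside the boxes `K`. -/
structure Fits (K : Finset ℕ) (R : Graph) (Γ : Multiset Edge) (c : Edge) (P : Graph) : Prop where
  edge : ∀ n ∈ edgeNames P, n ∈ edgeNames R → n = c.name ∨ n ∈ namesOf Γ
  box : ∀ b ∈ boxNames P, b ∉ boxUses R ∧ b ∉ K

/-- `R` is a proof structure with inputs `Γ'` and output `c'`, with a hole inside the boxes `K`
for a proof structure with inputs `Γ` and output `c`. -/
structure IsCtx (K : Finset ℕ) (R : Graph) (Γ : Multiset Edge) (c : Edge) (Γ' : Multiset Edge)
    (c' : Edge) : Prop where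
  plug : ∀ P, Proves P Γ c → Fits K R Γ c P → Proves (inside K P + R) Γ' c'
  outer : ∀ n, n = c'.name ∨ n ∈ namesOf Γ' → (n = c.name ∨ n ∈ namesOf Γ) ∨ n ∈ edgeNames R

/-- In every context, `P` reduces to a net with the property `Φ`. -/
def Evt (I : ℕ → ℤ) (Φ : Graph → Prop) (Γ : Multiset Edge) (c : Edge) (P : Graph) : Prop :=
  ∀ K R Γ' c', IsCtx K R Γ c Γ' c' → Resp I R → (∀ e ∈ Γ', I e.name = I c'.name) →
    Fits K R Γ c P → ∃ P', Net I P' Γ c ∧ Fits K R Γ c P' ∧ Φ P' ∧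
      Reduces Γ' c' (inside K P + R) (inside K P' + R)

section
variable {I : ℕ → ℤ} {Φ Ψ : Graph → Prop} {Γ : Multiset Edge} {c : Edge} {P : Graph}

theorem Evt.pure (hP : Net I P Γ c) (h : Φ P) : Evt I Φ Γ c P :=
  fun _ _ _ _ _ _ _ hf => ⟨P, hP, hf, h, .refl⟩

theorem Evt.bind (h : Evt I Φ Γ c P) (h' : ∀ P', Net I P' Γ c → Φ P' → Evt I Ψ Γ c P') :
    Evt I Ψ Γ c P := by
  intro K R Γ' c' hc hR hI hf
  obtain ⟨P', hP', hf', hΦ, hr⟩ := h K R Γ' c' hc hR hI hf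
  obtain ⟨P'', hP'', hf'', hΨ, hr'⟩ := h' P' hP' hΦ K R Γ' c' hc hR hI hf'
  exact ⟨P'', hP'', hf'', hΨ, hr.trans hr'⟩

theorem Evt.mono (h : Evt I Φ Γ c P) (h' : ∀ P', Net I P' Γ c → Φ P' → Ψ P') :
    Evt I Ψ Γ c P :=
  h.bind fun P' hP' hΦ => .pure hP' (h' P' hP' hΦ)

/-- The reduct may depend on the context, because the new names of a step must avoid the surrounding
graph. That the whole net stays a net comes from plugging the reduct back into the context, so only
the local part needs checking. -/
theorem Evt.of_step
    (h : ∀ K R, Fits K R Γ c P → ∃ P', Net I P' Γ c ∧ Fits K R Γ c P' ∧ Φ P' ∧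
      (Step (inside K P + R) (inside K P' + R) ∨ EigenRename (inside K P + R) (inside K P' + R))) :
    Evt I Φ Γ c P := by
  intro K R Γ' c' hc hR hI hf
  obtain ⟨P', hP', hf', hΦ, hs⟩ := h K R hf
  refine ⟨P', hP', hf', hΦ, .single ⟨hs, hc.plug P' hP'.1 hf', I, ?_, hI⟩⟩
  have : Resp I (inside K P' + R) := by simpa using ⟨hP'.2, hR⟩
  exact this

theorem Fits.mono {K : Finset ℕ} {R P' : Graph} (h : Fits K R Γ c P)
    (he : ∀ n ∈ edgeNames P', n ∈ edgeNames P) (hb : ∀ n ∈ boxNames P', n ∈ boxNames P) :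
    Fits K R Γ c P' :=
  ⟨fun n hn hn' => h.edge n (he n hn) hn', fun b hb' => h.box b (hb b hb')⟩

/-- Contexts compose: a hole of `R₀` inside the boxes `K₀`, itself placed in `R` inside `K`, is a
hole of `inside K R₀ + R` inside `K₀ ∪ K`. The reduction given for `P₀` is used in this larger
context; the work is to pass the freshness conditions between the two nested contexts and the
composite one. -/
theorem Evt.frame {K₀ : Finset ℕ} {R₀ P₀ : Graph} {Γ₀ : Multiset Edge} {c₀ : Edge}
    (hc : IsCtx K₀ R₀ Γ₀ c₀ Γ c) (hR : Resp I R₀) (hP₀ : Proves P₀ Γ₀ c₀)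
    (hf : Fits K₀ R₀ Γ₀ c₀ P₀) (h : Evt I Φ Γ₀ c₀ P₀) :
    Evt I (fun P' => ∃ P₁, P' = inside K₀ P₁ + R₀ ∧ Net I P₁ Γ₀ c₀ ∧ Fits K₀ R₀ Γ₀ c₀ P₁ ∧ Φ P₁)
      Γ c (inside K₀ P₀ + R₀) := by
  intro K R Γ' c' hc' hR' hI hf'
  have hfit : ∀ P₁, Proves P₁ Γ₀ c₀ → Fits (K₀ ∪ K) (inside K R₀ + R) Γ₀ c₀ P₁ →
      Fits K₀ R₀ Γ₀ c₀ P₁ ∧ Fits K R Γ c (inside K₀ P₁ + R₀) := by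
    intro P₁ hP₁ h₁
    refine ⟨⟨fun n hn hn' => h₁.edge n hn (by simp [hn']), fun b hb => ?_⟩,
      fun n hn hn' => ?_, fun b hb => ?_⟩
    · have := h₁.box b hb
      simp only [mem_boxUses_add, Finset.mem_union, not_or] at this
      refine ⟨fun hb' => this.1.1 ?_, this.2.1⟩
      obtain ⟨x, hx, hx'⟩ := hb'
      refine ⟨⟨x.node, x.boxes ∪ K⟩, Multiset.mem_map_of_mem (fun x : Cell => (⟨x.node, x.boxes ∪ K⟩ : Cell)) hx, ?_⟩
      simp only [Finset.mem_union]; tauto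
    · simp only [mem_edgeNames_add, mem_edgeNames_inside] at hn
      rcases hn with hn | hn
      -- An edge shared by `P₁` and the outer graph lies on the interface of the hole, hence is
      -- already an edge of `P₀`, to which the outer freshness condition applies.
      · have := hP₀.mem_names (h₁.edge n hn (by simp [hn']))
        exact hf'.edge n (by simp [this]) hn'
      · exact hf'.edge n (by simp [hn]) hn'
    · simp only [mem_boxNames_add, mem_boxNames_inside] at hb
      rcases hb with hb | hb
      · have := h₁.box b hb
        simp only [mem_boxUses_add, Finset.mem_union, not_or] at this
        exact ⟨this.1.2, this.2.2⟩
      · exact hf'.box b (by simp [hb])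
  have hin : ∀ P₁, inside K (inside K₀ P₁ + R₀) + R =
      inside (K₀ ∪ K) P₁ + (inside K R₀ + R) := by
    intro P₁; simp [add_assoc]
  obtain ⟨P₁, hP₁, hf₁, hΦ, hr⟩ := h (K₀ ∪ K) (inside K R₀ + R) Γ' c'
    ⟨fun P₁ hP₁ h₁ => by
      rw [← hin]
      exact hc'.plug _ (hc.plug _ hP₁ (hfit P₁ hP₁ h₁).1) (hfit P₁ hP₁ h₁).2,
     fun n hn => by
      rcases hc'.outer n hn with hn | hn
      · rcases hc.outer n hn with hn | hn
        · exact Or.inl hn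
        · right; simp [hn]
      · right; simp [hn]⟩
    (by simpa using ⟨hR, hR'⟩) hI
    ⟨fun n hn hn' => by
      simp only [mem_edgeNames_add, mem_edgeNames_inside] at hn'
      rcases hn' with hn' | hn'
      · exact hf.edge n hn hn'
      · rcases hc.outer n (hf'.edge n (by simp [hn]) hn') with h | h
        · exact h
        · exact hf.edge n hn h,
     fun b hb => by
      have h₁ := hf.box b hb
      have h₂ := hf'.box b (by simp [hb])
      simp only [mem_boxUses_add, Finset.mem_union, not_or]
      refine ⟨⟨fun h => ?_, h₂.1⟩, h₁.2, h₂.2⟩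
      rcases mem_boxUses_inside _ _ _ h with h | h
      · exact h₁.1 h
      · exact h₂.2 h⟩
  refine ⟨_, ⟨hc.plug _ hP₁.1 (hfit _ hP₁.1 hf₁).1, by simpa using ⟨hP₁.2, hR⟩⟩,
    (hfit _ hP₁.1 hf₁).2, ⟨P₁, rfl, hP₁, (hfit _ hP₁.1 hf₁).1, hΦ⟩, ?_⟩
  rw [hin, hin]
  exact hr
end

/-! ## Reduction is compatible with the rules -/

theorem inside_empty_add_singleton (P : Graph) (x : Cell) : inside ∅ P + {x} = x ::ₘ P := by
  rw [inside_empty, add_comm, Multiset.singleton_add]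

theorem inside_empty_add_cons (P Q : Graph) (x : Cell) :
    inside ∅ P + x ::ₘ Q = x ::ₘ (P + Q) := by
  rw [inside_empty, Multiset.add_cons]

section
variable {I : ℕ → ℤ} {Φ Ψ : Graph → Prop} {Γ Δ A : Multiset Edge} {c d e f i o : Edge}
  {P Q : Graph} {n : Node} {b : ℕ}

/-- The node is a context with one cell. The new input stays fresh for every reduct, since a reduct
may meet the context only on the old interface, and those edges belong to `P`, which does not
contain `i`. -/
theorem Evt.left (hr : LeftRule n i A) (hP : Proves P (A + Γ) c) (hi : i.name ∉ edgeNames P)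
    (hn : n.Respects I) (h : Evt I Φ (A + Γ) c P) :
    Evt I (fun P' => ∃ P₁, P' = ⟨n, ∅⟩ ::ₘ P₁ ∧ Net I P₁ (A + Γ) c ∧ i.name ∉ edgeNames P₁ ∧ Φ P₁)
      (i ::ₘ Γ) c (⟨n, ∅⟩ ::ₘ P) := by
  have hm := fun n h => hP.mem_names (n := n) h
  have fresh : ∀ P₁, Fits ∅ {⟨n, ∅⟩} (A + Γ) c P₁ → i.name ∉ edgeNames P₁ := fun P₁ hf h =>
    hi (hm _ (hf.edge _ h (by simp [hr.mem_names])))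
  rw [← inside_empty_add_singleton]
  refine (Evt.frame (Γ₀ := A + Γ) (c₀ := c) ⟨fun P₁ hP₁ hf => ?_, fun m hm' => ?_⟩ (by simpa)
    hP ⟨fun m h h' => ?_, ?_⟩ h).mono ?_
  · rw [inside_empty_add_singleton]
    exact hr.proves hP₁ (fresh _ hf)
  · simp only [mem_edgeNames_singleton, hr.mem_names, mem_namesOf_add, mem_namesOf_cons] at *
    tauto
  · simp only [mem_edgeNames_singleton, hr.mem_names, mem_namesOf_add] at *
    rcases h' with rfl | h' <;> tauto
  · simp [hr.uses_eq]
  · rintro _ _ ⟨P₁, rfl, hN, hf, hΦ⟩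
    exact ⟨P₁, inside_empty_add_singleton _ _, hN, fresh _ hf, hΦ⟩

theorem Evt.right (hr : RightRule n A c o) (hP : Proves P (A + Γ) c) (ho : o.name ∉ edgeNames P)
    (ha : ∀ a ∈ n.eigen, ∀ e ∈ Γ, a ∉ e.label.fv) (hn : n.Respects I)
    (h : Evt I Φ (A + Γ) c P) :
    Evt I (fun P' => ∃ P₁, P' = ⟨n, ∅⟩ ::ₘ P₁ ∧ Net I P₁ (A + Γ) c ∧ o.name ∉ edgeNames P₁ ∧ Φ P₁)
      Γ o (⟨n, ∅⟩ ::ₘ P) := by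
  have hm := fun n h => hP.mem_names (n := n) h
  have fresh : ∀ P₁, Fits ∅ {⟨n, ∅⟩} (A + Γ) c P₁ → o.name ∉ edgeNames P₁ := fun P₁ hf h =>
    ho (hm _ (hf.edge _ h (by simp [hr.mem_names])))
  rw [← inside_empty_add_singleton]
  refine (Evt.frame (Γ₀ := A + Γ) (c₀ := c) ⟨fun P₁ hP₁ hf => ?_, fun m hm' => ?_⟩ (by simpa)
    hP ⟨fun m h h' => ?_, ?_⟩ h).mono ?_
  · rw [inside_empty_add_singleton]
    exact hr.proves hP₁ (fresh _ hf) ha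
  · simp only [mem_edgeNames_singleton, hr.mem_names, mem_namesOf_add] at *
    tauto
  · simp only [mem_edgeNames_singleton, hr.mem_names, mem_namesOf_add] at *
    rcases h' with rfl | rfl | h' <;> tauto
  · simp [hr.uses_eq]
  · rintro _ _ ⟨P₁, rfl, hN, hf, hΦ⟩
    exact ⟨P₁, inside_empty_add_singleton _ _, hN, fresh _ hf, hΦ⟩

/-- The context of one premise of a rule with two premises. -/
theorem Evt.binary {Γ' : Multiset Edge} {c' : Edge} (hP : Proves P Γ c) (hQ : Proves Q Δ d)
    (hQr : Resp I Q) (hPQ : Apart P Q) (hn : n.Respects I) (hu : n.uses = ∅)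
    (hnames : ∀ m ∈ n.names, m ∉ edgeNames P ∨ m = c.name ∨ m ∈ namesOf Γ)
    (hout : ∀ m, m = c'.name ∨ m ∈ namesOf Γ' → (m = c.name ∨ m ∈ namesOf Γ) ∨
      m ∈ n.names ∨ m = d.name ∨ m ∈ namesOf Δ)
    (hplug : ∀ P₁, Proves P₁ Γ c → Apart P₁ Q →
      (∀ m ∈ n.names, m ∈ edgeNames P₁ → m ∈ edgeNames P) → Proves (⟨n, ∅⟩ ::ₘ (P₁ + Q)) Γ' c')
    (h : Evt I Φ Γ c P) :
    Evt I (fun P' => ∃ P₁, P' = ⟨n, ∅⟩ ::ₘ (P₁ + Q) ∧ Net I P₁ Γ c ∧ Apart P₁ Q ∧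
      (∀ m ∈ n.names, m ∈ edgeNames P₁ → m ∈ edgeNames P) ∧ Φ P₁) Γ' c' (⟨n, ∅⟩ ::ₘ (P + Q)) := by
  have hm := fun n h => hP.mem_names (n := n) h
  have hm' := fun n h => hQ.mem_names (n := n) h
  have key : ∀ P₁, Fits ∅ (⟨n, ∅⟩ ::ₘ Q) Γ c P₁ → Apart P₁ Q ∧
      (∀ m ∈ n.names, m ∈ edgeNames P₁ → m ∈ edgeNames P) := by
    intro P₁ hf
    refine ⟨apart_iff.2 ⟨fun m h h' => ?_, fun m h h' => ?_⟩, fun m h h' => ?_⟩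
    · exact hPQ.names (hm _ (hf.edge m h (by simp [h']))) h'
    · exact (hf.box m h).1 (by simp [mem_boxUses_of_boxNames _ _ h'])
    · exact hm _ (hf.edge m h' (by simp [h]))
  rw [← inside_empty_add_cons]
  refine (Evt.frame (Γ₀ := Γ) (c₀ := c) ⟨fun P₁ hP₁ hf => ?_, fun m h => ?_⟩
    (by simpa using ⟨hn, hQr⟩) hP ⟨fun m h h' => ?_, fun b hb => ?_⟩ h).mono ?_
  · rw [inside_empty_add_cons]
    exact hplug _ hP₁ (key _ hf).1 (key _ hf).2
  · have := hout m h
    have := hm' m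
    simp only [mem_edgeNames_cons] at *
    tauto
  · have := hnames m
    have := hPQ.names h
    simp only [mem_edgeNames_cons] at *
    tauto
  · simpa [hu] using fun h => hPQ.boxes hb (hQ.boxUses_sub h)
  · rintro _ _ ⟨P₁, rfl, hN, hf, hΦ⟩
    exact ⟨P₁, inside_empty_add_cons _ _ _, hN, (key _ hf).1, (key _ hf).2, hΦ⟩

theorem Evt.cutL (hP : Proves P (e ::ₘ Γ) c) (hQ : Proves Q Δ d) (hQr : Resp I Q)
    (hPQ : Apart P Q) (hl : d.label = e.label) (hn : (Node.cut d e).Respects I)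
    (h : Evt I Φ (e ::ₘ Γ) c P) :
    Evt I (fun P' => ∃ P₁, P' = ⟨.cut d e, ∅⟩ ::ₘ (P₁ + Q) ∧ Net I P₁ (e ::ₘ Γ) c ∧ Apart P₁ Q ∧
      Φ P₁) (Γ + Δ) c (⟨.cut d e, ∅⟩ ::ₘ (P + Q)) := by
  refine (Evt.binary hP hQ hQr hPQ hn rfl ?_ ?_ (fun P₁ hP₁ hA _ => .cut hP₁ hQ hA hl) h).mono ?_
  · have := hPQ.symm.names (hQ.mem_names (Or.inl rfl))
    simp only [names_cut, mem_namesOf_cons]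
    rintro m (rfl | rfl) <;> tauto
  · simp only [names_cut, mem_namesOf_cons, mem_namesOf_add]; tauto
  · rintro _ _ ⟨P₁, rfl, hN, hA, -, hΦ⟩
    exact ⟨P₁, rfl, hN, hA, hΦ⟩

theorem Evt.cutR (hP : Proves P (e ::ₘ Γ) c) (hPr : Resp I P) (hQ : Proves Q Δ d)
    (hPQ : Apart P Q) (hl : d.label = e.label) (hn : (Node.cut d e).Respects I)
    (h : Evt I Φ Δ d Q) :
    Evt I (fun P' => ∃ Q₁, P' = ⟨.cut d e, ∅⟩ ::ₘ (P + Q₁) ∧ Net I Q₁ Δ d ∧ Apart P Q₁ ∧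
      Φ Q₁) (Γ + Δ) c (⟨.cut d e, ∅⟩ ::ₘ (P + Q)) := by
  rw [add_comm P Q]
  refine (Evt.binary hQ hP hPr hPQ.symm hn rfl ?_ ?_ (fun Q₁ hQ₁ hA _ => ?_) h).mono ?_
  · have := hPQ.names (hP.mem_names (n := e.name) (by simp))
    simp only [names_cut]
    rintro m (rfl | rfl) <;> tauto
  · simp only [names_cut, mem_namesOf_cons, mem_namesOf_add]; tauto
  · rw [add_comm Q₁]; exact .cut hP hQ₁ hA.symm hl
  · rintro _ _ ⟨Q₁, rfl, hN, hA, -, hΦ⟩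
    exact ⟨Q₁, by rw [add_comm], hN, hA.symm, hΦ⟩

theorem Evt.cut (hP : Net I P (e ::ₘ Γ) c) (hQ : Net I Q Δ d)
    (hPQ : Apart P Q) (hl : d.label = e.label) (hn : (Node.cut d e).Respects I)
    (h : Evt I Φ (e ::ₘ Γ) c P) (h' : Evt I Ψ Δ d Q) :
    Evt I (fun P' => ∃ P₁ Q₁, P' = ⟨.cut d e, ∅⟩ ::ₘ (P₁ + Q₁) ∧ Net I P₁ (e ::ₘ Γ) c ∧
      Net I Q₁ Δ d ∧ Apart P₁ Q₁ ∧ Φ P₁ ∧ Ψ Q₁) (Γ + Δ) c (⟨.cut d e, ∅⟩ ::ₘ (P + Q)) := by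
  refine (Evt.cutL hP.1 hQ.1 hQ.2 hPQ hl hn h).bind ?_
  rintro _ _ ⟨P₁, rfl, hN, hA, hΦ⟩
  refine (Evt.cutR hN.1 hN.2 hQ.1 hA hl hn h').mono ?_
  rintro _ _ ⟨Q₁, rfl, hN', hA', hΨ⟩
  exact ⟨P₁, Q₁, rfl, hN, hN', hA', hΦ, hΨ⟩

theorem Evt.tensorR (hP : Net I P Γ c) (hQ : Net I Q Δ d)
    (hPQ : Apart P Q) (ho : o.name ∉ edgeNames (P + Q)) (hl : o.label = c.label.tensor d.label)
    (hn : (Node.tensorR c d o).Respects I) (h : Evt I Φ Γ c P) (h' : Evt I Ψ Δ d Q) :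
    Evt I (fun P' => ∃ P₁ Q₁, P' = ⟨.tensorR c d o, ∅⟩ ::ₘ (P₁ + Q₁) ∧ Net I P₁ Γ c ∧
      Net I Q₁ Δ d ∧ Apart P₁ Q₁ ∧ o.name ∉ edgeNames (P₁ + Q₁) ∧ Φ P₁ ∧ Ψ Q₁) (Γ + Δ) o
      (⟨.tensorR c d o, ∅⟩ ::ₘ (P + Q)) := by
  have ho' := ho
  simp only [mem_edgeNames_add, not_or] at ho'
  refine Evt.bind (Φ := fun P' => ∃ P₁, P' = ⟨.tensorR c d o, ∅⟩ ::ₘ (P₁ + Q) ∧ Net I P₁ Γ c ∧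
      Apart P₁ Q ∧ o.name ∉ edgeNames (P₁ + Q) ∧ Φ P₁) ?_ ?_
  · refine (Evt.binary hP.1 hQ.1 hQ.2 hPQ hn rfl ?_ ?_ (fun P₁ hP₁ hA hm => ?_) h).mono ?_
    · have := hPQ.symm.names (hQ.1.mem_names (Or.inl rfl))
      simp only [names_tensorR]
      rintro m (rfl | rfl | rfl) <;> tauto
    · simp only [names_tensorR, mem_namesOf_add]; tauto
    · exact .tensorR hP₁ hQ.1 hA (by have := hm o.name (by simp); simp; tauto) hl
    · rintro _ _ ⟨P₁, rfl, hN, hA, hm, hΦ⟩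
      exact ⟨P₁, rfl, hN, hA, by have := hm o.name (by simp); simp; tauto, hΦ⟩
  · rintro _ _ ⟨P₁, rfl, hN, hA, ho₁, hΦ⟩
    have ho₂ := ho₁
    simp only [mem_edgeNames_add, not_or] at ho₂
    rw [add_comm P₁ Q]
    refine (Evt.binary hQ.1 hN.1 hN.2 hA.symm hn rfl ?_ ?_ (fun Q₁ hQ₁ hA hm => ?_) h').mono ?_
    · have := hA.names (hN.1.mem_names (Or.inl rfl))
      simp only [names_tensorR]
      rintro m (rfl | rfl | rfl) <;> tauto
    · simp only [names_tensorR, mem_namesOf_add]; tauto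
    · rw [add_comm Q₁]
      exact .tensorR hN.1 hQ₁ hA.symm (by have := hm o.name (by simp); simp; tauto) hl
    · rintro _ _ ⟨Q₁, rfl, hN', hA, hm, hΨ⟩
      exact ⟨P₁, Q₁, by rw [add_comm], hN, hN', hA.symm,
        by have := hm o.name (by simp); simp; tauto, hΦ, hΨ⟩

theorem Evt.impL (hP : Net I P (e ::ₘ Γ) c) (hQ : Net I Q Δ d)
    (hPQ : Apart P Q) (hf : f.name ∉ edgeNames (P + Q)) (hl : f.label = d.label.imp e.label)
    (hn : (Node.impL f d e).Respects I) (h : Evt I Φ (e ::ₘ Γ) c P) (h' : Evt I Ψ Δ d Q) :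
    Evt I (fun P' => ∃ P₁ Q₁, P' = ⟨.impL f d e, ∅⟩ ::ₘ (P₁ + Q₁) ∧ Net I P₁ (e ::ₘ Γ) c ∧
      Net I Q₁ Δ d ∧ Apart P₁ Q₁ ∧ f.name ∉ edgeNames (P₁ + Q₁) ∧ Φ P₁ ∧ Ψ Q₁)
      (f ::ₘ (Γ + Δ)) c (⟨.impL f d e, ∅⟩ ::ₘ (P + Q)) := by
  have hf' := hf
  simp only [mem_edgeNames_add, not_or] at hf'
  refine Evt.bind (Φ := fun P' => ∃ P₁, P' = ⟨.impL f d e, ∅⟩ ::ₘ (P₁ + Q) ∧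
      Net I P₁ (e ::ₘ Γ) c ∧ Apart P₁ Q ∧ f.name ∉ edgeNames (P₁ + Q) ∧ Φ P₁) ?_ ?_
  · refine (Evt.binary hP.1 hQ.1 hQ.2 hPQ hn rfl ?_ ?_ (fun P₁ hP₁ hA hm => ?_) h).mono ?_
    · have := hPQ.symm.names (hQ.1.mem_names (Or.inl rfl))
      simp only [names_impL, mem_namesOf_cons]
      rintro m (rfl | rfl | rfl) <;> tauto
    · simp only [names_impL, mem_namesOf_add, mem_namesOf_cons]; tauto
    · exact .impL hP₁ hQ.1 hA (by have := hm f.name (by simp); simp; tauto) hl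
    · rintro _ _ ⟨P₁, rfl, hN, hA, hm, hΦ⟩
      exact ⟨P₁, rfl, hN, hA, by have := hm f.name (by simp); simp; tauto, hΦ⟩
  · rintro _ _ ⟨P₁, rfl, hN, hA, hf₁, hΦ⟩
    have hf₂ := hf₁
    simp only [mem_edgeNames_add, not_or] at hf₂
    rw [add_comm P₁ Q]
    refine (Evt.binary hQ.1 hN.1 hN.2 hA.symm hn rfl ?_ ?_ (fun Q₁ hQ₁ hA hm => ?_) h').mono ?_
    · have := hA.names (hN.1.mem_names (n := e.name) (by simp))
      simp only [names_impL]
      rintro m (rfl | rfl | rfl) <;> tauto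
    · simp only [names_impL, mem_namesOf_add, mem_namesOf_cons]; tauto
    · rw [add_comm Q₁]
      exact .impL hN.1 hQ₁ hA.symm (by have := hm f.name (by simp); simp; tauto) hl
    · rintro _ _ ⟨Q₁, rfl, hN', hA, hm, hΨ⟩
      exact ⟨P₁, Q₁, by rw [add_comm], hN, hN', hA.symm,
        by have := hm f.name (by simp); simp; tauto, hΦ, hΨ⟩

theorem Evt.box₀ (hP : Proves P 0 c) (ho : o.name ∉ edgeNames P)
    (hl : o.label = c.label.bang) (hb : b ∉ boxNames P) (hn : (Node.bangR c o b).Respects I)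
    (h : Evt I Φ 0 c P) :
    Evt I (fun P' => ∃ P₁, P' = ⟨.bangR c o b, ∅⟩ ::ₘ inside {b} P₁ ∧ Net I P₁ 0 c ∧
      o.name ∉ edgeNames P₁ ∧ b ∉ boxNames P₁ ∧ Φ P₁) 0 o
      (⟨.bangR c o b, ∅⟩ ::ₘ inside {b} P) := by
  have hm := fun n h => hP.mem_names (n := n) h
  have key : ∀ P₁, Fits {b} {⟨.bangR c o b, ∅⟩} 0 c P₁ →
      o.name ∉ edgeNames P₁ ∧ b ∉ boxNames P₁ := fun P₁ hf =>
    ⟨fun h => ho (hm _ (hf.edge _ h (by simp))), fun h => (hf.box _ h).2 (by simp)⟩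
  have e : ∀ P : Graph, inside {b} P + {⟨.bangR c o b, ∅⟩} =
      ⟨.bangR c o b, ∅⟩ ::ₘ inside {b} P := fun P => by rw [add_comm, Multiset.singleton_add]
  rw [← e]
  refine (Evt.frame (Γ₀ := 0) (c₀ := c) ⟨fun P₁ hP₁ hf => ?_, fun m hm' => ?_⟩ (by simpa)
    hP ⟨fun m h h' => ?_, fun b' hb' => ?_⟩ h).mono ?_
  · rw [e]
    exact .box₀ hP₁ (key _ hf).1 hl (key _ hf).2
  · simp at *; tauto
  · simp at *
    rcases h' with rfl | rfl <;> tauto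
  · have : b' ≠ b := by rintro rfl; exact hb hb'
    simpa [Node.uses]
  · rintro _ _ ⟨P₁, rfl, hN, hf, hΦ⟩
    exact ⟨P₁, e _, hN, (key _ hf).1, (key _ hf).2, hΦ⟩

theorem Evt.box₁ (hP : Proves P {e} c) (ho : o.name ∉ edgeNames P)
    (hl : o.label = c.label.bang) (hi : i.name ∉ edgeNames P) (hio : i.name ≠ o.name)
    (hl' : i.label = e.label.bang) (hb : b ∉ boxNames P) (hn : (Node.bangR c o b).Respects I)
    (hn' : (Node.bangL i e (some b)).Respects I)
    (h : Evt I Φ {e} c P) :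
    Evt I (fun P' => ∃ P₁, P' = ⟨.bangR c o b, ∅⟩ ::ₘ ⟨.bangL i e (some b), ∅⟩ ::ₘ inside {b} P₁ ∧
      Net I P₁ {e} c ∧ o.name ∉ edgeNames P₁ ∧ i.name ∉ edgeNames P₁ ∧ b ∉ boxNames P₁ ∧ Φ P₁) {i} o
      (⟨.bangR c o b, ∅⟩ ::ₘ ⟨.bangL i e (some b), ∅⟩ ::ₘ inside {b} P) := by
  have hm := fun n h => hP.mem_names (n := n) h
  have key : ∀ P₁, Fits {b} {⟨.bangR c o b, ∅⟩, ⟨.bangL i e (some b), ∅⟩} {e} c P₁ →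
      o.name ∉ edgeNames P₁ ∧ i.name ∉ edgeNames P₁ ∧ b ∉ boxNames P₁ := fun P₁ hf =>
    ⟨fun h => ho (hm _ (hf.edge _ h (by simp))), fun h => hi (hm _ (hf.edge _ h (by simp))),
      fun h => (hf.box _ h).2 (by simp)⟩
  have e' : ∀ P : Graph, inside {b} P + {⟨.bangR c o b, ∅⟩, ⟨.bangL i e (some b), ∅⟩} =
      ⟨.bangR c o b, ∅⟩ ::ₘ ⟨.bangL i e (some b), ∅⟩ ::ₘ inside {b} P := fun P => by
    rw [add_comm]; simp
  rw [← e']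
  refine (Evt.frame (Γ₀ := {e}) (c₀ := c) ⟨fun P₁ hP₁ hf => ?_, fun m hm' => ?_⟩
    (by simpa using ⟨hn, hn'⟩) hP ⟨fun m h h' => ?_, fun b' hb' => ?_⟩ h).mono ?_
  · rw [e']
    obtain ⟨h₁, h₂, h₃⟩ := key _ hf
    exact .box₁ hP₁ h₁ hl h₂ hio hl' h₃
  · simp at *; tauto
  · simp at *
    rcases h' with (rfl | rfl) | (rfl | rfl) <;> tauto
  · have : b' ≠ b := by rintro rfl; exact hb hb'
    simpa [Node.uses]
  · rintro _ _ ⟨P₁, rfl, hN, hf, hΦ⟩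
    obtain ⟨h₁, h₂, h₃⟩ := key _ hf
    exact ⟨P₁, e' _, hN, h₁, h₂, h₃, hΦ⟩
end

/-! ## Renaming and substitution -/

section
variable (fe : Edge → Edge) (fb fa : ℕ → ℕ)

@[simp] theorem map_cons (x : Cell) (P : Graph) : Graph.map fe fb fa (x ::ₘ P) =
    ⟨x.node.map fe fb fa, x.boxes.image fb⟩ ::ₘ Graph.map fe fb fa P := by simp [Graph.map]
@[simp] theorem map_singleton (x : Cell) : Graph.map fe fb fa {x} =
    {⟨x.node.map fe fb fa, x.boxes.image fb⟩} := by simp [Graph.map]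
@[simp] theorem map_add (P Q : Graph) : Graph.map fe fb fa (P + Q) =
    Graph.map fe fb fa P + Graph.map fe fb fa Q := by simp [Graph.map]
@[simp] theorem map_inside (K : Finset ℕ) (P : Graph) : Graph.map fe fb fa (inside K P) =
    inside (K.image fb) (Graph.map fe fb fa P) := by
  simp [Graph.map, inside, Finset.image_union]

theorem edges_map (n : Node) : (n.map fe fb fa).edges = n.edges.map fe := by
  cases n <;> rfl

theorem owns_map (n : Node) (b : ℕ) : b ∈ (n.map fe fb fa).owns ↔ ∃ b' ∈ n.owns, fb b' = b := by
  cases n <;> simp [Node.map, Node.owns, eq_comm]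

theorem eigen_map (n : Node) (b : ℕ) : b ∈ (n.map fe fb fa).eigen ↔ ∃ b' ∈ n.eigen, fa b' = b := by
  cases n <;> simp [Node.map, Node.eigen, eq_comm]

theorem boxNames_map (P : Graph) (b : ℕ) :
    b ∈ boxNames (Graph.map fe fb fa P) ↔ ∃ b' ∈ boxNames P, fb b' = b := by
  simp only [mem_boxNames, Graph.map, Multiset.mem_map]
  constructor
  · rintro ⟨_, ⟨x, hx, rfl⟩, h⟩
    obtain ⟨b', hb', rfl⟩ := (owns_map _ _ _ _ _).1 h
    exact ⟨b', ⟨x, hx, hb'⟩, rfl⟩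
  · rintro ⟨b', ⟨x, hx, hb'⟩, rfl⟩
    exact ⟨_, ⟨x, hx, rfl⟩, (owns_map _ _ _ _ _).2 ⟨b', hb', rfl⟩⟩

theorem eigenvars_map (P : Graph) (b : ℕ) :
    b ∈ eigenvars (Graph.map fe fb fa P) ↔ ∃ b' ∈ eigenvars P, fa b' = b := by
  simp only [mem_eigenvars, Graph.map, Multiset.mem_map]
  constructor
  · rintro ⟨_, ⟨x, hx, rfl⟩, h⟩
    obtain ⟨b', hb', rfl⟩ := (eigen_map _ _ _ _ _).1 h
    exact ⟨b', ⟨x, hx, hb'⟩, rfl⟩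
  · rintro ⟨b', ⟨x, hx, hb'⟩, rfl⟩
    exact ⟨_, ⟨x, hx, rfl⟩, (eigen_map _ _ _ _ _).2 ⟨b', hb', rfl⟩⟩

theorem edgeNames_map_subst (a : ℕ) (B : Formula) (P : Graph) (n : ℕ) :
    n ∈ edgeNames (Graph.map (Edge.subst a B) fb fa P) ↔ n ∈ edgeNames P := by
  simp only [mem_edgeNames, Graph.map, Multiset.mem_map, Node.names]
  constructor
  · rintro ⟨_, ⟨x, hx, rfl⟩, e, he, rfl⟩
    rw [edges_map, List.mem_map] at he
    obtain ⟨e, he, rfl⟩ := he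
    exact ⟨x, hx, e, he, rfl⟩
  · rintro ⟨x, hx, e, he, rfl⟩
    refine ⟨_, ⟨x, hx, rfl⟩, e.subst a B, ?_, rfl⟩
    rw [edges_map, List.mem_map]
    exact ⟨e, he, rfl⟩

theorem map_congr {fe' : Edge → Edge} {fb' fa' : ℕ → ℕ} {P : Graph}
    (he : ∀ e ∈ edges P, fe e = fe' e) (hb : ∀ b ∈ boxUses P, fb b = fb' b)
    (ha : ∀ a ∈ eigenvars P, fa a = fa' a) : Graph.map fe fb fa P = Graph.map fe' fb' fa' P := by
  refine Multiset.map_congr rfl fun x hx => ?_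
  have he' : ∀ e ∈ x.node.edges, fe e = fe' e := fun e h => he e ⟨x, hx, h⟩
  have hb₁ : ∀ b ∈ x.boxes, fb b = fb' b := fun b h => hb b ⟨x, hx, Or.inl h⟩
  have hb₂ : ∀ b ∈ x.node.uses, fb b = fb' b := fun b h => hb b ⟨x, hx, Or.inr h⟩
  have ha' : ∀ a ∈ x.node.eigen, fa a = fa' a :=
    fun a h => ha a ((mem_eigenvars _ _).2 ⟨x, hx, h⟩)
  rw [Finset.image_congr hb₁]
  congr 1
  generalize x.node = n at *
  cases n with
  | bangL i o p => cases p <;> simp_all [Node.edges, Node.uses, Node.eigen, Node.map]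
  | _ => simp_all [Node.edges, Node.uses, Node.eigen, Node.map]
end

theorem map_id (P : Graph) : Graph.map id id id P = P := by
  unfold Graph.map
  conv_rhs => rw [← Multiset.map_id P]
  refine Multiset.map_congr rfl fun x _ => ?_
  obtain ⟨n, K⟩ := x
  cases n <;> simp [Node.map]

theorem edgeNames_map {fe : Edge → Edge} {f : ℕ → ℕ} (hf : ∀ e, (fe e).name = f e.name)
    (fb fa : ℕ → ℕ) (P : Graph) (n : ℕ) :
    n ∈ edgeNames (Graph.map fe fb fa P) ↔ ∃ m ∈ edgeNames P, f m = n := by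
  simp only [mem_edgeNames, Graph.map, Multiset.mem_map, Node.names]
  constructor
  · rintro ⟨_, ⟨x, hx, rfl⟩, e, he, rfl⟩
    rw [edges_map, List.mem_map] at he
    obtain ⟨e, he, rfl⟩ := he
    exact ⟨e.name, ⟨x, hx, e, he, rfl⟩, (hf e).symm⟩
  · rintro ⟨_, ⟨x, hx, e, he, rfl⟩, rfl⟩
    refine ⟨_, ⟨x, hx, rfl⟩, fe e, ?_, hf e⟩
    rw [edges_map, List.mem_map]
    exact ⟨e, he, rfl⟩

/-- Proof structures are preserved by injective renamings of edges and boxes, combined with a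
compatible map on the labels. -/
theorem Proves.map {P : Graph} {Γ : Multiset Edge} {c : Edge} (h : Proves P Γ c)
    {fe : Edge → Edge} {f g : ℕ → ℕ} {φ : Formula → Formula}
    (hn : ∀ e, (fe e).name = f e.name) (hl : ∀ e, (fe e).label = φ e.label)
    (hf : f.Injective) (hg : g.Injective)
    (htensor : ∀ A B, φ (A.tensor B) = (φ A).tensor (φ B))
    (himp : ∀ A B, φ (A.imp B) = (φ A).imp (φ B))
    (hbang : ∀ A, φ A.bang = (φ A).bang) (hpar : ∀ A, φ A.par = (φ A).par)
    (hall : ∀ (A B : Formula) (a : ℕ), ∃ (A' B' : Formula) (a' : ℕ), φ (A.all a) = A'.all a' ∧ φ (A.subst a B) = A'.subst a' B')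
    (heig : ∀ a ∈ eigenvars P, ∀ A, φ (A.all a) = (φ A).all a ∧ (a ∉ A.fv → a ∉ (φ A).fv)) :
    Proves (Graph.map fe g id P) (Γ.map fe) (fe c) := by
  have fresh : ∀ (P : Graph) (i : Edge), i.name ∉ edgeNames P →
      (fe i).name ∉ edgeNames (Graph.map fe g id P) := by
    intro P n hi h
    obtain ⟨m, hm, hmn⟩ := (edgeNames_map hn _ _ _ _).1 h
    exact hi (hf (hmn.trans (hn n)) ▸ hm)
  have freshBox : ∀ (P : Graph) (n : ℕ), n ∉ boxNames P →
      g n ∉ boxNames (Graph.map fe g id P) := by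
    intro P n hn h
    obtain ⟨m, hm, hmn⟩ := (boxNames_map _ _ _ _ _).1 h
    exact hn (hg hmn ▸ hm)
  have apart : ∀ P Q : Graph, Apart P Q → Apart (Graph.map fe g id P)
      (Graph.map fe g id Q) := by
    intro P Q hPQ
    refine apart_iff.2 ⟨fun n h h' => ?_, fun n h h' => ?_⟩
    · obtain ⟨m, hm, rfl⟩ := (edgeNames_map hn _ _ _ _).1 h
      obtain ⟨m', hm', h⟩ := (edgeNames_map hn _ _ _ _).1 h'
      exact hPQ.names hm (hf h ▸ hm')
    · obtain ⟨m, hm, rfl⟩ := (boxNames_map _ _ _ _ _).1 h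
      exact freshBox Q m (hPQ.boxes hm) h'
  have ne : ∀ i o : Edge, i.name ≠ o.name → (fe i).name ≠ (fe o).name := by
    intro i o h; rw [hn, hn]; exact hf.ne h
  have notFv : ∀ (Γ : Multiset Edge) a, (∀ A : Formula, a ∉ A.fv → a ∉ (φ A).fv) →
      (∀ e ∈ Γ, a ∉ e.label.fv) → ∀ e ∈ Γ.map fe, a ∉ e.label.fv := by
    intro Γ a h h' e he
    obtain ⟨e, he', rfl⟩ := Multiset.mem_map.1 he
    rw [hl]; exact h _ (h' e he')
  have lab : ∀ {e e' : Edge}, e.label = e'.label → (fe e).label = (fe e').label := by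
    intro e e' h; rw [hl, hl, h]
  induction h with
  | ax hn' hl' => simpa [Node.map] using Proves.ax (ne _ _ hn') (lab hl')
  | daemon o => simpa [Node.map] using Proves.daemon (fe o)
  | cut hP hQ hPQ hl' ihP ihQ =>
    have ihP := ihP fun a h => heig a (by simp [h])
    have ihQ := ihQ fun a h => heig a (by simp [h])
    simp only [map_cons, map_add, Node.map, Finset.image_empty, Multiset.map_cons,
      Multiset.map_add] at ihP ⊢
    exact .cut ihP ihQ (apart _ _ hPQ) (lab hl')
  | weak hP hi ih =>
    have ih := ih fun a h => heig a (by simp [h])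
    simp only [map_cons, Node.map, Finset.image_empty, Multiset.map_cons] at ih ⊢
    exact .weak ih (fresh _ _ hi)
  | contr hP hi h h₁ h₂ ih =>
    have ih := ih fun a h => heig a (by simp [h])
    simp only [map_cons, Node.map, Finset.image_empty, Multiset.map_cons] at ih ⊢
    exact .contr ih (fresh _ _ hi) (by rw [hl, h, hbang]) (by rw [hl, h₁, hbang])
      (by rw [hl, h₂, hbang])
  | tensorL hP hi h ih =>
    have ih := ih fun a h => heig a (by simp [h])
    simp only [map_cons, Node.map, Finset.image_empty, Multiset.map_cons] at ih ⊢
    exact .tensorL ih (fresh _ _ hi) (by rw [hl, h, htensor, hl, hl])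
  | tensorR hP hQ hPQ ho h ihP ihQ =>
    have ihP := ihP fun a h => heig a (by simp [h])
    have ihQ := ihQ fun a h => heig a (by simp [h])
    have ho := fresh _ _ ho
    simp only [map_cons, map_add, Node.map, Finset.image_empty, Multiset.map_add] at ho ⊢
    exact .tensorR ihP ihQ (apart _ _ hPQ) ho (by rw [hl, h, htensor, hl, hl])
  | impL hP hQ hPQ ho h ihP ihQ =>
    have ihP := ihP fun a h => heig a (by simp [h])
    have ihQ := ihQ fun a h => heig a (by simp [h])
    have ho := fresh _ _ ho
    simp only [map_cons, map_add, Node.map, Finset.image_empty, Multiset.map_add,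
      Multiset.map_cons] at ihP ho ⊢
    exact .impL ihP ihQ (apart _ _ hPQ) ho (by rw [hl, h, himp, hl, hl])
  | impR hP ho h ih =>
    have ih := ih fun a h => heig a (by simp [h])
    simp only [map_cons, Node.map, Finset.image_empty, Multiset.map_cons] at ih ⊢
    exact .impR ih (fresh _ _ ho) (by rw [hl, h, himp, hl, hl])
  | allL hP hi h h' ih =>
    have ih := ih fun a h => heig a (by simp [h])
    simp only [map_cons, Node.map, Finset.image_empty, Multiset.map_cons] at ih ⊢
    obtain ⟨A', B', a', h₁, h₂⟩ := hall _ _ _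
    exact .allL ih (fresh _ _ hi) (by rw [hl, h, h₁]) (by rw [hl, h', h₂])
  | allR hP ho ha h ih =>
    have ih := ih fun a h => heig a (by simp [h])
    have he := heig _ (by simp [Node.eigen]; left; rfl)
    simp only [map_cons, Node.map, Finset.image_empty, id] at ih ⊢
    exact .allR ih (fresh _ _ ho) (notFv _ _ (fun A => (he A).2) ha)
      (by rw [hl, h, (he _).1, hl])
  | parL hP hi h ih =>
    have ih := ih fun a h => heig a (by simp [h])
    simp only [map_cons, Node.map, Finset.image_empty, Multiset.map_cons] at ih ⊢
    exact .parL ih (fresh _ _ hi) (by rw [hl, h, hpar, hl])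
  | parR hP ho h ih =>
    have ih := ih fun a h => heig a (by simp [h])
    simp only [map_cons, Node.map, Finset.image_empty] at ih ⊢
    exact .parR ih (fresh _ _ ho) (by rw [hl, h, hpar, hl])
  | bangL hP hi h ih =>
    have ih := ih fun a h => heig a (by simp [h])
    simp only [map_cons, Node.map, Finset.image_empty, Multiset.map_cons, Option.map_none] at ih ⊢
    exact .bangL ih (fresh _ _ hi) (by rw [hl, h, hbang, hl])
  | box₀ hP ho h hb ih =>
    have ih := ih fun a h => heig a (by simp [h])
    simp only [map_cons, Node.map, Finset.image_empty, map_inside, Finset.image_singleton,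
      Multiset.map_zero] at ih ⊢
    exact .box₀ ih (fresh _ _ ho) (by rw [hl, h, hbang, hl]) (freshBox _ _ hb)
  | box₁ hP ho h hi hio h' hb ih =>
    have ih := ih fun a h => heig a (by simp [h])
    simp only [map_cons, Node.map, Finset.image_empty, map_inside, Finset.image_singleton,
      Multiset.map_singleton, Option.map_some] at ih ⊢
    exact .box₁ ih (fresh _ _ ho) (by rw [hl, h, hbang, hl]) (fresh _ _ hi) (ne _ _ hio)
      (by rw [hl, h', hbang, hl]) (freshBox _ _ hb)

theorem Proves.rename {P : Graph} {Γ : Multiset Edge} {c : Edge} (h : Proves P Γ c) {f g : ℕ → ℕ}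
    (hf : f.Injective) (hg : g.Injective) :
    Proves (Graph.map (Edge.rename f) g id P) (Γ.map (Edge.rename f)) (c.rename f) :=
  h.map (φ := id) (fun _ => rfl) (fun _ => rfl) hf hg (fun _ _ => rfl) (fun _ _ => rfl)
    (fun _ => rfl) (fun _ => rfl) (fun A B a => ⟨A, B, a, rfl, rfl⟩) (fun _ _ _ => ⟨rfl, id⟩)

/-- With eigenvariables distinct from `a` and not free in `B`, substitution commutes with closing
each of them and preserves the side condition of `∀`-right. -/
theorem Proves.subst {P : Graph} {Γ : Multiset Edge} {c : Edge} (h : Proves P Γ c) (a : ℕ)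
    (B : Formula) (ha : ∀ a' ∈ eigenvars P, a' ≠ a ∧ a' ∉ B.fv) :
    Proves (Graph.map (Edge.subst a B) id id P) (Γ.map (Edge.subst a B)) (c.subst a B) :=
  h.map (φ := fun A => A.subst a B) (f := id) (fun _ => rfl) (fun _ => rfl) Function.injective_id
    Function.injective_id (fun _ _ => Formula.subst_tensor _ _ _ _)
    (fun _ _ => Formula.subst_imp _ _ _ _)
    (fun _ => Formula.subst_bang _ _ _) (fun _ => Formula.subst_par _ _ _)
    (fun A A' a' => Formula.exists_subst_all A A' B a' a)
    (fun a' ha' _ => ⟨Formula.subst_all (ha a' ha').1 (ha a' ha').2,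
      fun h => Formula.notMem_fv_subst h (ha a' ha').2⟩)

theorem map_subst_of_notMem {Γ : Multiset Edge} {a : ℕ} (h : ∀ e ∈ Γ, a ∉ e.label.fv)
    (B : Formula) : Γ.map (Edge.subst a B) = Γ := by
  conv_rhs => rw [← Multiset.map_id Γ]
  refine Multiset.map_congr rfl fun e he => ?_
  simp [Edge.subst, Formula.subst_of_notMem (h e he)]

/-- Edges with the same name are equal. -/
def Consistent (S : Set Edge) : Prop := ∀ e ∈ S, ∀ e' ∈ S, e.name = e'.name → e = e'

theorem Consistent.insert {P : Graph} (h : Consistent (edges P)) {i : Edge}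
    (hi : i.name ∉ edgeNames P) {S : Set Edge} (hS : ∀ e ∈ S, e = i ∨ e ∈ edges P) :
    Consistent S := by
  intro e he e' he' hee
  rcases hS e he with rfl | h₁ <;> rcases hS e' he' with rfl | h₂
  · rfl
  · exact absurd (hee ▸ name_mem_edgeNames h₂) hi
  · exact absurd (hee ▸ name_mem_edgeNames h₁) hi
  · exact h e h₁ e' h₂ hee

theorem Consistent.add {P Q : Graph} (h : Consistent (edges P)) (h' : Consistent (edges Q))
    (hPQ : Apart P Q) : Consistent (edges (P + Q)) := by
  intro e he e' he' hee
  rcases (mem_edges_add _ _ _).1 he with h₁ | h₁ <;> rcases (mem_edges_add _ _ _).1 he' with h₂ | h₂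
  · exact h e h₁ e' h₂ hee
  · exact absurd (hee ▸ name_mem_edgeNames h₂) (hPQ.names (name_mem_edgeNames h₁))
  · exact absurd (hee ▸ name_mem_edgeNames h₁) (hPQ.names (name_mem_edgeNames h₂))
  · exact h' e h₁ e' h₂ hee

/-- The occurrences of an edge in a proof structure have the same label. -/
theorem Proves.consistent {P : Graph} {Γ : Multiset Edge} {c : Edge} (h : Proves P Γ c) :
    Consistent (edges P) := by
  induction h using Proves.rules with
  | ax h =>
    intro e he e' he' hee
    simp only [mem_edges_singleton, Node.edges, List.mem_cons, List.not_mem_nil, or_false] at he he'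
    rcases he with rfl | rfl <;> rcases he' with rfl | rfl <;> tauto
  | daemon => intro e he e' he' _; simp_all [Node.edges]
  | left hr hP hi ih =>
    refine ih.insert hi fun e he => ?_
    have := hP.mem_edges.2 e
    simp only [mem_edges_cons, hr.mem_edges, Multiset.mem_add] at he this
    tauto
  | right hr hP hi _ ih =>
    refine ih.insert hi fun e he => ?_
    have h₁ := hP.mem_edges.2 e
    have h₂ := hP.mem_edges.1
    simp only [mem_edges_cons, hr.mem_edges, Multiset.mem_add] at he h₁
    rcases he with (rfl | rfl | he) | he <;> tauto
  | cut hP hQ hPQ _ ihP ihQ =>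
    intro e he e' he'
    refine ihP.add ihQ hPQ e ?_ e' ?_
    all_goals
      have h₁ := hP.mem_edges.2 _ (Multiset.mem_cons_self _ _)
      have h₂ := hQ.mem_edges.1
      simp only [mem_edges_cons, mem_edges_add, Node.edges, List.mem_cons, List.not_mem_nil,
        or_false] at he he' ⊢
    · rcases he with (rfl | rfl) | he <;> tauto
    · rcases he' with (rfl | rfl) | he' <;> tauto
  | tensorR hP hQ hPQ hi _ ihP ihQ =>
    refine (ihP.add ihQ hPQ).insert hi fun e he => ?_
    have h₁ := hP.mem_edges.1
    have h₂ := hQ.mem_edges.1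
    simp only [mem_edges_cons, mem_edges_add, Node.edges, List.mem_cons, List.not_mem_nil,
        or_false] at he ⊢
    rcases he with (rfl | rfl | rfl) | he <;> tauto
  | impL hP hQ hPQ hi _ ihP ihQ =>
    refine (ihP.add ihQ hPQ).insert hi fun e he => ?_
    have h₁ := hP.mem_edges.2 _ (Multiset.mem_cons_self _ _)
    have h₂ := hQ.mem_edges.1
    simp only [mem_edges_cons, mem_edges_add, Node.edges, List.mem_cons, List.not_mem_nil,
        or_false] at he ⊢
    rcases he with (rfl | rfl | rfl) | he <;> tauto
  | box₀ hP hi _ _ ih =>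
    refine ih.insert hi fun e he => ?_
    have h₁ := hP.mem_edges.1
    simp only [mem_edges_cons, mem_edges_inside, Node.edges, List.mem_cons, List.not_mem_nil,
        or_false] at he ⊢
    rcases he with (rfl | rfl) | he <;> tauto
  | @box₁ P c o i e b hP ho _ hi hio _ _ ih =>
    have h₁ := hP.mem_edges.1
    have h₂ := hP.mem_edges.2 e (by simp)
    have ih' : Consistent (edges (⟨.bangL i e none, ∅⟩ ::ₘ P)) := ih.insert hi fun e he => by
      simp only [mem_edges_cons, Node.edges, List.mem_cons, List.not_mem_nil, or_false] at he ⊢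
      rcases he with (rfl | rfl) | he <;> tauto
    refine ih'.insert (i := o) ?_ fun e he => ?_
    · have := name_mem_edgeNames h₂
      simp only [mem_edgeNames_cons, names_bangL]
      rintro ((h | h) | h)
      · exact hio h.symm
      · exact ho (h ▸ this)
      · exact ho h
    · simp only [mem_edges_cons, mem_edges_inside, Node.edges, List.mem_cons, List.not_mem_nil,
        or_false] at he ⊢
      rcases he with (rfl | rfl) | (rfl | rfl) | he <;> tauto

/-- Redirection is not injective, but on a structure that does not contain `y` it acts as the
transposition of the two names, to which `Proves.rename` applies. Consistency of labels is needed
because redirection recognises an edge by its name only and replaces its label too. -/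
theorem redirect_eq_rename {P : Graph} {Γ : Multiset Edge} {c x y : Edge} (h : Proves P Γ c)
    (hx : x ∈ edges P) (hy : y.name ∉ edgeNames P) (hl : y.label = x.label) :
    redirect x y P = Graph.map (Edge.rename (Equiv.swap x.name y.name)) id id P := by
  refine map_congr _ _ _ (fun e he => ?_) (fun _ _ => rfl) (fun _ _ => rfl)
  unfold Edge.redirect Edge.rename
  split_ifs with hex
  · obtain rfl := h.consistent e he x hx hex
    simp [← hl]
  · rw [Equiv.swap_apply_of_ne_of_ne hex]
    rintro heq
    exact hy (heq ▸ name_mem_edgeNames he)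

theorem map_rename_swap {Γ : Multiset Edge} {n m : ℕ} (hn : n ∉ namesOf Γ) (hm : m ∉ namesOf Γ) :
    Γ.map (Edge.rename (Equiv.swap n m)) = Γ := by
  conv_rhs => rw [← Multiset.map_id Γ]
  refine Multiset.map_congr rfl fun e he => ?_
  have h₁ : e.name ≠ n := by rintro rfl; exact hn ⟨e, he, rfl⟩
  have h₂ : e.name ≠ m := by rintro rfl; exact hm ⟨e, he, rfl⟩
  simp [Edge.rename, Equiv.swap_apply_of_ne_of_ne h₁ h₂]

theorem Proves.redirect_input {P : Graph} {Γ : Multiset Edge} {c x y : Edge}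
    (h : Proves P (x ::ₘ Γ) c) (hy : y.name ∉ edgeNames P) (hl : y.label = x.label) :
    Proves (redirect x y P) (y ::ₘ Γ) c := by
  rw [redirect_eq_rename h (h.mem_edges.2 x (by simp)) hy hl]
  have h' := h.rename (f := Equiv.swap x.name y.name) (g := id) (Equiv.injective _)
    Function.injective_id
  have h₁ := h.head_notMem
  have h₂ := mt h.mem_names hy
  simp only [mem_namesOf_cons, not_or] at h₂
  rw [Multiset.map_cons, map_rename_swap h₁.1 h₂.2.2] at h'
  convert h' using 2
  · simp [Edge.rename, ← hl]
  · simp [Edge.rename, Equiv.swap_apply_of_ne_of_ne (Ne.symm h₁.2) (Ne.symm h₂.1)]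

theorem Proves.redirect_output {P : Graph} {Γ : Multiset Edge} {x y : Edge}
    (h : Proves P Γ x) (hy : y.name ∉ edgeNames P) (hl : y.label = x.label) :
    Proves (redirect x y P) Γ y := by
  rw [redirect_eq_rename h h.mem_edges.1 hy hl]
  have h' := h.rename (f := Equiv.swap x.name y.name) (g := id) (Equiv.injective _)
    Function.injective_id
  have h₂ := mt h.mem_names hy
  simp only [not_or] at h₂
  rw [map_rename_swap h.out_notMem h₂.2] at h'
  convert h' using 2
  simp [Edge.rename, ← hl]

theorem redirect_of_notMem {P : Graph} {x y : Edge} (h : x.name ∉ edgeNames P) :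
    redirect x y P = P := by
  conv_rhs => rw [← map_id P]
  refine map_congr _ _ _ (fun e he => ?_) (fun _ _ => rfl) (fun _ _ => rfl)
  rw [Edge.redirect, if_neg]
  · rfl
  · rintro heq; exact h (heq ▸ name_mem_edgeNames he)

@[simp] theorem redirect_add (x y : Edge) (P Q : Graph) :
    redirect x y (P + Q) = redirect x y P + redirect x y Q := map_add _ _ _ _ _
@[simp] theorem redirect_inside (x y : Edge) (K : Finset ℕ) (P : Graph) :
    redirect x y (inside K P) = inside K (redirect x y P) := by simp [redirect]

theorem edgeNames_redirect {x y : Edge} {P : Graph} {n : ℕ} (h : n ∈ edgeNames (redirect x y P)) :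
    n = y.name ∨ n ∈ edgeNames P ∧ n ≠ x.name := by
  have hf : ∀ e : Edge, (Edge.redirect x y e).name = if e.name = x.name then y.name else e.name := by
    intro e; unfold Edge.redirect; split_ifs <;> rfl
  obtain ⟨m, hm, rfl⟩ := (edgeNames_map (f := fun m => if m = x.name then y.name else m) hf
    _ _ _ _).1 h
  by_cases hx : m = x.name
  · simp [hx]
  · simp only [hx, if_false]; tauto

theorem boxNames_redirect {x y : Edge} {P : Graph} {n : ℕ} :
    n ∈ boxNames (redirect x y P) ↔ n ∈ boxNames P := by
  simp [redirect, boxNames_map]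

/-! ## Weights and levels of cuts -/

/-- The tightest cases are a `⊗` or `⊸` node meeting a weakening or a dæmon, and a contraction
meeting a dæmon: two nodes of weight 1 and the large node are replaced by four nodes of weight 1, so
a large node needs weight at least 3. -/
def Node.weight : Node → ℕ
  | .cut _ _ => 1
  | .weak _ => 1
  | .daemon _ => 1
  | _ => 3

/-- A measure that decreases in every cut elimination step that does not duplicate a box. -/
def weight (P : Graph) : ℕ := (Multiset.map (fun x : Cell => x.node.weight) P).sum

@[simp] theorem weight_cons (x : Cell) (P : Graph) :
    weight (x ::ₘ P) = x.node.weight + weight P := by simp [weight]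
@[simp] theorem weight_singleton (x : Cell) : weight {x} = x.node.weight := by simp [weight]
@[simp] theorem weight_add (P Q : Graph) : weight (P + Q) = weight P + weight Q := by
  simp [weight]
@[simp] theorem weight_inside (K : Finset ℕ) (P : Graph) : weight (inside K P) = weight P := by
  simp [weight, inside]
@[simp] theorem weight_map (fe : Edge → Edge) (fb fa : ℕ → ℕ) (P : Graph) :
    weight (Graph.map fe fb fa P) = weight P := by
  simp only [weight, Graph.map, Multiset.map_map]
  congr 1
  refine Multiset.map_congr rfl fun x _ => ?_
  cases h : x.node <;> simp [h, Node.map, Node.weight]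
@[simp] theorem weight_redirect (x y : Edge) (P : Graph) :
    weight (redirect x y P) = weight P := weight_map _ _ _ _

/-- If the node is a cut, then its level is at least `j`. -/
def Node.Above (I : ℕ → ℤ) (j : ℤ) : Node → Prop
  | .cut d _ => j ≤ I d.name
  | _ => True

/-- The cuts of `P` have level at least `j`. -/
def Good (I : ℕ → ℤ) (j : ℤ) (P : Graph) : Prop := ∀ x ∈ P, x.node.Above I j

section
variable {I : ℕ → ℤ} {j : ℤ}
@[simp] theorem good_cons (x : Cell) (P : Graph) :
    Good I j (x ::ₘ P) ↔ x.node.Above I j ∧ Good I j P := by simp [Good]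
@[simp] theorem good_singleton (x : Cell) :
    Good I j {x} ↔ x.node.Above I j := by simp [Good]
@[simp] theorem good_add (P Q : Graph) :
    Good I j (P + Q) ↔ Good I j P ∧ Good I j Q := by simp [Good, or_imp, forall_and]
@[simp] theorem good_inside (K : Finset ℕ) (P : Graph) :
    Good I j (inside K P) ↔ Good I j P := by simp [Good, inside]

theorem respects_map {fe : Edge → Edge} (h : ∀ e, I (fe e).name = I e.name) (fb fa : ℕ → ℕ)
    (n : Node) : (n.map fe fb fa).Respects I ↔ n.Respects I := by
  cases n <;> simp [Node.map, Node.Respects, Node.edges, h]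

theorem above_map {fe : Edge → Edge} (h : ∀ e, I (fe e).name = I e.name) (fb fa : ℕ → ℕ)
    (n : Node) : (n.map fe fb fa).Above I j ↔ n.Above I j := by
  cases n <;> simp [Node.map, Node.Above, h]

theorem resp_map {fe : Edge → Edge} (h : ∀ e, I (fe e).name = I e.name) (fb fa : ℕ → ℕ)
    (P : Graph) : Resp I (Graph.map fe fb fa P) ↔ Resp I P := by
  simp [Resp, Graph.map, respects_map h]

theorem good_map {fe : Edge → Edge} (h : ∀ e, I (fe e).name = I e.name) (fb fa : ℕ → ℕ)
    (P : Graph) : Good I j (Graph.map fe fb fa P) ↔ Good I j P := by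
  simp [Good, Graph.map, above_map h]

@[simp] theorem resp_map_subst (a : ℕ) (B : Formula) (fb fa : ℕ → ℕ) (P : Graph) :
    Resp I (Graph.map (Edge.subst a B) fb fa P) ↔ Resp I P :=
  resp_map (fe := Edge.subst a B) (fun _ => rfl) _ _ _
@[simp] theorem good_map_subst (a : ℕ) (B : Formula) (fb fa : ℕ → ℕ) (P : Graph) :
    Good I j (Graph.map (Edge.subst a B) fb fa P) ↔ Good I j P :=
  good_map (fe := Edge.subst a B) (fun _ => rfl) _ _ _

theorem level_redirect {x y : Edge} (h : I x.name = I y.name) (e : Edge) :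
    I (Edge.redirect x y e).name = I e.name := by
  unfold Edge.redirect
  split_ifs with he
  · rw [← h, he]
  · rfl

theorem resp_redirect {x y : Edge} (h : I x.name = I y.name) (P : Graph) :
    Resp I (redirect x y P) ↔ Resp I P := resp_map (level_redirect h) _ _ _

theorem good_redirect {x y : Edge} (h : I x.name = I y.name) (P : Graph) :
    Good I j (redirect x y P) ↔ Good I j P := good_map (level_redirect h) _ _ _
end

/-! ## Renaming of eigenvariables -/

/-- `P'` has the same weight as `P`, and no cuts of lower level. -/
def Similar (I : ℕ → ℤ) (P P' : Graph) : Prop :=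
  weight P' = weight P ∧ ∀ j, Good I j P → Good I j P'

/-- Eigenvariables can be moved out of any finite set, from the premises down, at no cost: renaming
changes labels but neither the nodes nor the levels. This is the only use of `EigenRename` steps; it
is called before a structure is moved past `∀`-right nodes and before a witness is substituted. -/
theorem Proves.evt_eigenvars {I : ℕ → ℤ} {P : Graph} {Γ : Multiset Edge} {c : Edge}
    (h : Proves P Γ c) : Resp I P → ∀ G : Set ℕ, G.Finite →
    Evt I (fun P' => (∀ a ∈ eigenvars P', a ∉ G) ∧ Similar I P P') Γ c P := by
  induction h using Proves.rules with
  | ax hn hl =>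
    exact fun hr G _ => .pure ⟨.ax hn hl, hr⟩ ⟨by simp [Node.eigen], rfl, fun _ h => h⟩
  | daemon o =>
    exact fun hr G _ => .pure ⟨.daemon o, hr⟩ ⟨by simp [Node.eigen], rfl, fun _ h => h⟩
  | left hr hP hi ih =>
    intro hR G hG
    rw [resp_cons] at hR
    refine (Evt.left hr hP hi hR.1 (ih hR.2 G hG)).mono ?_
    rintro _ - ⟨P₁, rfl, hN, -, ha, hw, hg⟩
    refine ⟨by simpa [hr.eigen_eq] using ha, by simp [hw], fun j => ?_⟩
    simpa using fun h h' => ⟨h, hg j h'⟩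
  | cut hP hQ hPQ hl ihP ihQ =>
    intro hR G hG
    simp only [resp_cons, resp_add] at hR
    refine (Evt.cut ⟨hP, hR.2.1⟩ ⟨hQ, hR.2.2⟩ hPQ hl hR.1 (ihP hR.2.1 G hG) (ihQ hR.2.2 G hG)).mono ?_
    rintro _ - ⟨P₁, Q₁, rfl, -, -, -, ⟨ha, hw, hg⟩, ha', hw', hg'⟩
    refine ⟨?_, by simp [hw, hw'], fun j => ?_⟩
    · simpa [Node.eigen, or_imp, forall_and] using ⟨ha, ha'⟩
    · simpa using fun h h₁ h₂ => ⟨h, hg j h₁, hg' j h₂⟩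
  | tensorR hP hQ hPQ ho hl ihP ihQ =>
    intro hR G hG
    simp only [resp_cons, resp_add] at hR
    refine (Evt.tensorR ⟨hP, hR.2.1⟩ ⟨hQ, hR.2.2⟩ hPQ ho hl hR.1 (ihP hR.2.1 G hG)
      (ihQ hR.2.2 G hG)).mono ?_
    rintro _ - ⟨P₁, Q₁, rfl, -, -, -, -, ⟨ha, hw, hg⟩, ha', hw', hg'⟩
    refine ⟨?_, by simp [hw, hw'], fun j => ?_⟩
    · simpa [Node.eigen, or_imp, forall_and] using ⟨ha, ha'⟩
    · simpa using fun h h₁ h₂ => ⟨h, hg j h₁, hg' j h₂⟩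
  | impL hP hQ hPQ ho hl ihP ihQ =>
    intro hR G hG
    simp only [resp_cons, resp_add] at hR
    refine (Evt.impL ⟨hP, hR.2.1⟩ ⟨hQ, hR.2.2⟩ hPQ ho hl hR.1 (ihP hR.2.1 G hG)
      (ihQ hR.2.2 G hG)).mono ?_
    rintro _ - ⟨P₁, Q₁, rfl, -, -, -, -, ⟨ha, hw, hg⟩, ha', hw', hg'⟩
    refine ⟨?_, by simp [hw, hw'], fun j => ?_⟩
    · simpa [Node.eigen, or_imp, forall_and] using ⟨ha, ha'⟩
    · simpa using fun h h₁ h₂ => ⟨h, hg j h₁, hg' j h₂⟩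
  | box₀ hP ho hl hb ih =>
    intro hR G hG
    simp only [resp_cons, resp_inside] at hR
    refine (Evt.box₀ hP ho hl hb hR.1 (ih hR.2 G hG)).mono ?_
    rintro _ - ⟨P₁, rfl, -, -, -, ha, hw, hg⟩
    refine ⟨by simpa [Node.eigen] using ha, by simp [hw], fun j => ?_⟩
    simpa using fun h h' => ⟨h, hg j h'⟩
  | box₁ hP ho hl hi hio hl' hb ih =>
    intro hR G hG
    simp only [resp_cons, resp_inside] at hR
    refine (Evt.box₁ hP ho hl hi hio hl' hb hR.1 hR.2.1 (ih hR.2.2 G hG)).mono ?_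
    rintro _ - ⟨P₁, rfl, -, -, -, -, ha, hw, hg⟩
    refine ⟨by simpa [Node.eigen] using ha, by simp [hw], fun j => ?_⟩
    simpa using fun h h₁ h' => ⟨h, h₁, hg j h'⟩
  | @right n A c o P Γ hr hP ho ha ih =>
    intro hR G hG
    rw [resp_cons] at hR
    -- The eigenvariable of the current node is added to the forbidden set, so that renaming it will
    -- not touch the nodes above.
    have hE := Evt.right hr hP ho ha hR.1 (ih hR.2 (G ∪ n.eigen) (hG.union (by
      cases n <;> simp [Node.eigen])))
    cases hr with
    | impR hl =>
      refine hE.mono ?_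
      rintro _ - ⟨P₁, rfl, -, -, ha, hw, hg⟩
      refine ⟨by simpa [Node.eigen] using ha, by simp [hw], fun j => ?_⟩
      simpa using fun h h' => ⟨h, hg j h'⟩
    | parR hl =>
      refine hE.mono ?_
      rintro _ - ⟨P₁, rfl, -, -, ha, hw, hg⟩
      refine ⟨by simpa [Node.eigen] using ha, by simp [hw], fun j => ?_⟩
      simpa using fun h h' => ⟨h, hg j h'⟩
    | @allR _ _ a hl =>
      refine hE.bind ?_
      rintro _ hN₀ ⟨P₁, rfl, hN, ho₁, ha₁, hw, hg⟩
      rw [zero_add] at hN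
      have ha := ha a rfl
      -- The new name avoids the forbidden set, the eigenvariables above the node and every variable
      -- free in a label there.
      obtain ⟨a', ha'⟩ := ((hG.union (finite_eigenvars P₁)).union
        ((finite_edges P₁).biUnion fun e _ => e.label.finite_fv)).exists_notMem
      simp only [Set.mem_union, Set.mem_iUnion, not_or, not_exists] at ha'
      obtain ⟨⟨h₁, h₂⟩, h₃⟩ := ha'
      have hne : ∀ b ∈ eigenvars P₁, b ≠ a ∧ b ∉ (Formula.var a').fv := by
        intro b hb
        refine ⟨fun h => ha₁ b hb (Or.inr h), ?_⟩
        rw [Formula.fv_var]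
        rintro rfl; exact h₂ hb
      have hs := hN.1.subst a (.var a') hne
      rw [map_subst_of_notMem ha] at hs
      have ho₂ : o.name ∉ edgeNames (Graph.map (Edge.subst a (.var a')) id id P₁) := by
        rwa [edgeNames_map_subst]
      refine Evt.of_step fun K R hf => ⟨⟨.allR (c.subst a (.var a')) o a', ∅⟩ ::ₘ
        Graph.map (Edge.subst a (.var a')) id id P₁, ⟨?_, ?_⟩, hf.mono ?_ ?_, ⟨?_, ?_⟩, Or.inr ?_⟩
      · refine .allR hs ho₂ (fun e he h => h₃ e (hN.1.mem_edges.2 e he) h) ?_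
        rw [hl]
        exact (Formula.all_subst_var (h₃ c hN.1.mem_edges.1)).symm
      · exact (resp_cons _ _ _).2 ⟨by simpa [Node.Respects, Node.edges, Edge.subst] using hR.1,
          by simpa using hN.2⟩
      · intro m
        simp [edgeNames_map_subst, Edge.subst]
      · intro m
        simp [boxNames_map, Node.owns]
      · simp only [mem_eigenvars_cons, Node.eigen, eigenvars_map]
        rintro b (rfl | ⟨b, hb, rfl⟩)
        · exact h₁
        · exact fun h => ha₁ b hb (Or.inl h)
      · refine ⟨by simp [hw, Node.weight], fun j => ?_⟩
        simpa [Node.Above] using fun h => hg j h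
      · have := EigenRename.mk (K := K) (R := R) (d := o) (a := a) (a' := a') hN.1 ha
          (fun e he h => h₃ e he h) h₂
        -- No eigenvariable above the node is `a`, so the general step renames no node there and is
        -- a mere substitution in the labels.
        rw [map_congr (fa' := id) _ _ (fun k => if k = a then a' else k) (fun _ _ => rfl) (fun _ _ => rfl)
          (fun b hb => if_neg (hne b hb).1)] at this
        simpa using this

/-! ### Periodic levels and fresh edges -/

/-- Every level that occurs, occurs infinitely often. -/
def Recurrent (I : ℕ → ℤ) : Prop := ∃ N, 0 < N ∧ ∀ n, I (n + N) = I n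

/-- The names `n + k * N` all have the level of `n`, and infinitely many of them avoid a finite set.
Edges created by a step can thus be given the level of the edge they are attached to without
changing the indexing. -/
theorem Recurrent.exists_notMem {I : ℕ → ℤ} (h : Recurrent I) {S : Set ℕ} (hS : S.Finite) (n : ℕ) :
    ∃ m, m ∉ S ∧ I m = I n := by
  obtain ⟨N, hN, h⟩ := h
  have h' : ∀ k, I (n + k * N) = I n := by
    intro k
    induction k with
    | zero => simp
    | succ k ih => rw [Nat.succ_mul, ← add_assoc, h, ih]
  obtain ⟨m, hm, hm'⟩ := (Set.infinite_range_of_injective (f := fun k => n + k * N)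
    (fun a b hab => by simpa [hN.ne'] using hab)).exists_notMem_finite hS
  obtain ⟨k, rfl⟩ := hm
  exact ⟨_, hm', h' k⟩

theorem Recurrent.exists_fresh {I : ℕ → ℤ} (h : Recurrent I) (P : Graph) (A : Formula) (n : ℕ) :
    ∃ x : Edge, x.name ∉ edgeNames P ∧ x.label = A ∧ I x.name = I n := by
  obtain ⟨m, hm, hm'⟩ := h.exists_notMem (finite_edgeNames P) n
  exact ⟨⟨m, A⟩, hm, rfl, hm'⟩

theorem Recurrent.exists_fresh₂ {I : ℕ → ℤ} (h : Recurrent I) (P : Graph) (A B : Formula)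
    (n m : ℕ) : ∃ x y : Edge, x.name ≠ y.name ∧ (x.name ∉ edgeNames P ∧ x.label = A ∧
      I x.name = I n) ∧ y.name ∉ edgeNames P ∧ y.label = B ∧ I y.name = I m := by
  obtain ⟨k, hk, hk'⟩ := h.exists_notMem (finite_edgeNames P) n
  obtain ⟨l, hl, hl'⟩ := h.exists_notMem ((finite_edgeNames P).insert k) m
  simp only [Set.mem_insert_iff, not_or] at hl
  exact ⟨⟨k, A⟩, ⟨l, B⟩, Ne.symm hl.1, ⟨hk, rfl, hk'⟩, hl.2, rfl, hl'⟩

theorem Fits.of_fresh {K : Finset ℕ} {R P P' : Graph} {Γ : Multiset Edge} {c : Edge}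
    (h : Fits K R Γ c P) (he : ∀ n ∈ edgeNames P', n ∈ edgeNames P ∨ n ∉ edgeNames R)
    (hb : ∀ n ∈ boxNames P', n ∈ boxNames P) : Fits K R Γ c P' :=
  ⟨fun n hn hn' => h.edge n ((he n hn).resolve_right (not_not.2 hn')) hn',
    fun b hb' => h.box b (hb b hb')⟩

/-- `P'` has smaller weight than `P`, and no cuts of lower level. -/
def Lighter (I : ℕ → ℤ) (P P' : Graph) : Prop :=
  weight P' < weight P ∧ ∀ j, Good I j P → Good I j P'

/-! ### Linear steps -/

section
variable {I : ℕ → ℤ} {Γ Δ Δ₁ Δ₂ : Multiset Edge} {c d d₁ d₂ e i o o₁ o₂ v : Edge}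
  {P Q Q₁ Q₂ : Graph}

/-- The cut of `P` with `Q`. -/
abbrev cutGraph (d e : Edge) (P Q : Graph) : Graph := ⟨.cut d e, ∅⟩ ::ₘ (P + Q)

theorem evt_axL (hld : o.label = d.label) (hP : Proves P (e ::ₘ Γ) c)
    (hPQ : Apart P {⟨.ax o d, ∅⟩}) (hl : d.label = e.label) {W : Graph}
    (hW : W = cutGraph d e P {⟨.ax o d, ∅⟩}) (hR : Resp I W) :
    Evt I (Lighter I W) (Γ + {o}) c W := by
  subst hW
  have ho : o.name ∉ edgeNames P := fun h => hPQ.names h (by simp)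
  have hm := hP.mem_names (n := e.name) (by simp)
  have h₁ := hP.head_notMem
  have hne : e.name ≠ o.name := fun h => ho (h ▸ hm)
  have hlev : I e.name = I o.name := by
    simp [Node.Respects, Node.edges] at hR
    grind
  refine Evt.of_step fun K R hf => ⟨redirect e o P, ⟨?_, ?_⟩, hf.mono ?_ ?_, ⟨?_, ?_⟩, Or.inl ?_⟩
  · rw [add_comm, Multiset.singleton_add]
    exact hP.redirect_input ho (hld.trans hl)
  · rw [resp_redirect hlev]; simp at hR; tauto
  · intro m hm
    have := edgeNames_redirect hm
    simp
    tauto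
  · intro m; rw [boxNames_redirect]; simp; tauto
  · simp [Node.weight]; omega
  · intro j; rw [good_redirect hlev]; simp; tauto
  -- The step redirects `e` in the entire graph. As `e` is internal to the cut and not on the
  -- interface, the context does not contain it and is left alone.
  · have heR : e.name ∉ edgeNames R := fun h => by
      have := hf.edge e.name (by simp) h
      simp only [mem_namesOf_add, mem_namesOf_singleton] at this
      tauto
    convert Step.axL (K := K) (R := inside K P + R) (e₀ := o) (e₁ := d) (e₂ := e) using 1
    · simp only [inside_add, inside_singleton, Finset.empty_union,
        ← Multiset.singleton_add]
      abel
    · rw [redirect_add, redirect_inside, redirect_of_notMem heR]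

/-- The second conclusion is stronger than `Lighter`: the reduct is `Q` with its output redirected,
so its cuts are bounded by those of `Q` alone, however low the removed cut was. This is how a box
cut with an axiom loses its cut of the lowest level. -/
theorem evt_axR (heo : e.label = o.label) (hQ : Proves Q Δ d)
    (hPQ : Apart {⟨.ax e o, ∅⟩} Q) (hl : d.label = e.label) {W : Graph}
    (hW : W = cutGraph d e {⟨.ax e o, ∅⟩} Q) (hR : Resp I W) :
    Evt I (fun P' => Lighter I W P' ∧ ∀ j, Good I j Q → Good I j P') Δ o W := by
  subst hW
  have ho : o.name ∉ edgeNames Q := hPQ.names (by simp)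
  have hm := hQ.mem_names (n := d.name) (by simp)
  have h₁ := hQ.out_notMem
  have hne : d.name ≠ o.name := fun h => ho (h ▸ hm)
  have hlev : I d.name = I o.name := by
    simp [Node.Respects, Node.edges] at hR
    grind
  refine Evt.of_step fun K R hf => ⟨redirect d o Q, ⟨?_, ?_⟩, hf.mono ?_ ?_, ⟨⟨?_, ?_⟩, ?_⟩,
    Or.inl ?_⟩
  · exact hQ.redirect_output ho (heo.symm.trans hl.symm)
  · rw [resp_redirect hlev]; simp at hR; exact hR.2.2
  · intro m hm
    have := edgeNames_redirect hm
    simp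
    tauto
  · intro m; rw [boxNames_redirect]; simp; tauto
  · simp [Node.weight]; omega
  · intro j; rw [good_redirect hlev]; simp
  · intro j; rw [good_redirect hlev]; exact id
  · have heR : d.name ∉ edgeNames R := fun h => by
      have := hf.edge d.name (by simp) h
      tauto
    convert Step.axR (K := K) (R := inside K Q + R) (e₁ := d) (e₂ := e) (e₃ := o) using 1
    · simp only [inside_add, inside_singleton, Finset.empty_union,
        ← Multiset.singleton_add]
      abel
    · rw [redirect_add, redirect_inside, redirect_of_notMem heR]

theorem evt_tensor (hP : Proves P (o₁ ::ₘ o₂ ::ₘ Γ) c) (hQ₁ : Proves Q₁ Δ₁ d₁)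
    (hQ₂ : Proves Q₂ Δ₂ d₂) (hQ : Apart Q₁ Q₂)
    (hPQ : Apart (⟨.tensorL e o₁ o₂, ∅⟩ ::ₘ P) (⟨.tensorR d₁ d₂ d, ∅⟩ ::ₘ (Q₁ + Q₂)))
    (hd : d.label = d₁.label.tensor d₂.label) (he : e.label = o₁.label.tensor o₂.label)
    (hl : d.label = e.label) {W : Graph}
    (hW : W = cutGraph d e (⟨.tensorL e o₁ o₂, ∅⟩ ::ₘ P) (⟨.tensorR d₁ d₂ d, ∅⟩ ::ₘ (Q₁ + Q₂)))
    (hR : Resp I W) : Evt I (Lighter I W) (Γ + (Δ₁ + Δ₂)) c W := by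
  subst hW
  obtain ⟨h₁, h₂⟩ := Formula.tensor_inj (hd.symm.trans (hl.trans he))
  have hm₁ := hQ₁.mem_names (Or.inl rfl)
  have hm₂ := hQ₂.mem_names (Or.inl rfl)
  have hm₃ := hP.mem_names (n := o₁.name) (by simp)
  have hm₄ := hP.mem_names (n := o₂.name) (by simp)
  rw [apart_iff] at hQ hPQ
  refine Evt.of_step fun K R hf => ⟨cutGraph d₂ o₂ (cutGraph d₁ o₁ P Q₁) Q₂, ⟨?_, ?_⟩,
    hf.mono ?_ ?_, ⟨?_, ?_⟩, Or.inl ?_⟩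
  · have := Proves.cut hP hQ₁ (apart_iff.2 ?_) h₁
    · rw [Multiset.cons_add] at this
      have := Proves.cut this hQ₂ (apart_iff.2 ?_) h₂
      · rwa [add_assoc] at this
      · simp only [mem_edgeNames_cons, mem_edgeNames_add, mem_boxNames_cons, mem_boxNames_add,
          names_cut, Node.owns] at *
        grind
    · simp only [mem_edgeNames_cons, mem_edgeNames_add, mem_boxNames_cons, mem_boxNames_add] at *
      grind
  · simp [Node.Respects, Node.edges] at hR ⊢
    grind
  · simp
    grind
  · simp [Node.owns]; grind
  · simp [Node.weight]; omega
  · intro j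
    simp [Node.Above, Node.Respects, Node.edges] at hR ⊢
    grind
  · convert Step.tensor (K := K) (R := inside K (P + Q₁ + Q₂) + R) (i₁ := d₁) (i₂ := d₂) (d := d)
      (e := e) (o₁ := o₁) (o₂ := o₂) using 1 <;>
    · simp only [inside_add, inside_singleton, Finset.empty_union,
        ← Multiset.singleton_add]
      abel

/-- The reduct is derived by cutting the argument `P₂` into the body `Q`, and then the result into
`P₁`. Both new cuts stay on the level of the old one. -/
theorem evt_imp {P₁ P₂ : Graph} {Γ₁ Γ₂ : Multiset Edge} {a b : Edge}
    (hP₁ : Proves P₁ (o ::ₘ Γ₁) c) (hP₂ : Proves P₂ Γ₂ a) (hP : Apart P₁ P₂)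
    (hQ : Proves Q (v ::ₘ Δ) b)
    (hPQ : Apart (⟨.impL e a o, ∅⟩ ::ₘ (P₁ + P₂)) (⟨.impR b v d, ∅⟩ ::ₘ Q))
    (hd : d.label = v.label.imp b.label) (he : e.label = a.label.imp o.label)
    (hl : d.label = e.label) {W : Graph}
    (hW : W = cutGraph d e (⟨.impL e a o, ∅⟩ ::ₘ (P₁ + P₂)) (⟨.impR b v d, ∅⟩ ::ₘ Q))
    (hR : Resp I W) : Evt I (Lighter I W) ((Γ₁ + Γ₂) + Δ) c W := by
  subst hW
  obtain ⟨h₁, h₂⟩ := Formula.imp_inj (hd.symm.trans (hl.trans he))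
  have hm₁ := hQ.mem_names (Or.inl rfl)
  have hm₂ := hQ.mem_names (n := v.name) (by simp)
  have hm₃ := hP₁.mem_names (n := o.name) (by simp)
  have hm₄ := hP₂.mem_names (Or.inl rfl)
  rw [apart_iff] at hP hPQ
  refine Evt.of_step fun K R hf => ⟨cutGraph b o P₁ (cutGraph a v Q P₂), ⟨?_, ?_⟩,
    hf.mono ?_ ?_, ⟨?_, ?_⟩, Or.inl ?_⟩
  · have := Proves.cut hQ hP₂ (apart_iff.2 ?_) h₁.symm
    · have := Proves.cut hP₁ this (apart_iff.2 ?_) h₂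
      · rwa [add_comm Δ, ← add_assoc] at this
      · simp only [mem_edgeNames_cons, mem_edgeNames_add, mem_boxNames_cons, mem_boxNames_add,
          names_cut, Node.owns] at *
        grind
    · simp only [mem_edgeNames_cons, mem_edgeNames_add, mem_boxNames_cons, mem_boxNames_add] at *
      grind
  · simp [Node.Respects, Node.edges] at hR ⊢
    grind
  · simp
    grind
  · simp [Node.owns]; grind
  · simp [Node.weight]; omega
  · intro j
    simp [Node.Above, Node.Respects, Node.edges] at hR ⊢
    grind
  · convert Step.imp (K := K) (R := inside K (P₁ + P₂ + Q) + R) (b := b) (v := v) (d := d)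
      (e := e) (a := a) (o := o) using 1 <;>
    · simp only [inside_add, inside_singleton, Finset.empty_union,
        ← Multiset.singleton_add]
      abel

theorem evt_par (hP : Proves P (o ::ₘ Γ) c) (hQ : Proves Q Δ d₁)
    (hPQ : Apart (⟨.parL e o, ∅⟩ ::ₘ P) (⟨.parR d₁ d, ∅⟩ ::ₘ Q))
    (hd : d.label = d₁.label.par) (he : e.label = o.label.par)
    (hl : d.label = e.label) {W : Graph}
    (hW : W = cutGraph d e (⟨.parL e o, ∅⟩ ::ₘ P) (⟨.parR d₁ d, ∅⟩ ::ₘ Q))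
    (hR : Resp I W) : Evt I (Lighter I W) (Γ + Δ) c W := by
  subst hW
  have h₁ := Formula.par_inj (hd.symm.trans (hl.trans he))
  have hm₁ := hQ.mem_names (Or.inl rfl)
  have hm₂ := hP.mem_names (n := o.name) (by simp)
  rw [apart_iff] at hPQ
  refine Evt.of_step fun K R hf => ⟨cutGraph d₁ o P Q, ⟨?_, ?_⟩,
    hf.mono ?_ ?_, ⟨?_, ?_⟩, Or.inl ?_⟩
  · refine Proves.cut hP hQ (apart_iff.2 ?_) h₁
    simp only [mem_edgeNames_cons, mem_boxNames_cons] at *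
    grind
  · simp [Node.Respects, Node.edges] at hR ⊢
    grind
  · simp
    grind
  · simp [Node.owns]
  · simp [Node.weight]; omega
  · intro j
    simp [Node.Above, Node.Respects, Node.edges] at hR ⊢
    grind
  · convert Step.par (K := K) (R := inside K (P + Q) + R) (c := d₁) (d := d)
      (e := e) (o := o) using 1 <;>
    · simp only [inside_add, inside_singleton, Finset.empty_union,
        ← Multiset.singleton_add]
      abel

/-- The witness may be substituted above `∀`-right only if it meets no eigenvariable there, so those
are first renamed away from `a` and from the variables of `B`. The inputs of `Q` do not contain `a`,
hence keep their labels, and injectivity of the quantifier makes the new cut well typed. The weight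
drops since neither renaming nor substitution adds nodes. -/
theorem evt_all {a a' : ℕ} {A B : Formula} (hP : Proves P (o ::ₘ Γ) c) (hi : e.name ∉ edgeNames P)
    (hQ : Proves Q Δ d₁) (hid : d.name ∉ edgeNames Q) (ha : ∀ x ∈ Δ, a ∉ x.label.fv)
    (hPQ : Apart (⟨.allL e o, ∅⟩ ::ₘ P) (⟨.allR d₁ d a, ∅⟩ ::ₘ Q))
    (hd : d.label = d₁.label.all a) (he : e.label = A.all a') (ho : o.label = A.subst a' B)
    (hl : d.label = e.label) {W : Graph}
    (hW : W = cutGraph d e (⟨.allL e o, ∅⟩ ::ₘ P) (⟨.allR d₁ d a, ∅⟩ ::ₘ Q))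
    (hR : Resp I W) : Evt I (Lighter I W) (Γ + Δ) c W := by
  subst hW
  have h₁ := Formula.subst_eq_of_all_eq (hd.symm.trans (hl.trans he)) B
  have hR' := hR
  simp only [resp_cons, resp_add] at hR
  have hE₀ := hQ.evt_eigenvars hR.2.2.2 ({a} ∪ B.fv)
    ((Set.finite_singleton a).union B.finite_fv)
  have hQ' := hQ
  rw [← zero_add Δ] at hE₀ hQ'
  have hE := Evt.cutR (.allL hP hi he ho) ((resp_cons _ _ _).2 hR.2.1) (.allR hQ hid ha hd) hPQ hl
    hR.1 (Evt.right (.allR hd) hQ' hid (by rintro a rfl; exact ha) hR.2.2.1 hE₀)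
  refine hE.bind ?_
  rintro _ - ⟨_, rfl, -, hPQ', ⟨Q₁, rfl, hQ₁, hid₁, heig, hw, hg⟩⟩
  rw [zero_add] at hQ₁
  have heig : ∀ b ∈ eigenvars Q₁, b ≠ a ∧ b ∉ B.fv := by
    intro b hb
    have := heig b hb
    simpa only [Set.mem_union, Set.mem_singleton_iff, not_or] using this
  have hs := hQ₁.1.subst a B heig
  rw [map_subst_of_notMem ha] at hs
  have hm₁ := hQ₁.1.mem_names (Or.inl rfl)
  have hm₂ := hP.mem_names (n := o.name) (by simp)
  rw [apart_iff] at hPQ'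
  refine Evt.of_step fun K R hf => ⟨cutGraph (d₁.subst a B) o P
    (Graph.map (Edge.subst a B) id id Q₁), ⟨?_, ?_⟩, hf.mono ?_ ?_, ⟨?_, ?_⟩, Or.inl ?_⟩
  · refine Proves.cut hP hs (apart_iff.2 ?_) (h₁.trans ho.symm)
    simp only [mem_edgeNames_cons, mem_boxNames_cons, edgeNames_map_subst, boxNames_map] at *
    grind
  · simp [Node.Respects, Node.edges, Edge.subst] at hR ⊢
    have := hQ₁.2
    grind
  · simp [edgeNames_map_subst, Edge.subst]
    grind
  · simp [Node.owns, boxNames_map]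
  · simp [Node.weight, hw]; omega
  · intro j
    have := hg j
    simp [Node.Above, Node.Respects, Node.edges, Edge.subst] at hR ⊢
    grind
  · convert Step.all (K := K) (R := inside K P + R) (c := d₁) (d := d)
      (e := e) (o := o) hQ₁.1 ha heig (ho.trans h₁.symm) using 1 <;>
    · simp only [inside_add, inside_singleton, Finset.empty_union,
        ← Multiset.singleton_add]
      abel
end

section
variable {I : ℕ → ℤ} {Γ Δ Δ₁ Δ₂ : Multiset Edge} {c d d₁ d₂ e i o o₁ o₂ v : Edge}
  {P Q Q₁ Q₂ : Graph} {n : Node}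

/-! ## Garbage collection -/

theorem evt_daemon_weak (hP : Proves P Γ c) {W : Graph}
    (hW : W = cutGraph d e (⟨.weak e, ∅⟩ ::ₘ P) {⟨.daemon d, ∅⟩})
    (hR : Resp I W) : Evt I (Lighter I W) Γ c W := by
  subst hW
  refine Evt.of_step fun K R hf => ⟨P, ⟨hP, ?_⟩, hf.mono ?_ ?_, ⟨?_, ?_⟩, Or.inl ?_⟩
  · simp at hR; tauto
  · simp; tauto
  · simp; tauto
  · simp [Node.weight]; omega
  · intro j; simp; tauto
  · convert Step.daemonWeak (K := K) (R := inside K P + R) (d := d) (e := e) using 1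
    simp only [inside_add, inside_singleton, Finset.empty_union,
      ← Multiset.singleton_add]
    abel

theorem evt_tensor_weak (hI : Recurrent I) (hP : Proves P Γ c) (hQ₁ : Proves Q₁ Δ₁ d₁)
    (hQ₂ : Proves Q₂ Δ₂ d₂) (hQ : Apart Q₁ Q₂)
    (hPQ : Apart (⟨.weak e, ∅⟩ ::ₘ P) (⟨.tensorR d₁ d₂ d, ∅⟩ ::ₘ (Q₁ + Q₂))) {W : Graph}
    (hW : W = cutGraph d e (⟨.weak e, ∅⟩ ::ₘ P) (⟨.tensorR d₁ d₂ d, ∅⟩ ::ₘ (Q₁ + Q₂)))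
    (hR : Resp I W) : Evt I (Lighter I W) (Γ + (Δ₁ + Δ₂)) c W := by
  subst hW
  have hm₁ := hQ₁.mem_names (Or.inl rfl)
  have hm₂ := hQ₂.mem_names (Or.inl rfl)
  rw [apart_iff] at hQ hPQ
  refine Evt.of_step fun K R hf => ?_
  obtain ⟨x₁, x₂, hne, ⟨hx₁, hl₁, hI₁⟩, hx₂, hl₂, hI₂⟩ := hI.exists_fresh₂
    (inside K (cutGraph d e (⟨.weak e, ∅⟩ ::ₘ P) (⟨.tensorR d₁ d₂ d, ∅⟩ ::ₘ (Q₁ + Q₂))) + R)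
    d₁.label d₂.label d₁.name d₂.name
  have hx₁' := hx₁
  have hx₂' := hx₂
  simp only [mem_edgeNames_add, mem_edgeNames_inside, mem_edgeNames_cons, names_weak, names_cut,
    names_tensorR, not_or] at hx₁' hx₂'
  refine ⟨cutGraph d₂ x₂ (⟨.weak x₂, ∅⟩ ::ₘ cutGraph d₁ x₁ (⟨.weak x₁, ∅⟩ ::ₘ P) Q₁) Q₂, ⟨?_, ?_⟩,
    hf.of_fresh ?_ ?_, ⟨?_, ?_⟩, Or.inl ?_⟩
  · have := Proves.cut (.weak (i := x₁) hP hx₁'.1.2.1.2) hQ₁ (apart_iff.2 ?_) hl₁.symm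
    · have := Proves.cut (.weak (i := x₂) this ?_) hQ₂ (apart_iff.2 ?_) hl₂.symm
      · rwa [add_assoc] at this
      · simp only [mem_edgeNames_cons, mem_edgeNames_add, names_cut, names_weak]; grind
      · simp only [mem_edgeNames_cons, mem_edgeNames_add, mem_boxNames_cons, mem_boxNames_add,
          names_cut, names_weak, Node.owns] at *
        grind
    · simp only [mem_edgeNames_cons, mem_edgeNames_add, mem_boxNames_cons, mem_boxNames_add,
        names_weak, Node.owns] at *
      grind
  · simp [Node.Respects, Node.edges] at hR ⊢
    grind
  · simp
    grind
  · simp [Node.owns]; grind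
  · simp [Node.weight]; omega
  · intro j
    simp [Node.Above, Node.Respects, Node.edges] at hR ⊢
    grind
  · convert Step.tensorWeak (K := K) (R := inside K (P + Q₁ + Q₂) + R) (i₁ := d₁) (i₂ := d₂)
      (d := d) (e := e) (x₁ := x₁) (x₂ := x₂) ?_ hne hx₁ hl₁ hx₂ hl₂ using 1 <;>
    · simp only [inside_add, Finset.empty_union,
        ← Multiset.singleton_add, inside_singleton]
      abel

theorem evt_imp_weak {b : Edge} (hI : Recurrent I) (hP : Proves P Γ c)
    (hQ : Proves Q (v ::ₘ Δ) b)
    (hPQ : Apart (⟨.weak e, ∅⟩ ::ₘ P) (⟨.impR b v d, ∅⟩ ::ₘ Q)) {W : Graph}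
    (hW : W = cutGraph d e (⟨.weak e, ∅⟩ ::ₘ P) (⟨.impR b v d, ∅⟩ ::ₘ Q))
    (hR : Resp I W) : Evt I (Lighter I W) (Γ + Δ) c W := by
  subst hW
  have hm₁ := hQ.mem_names (Or.inl rfl)
  have hm₂ := hQ.mem_names (n := v.name) (by simp)
  rw [apart_iff] at hPQ
  refine Evt.of_step fun K R hf => ?_
  obtain ⟨x, y, hne, ⟨hx, hl₁, hI₁⟩, hy, hl₂, hI₂⟩ := hI.exists_fresh₂
    (inside K (cutGraph d e (⟨.weak e, ∅⟩ ::ₘ P) (⟨.impR b v d, ∅⟩ ::ₘ Q)) + R)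
    b.label v.label b.name v.name
  have hx' := hx
  have hy' := hy
  simp only [mem_edgeNames_add, mem_edgeNames_inside, mem_edgeNames_cons, names_weak, names_cut,
    names_impR, not_or] at hx' hy'
  refine ⟨cutGraph b x (⟨.weak x, ∅⟩ ::ₘ P) (cutGraph y v Q {⟨.daemon y, ∅⟩}), ⟨?_, ?_⟩,
    hf.of_fresh ?_ ?_, ⟨?_, ?_⟩, Or.inl ?_⟩
  · have := Proves.cut hQ (.daemon y) (apart_iff.2 ?_) hl₂
    · have := Proves.cut (.weak (i := x) hP hx'.1.2.1.2) this (apart_iff.2 ?_) hl₁.symm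
      · rwa [add_zero] at this
      · simp only [mem_edgeNames_cons, mem_edgeNames_add, mem_boxNames_cons, mem_boxNames_add,
          mem_edgeNames_singleton, mem_boxNames_singleton, names_daemon,
          names_cut, names_weak, Node.owns] at *
        grind
    · simp only [mem_edgeNames_singleton, mem_boxNames_singleton, names_daemon, Node.owns] at *
      grind
  · simp [Node.Respects, Node.edges] at hR ⊢
    grind
  · simp
    grind
  · simp [Node.owns]
  · simp [Node.weight]; omega
  · intro j
    simp [Node.Above, Node.Respects, Node.edges] at hR ⊢
    grind
  · convert Step.impWeak (K := K) (R := inside K (P + Q) + R) (b := b) (v := v)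
      (d := d) (e := e) (x := x) (y := y) ?_ hne hx hl₁ hy hl₂ using 1 <;>
    · simp only [inside_add, Finset.empty_union,
        ← Multiset.singleton_add, inside_singleton]
      abel

/-- A right node with one premise and no discharged input, cut with a weakening. -/
theorem evt_right_weak (hI : Recurrent I) (hP : Proves P Γ c) (hQ : Proves Q Δ d₁)
    {A : Multiset Edge} (hr : RightRule n A d₁ d)
    (hstep : ∀ {K P R x}, P = ⟨n, K⟩ ::ₘ ⟨.cut d e, K⟩ ::ₘ ⟨.weak e, K⟩ ::ₘ R →
      x.name ∉ edgeNames P → x.label = d₁.label → Step P (⟨.cut d₁ x, K⟩ ::ₘ ⟨.weak x, K⟩ ::ₘ R))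
    (hPQ : Apart (⟨.weak e, ∅⟩ ::ₘ P) (⟨n, ∅⟩ ::ₘ Q)) {W : Graph}
    (hW : W = cutGraph d e (⟨.weak e, ∅⟩ ::ₘ P) (⟨n, ∅⟩ ::ₘ Q))
    (hR : Resp I W) : Evt I (Lighter I W) (Γ + Δ) c W := by
  subst hW
  have hm₁ := hQ.mem_names (Or.inl rfl)
  have hw : n.weight = 3 := by cases hr <;> rfl
  -- At a `§` node the premise is one level higher, so equality fails; the inequality suffices for
  -- the new cut not to be lower.
  have hlev : I d.name ≤ I d₁.name := by
    simp only [resp_cons, resp_add] at hR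
    have := hR.2.2.1
    cases hr <;> simp [Node.Respects, Node.edges] at this <;> omega
  rw [apart_iff] at hPQ
  refine Evt.of_step fun K R hf => ?_
  obtain ⟨x, hx, hl₁, hI₁⟩ := hI.exists_fresh
    (inside K (cutGraph d e (⟨.weak e, ∅⟩ ::ₘ P) (⟨n, ∅⟩ ::ₘ Q)) + R)
    d₁.label d₁.name
  have hx' := hx
  simp only [mem_edgeNames_add, mem_edgeNames_inside, mem_edgeNames_cons, names_weak, names_cut,
    not_or] at hx'
  refine ⟨cutGraph d₁ x (⟨.weak x, ∅⟩ ::ₘ P) Q, ⟨?_, ?_⟩,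
    hf.of_fresh ?_ ?_, ⟨?_, ?_⟩, Or.inl ?_⟩
  · refine Proves.cut (.weak (i := x) hP hx'.1.2.1.2) hQ (apart_iff.2 ?_) hl₁.symm
    simp only [mem_edgeNames_cons, mem_boxNames_cons, names_weak, Node.owns] at *
    grind
  · simp [Node.Respects, Node.edges] at hR ⊢
    grind
  · simp
    grind
  · simp [Node.owns]; grind
  · simp only [weight_cons, weight_add, hw]; simp [Node.weight]
  · intro j
    simp [Node.Above] at hR ⊢
    grind
  · convert hstep (K := K) (R := inside K (P + Q) + R) (x := x) ?_ hx hl₁ using 1 <;>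
    · simp only [inside_add, Finset.empty_union,
        ← Multiset.singleton_add, inside_singleton]
      abel

/-- A left node with two outgoing edges, cut with a dæmon. -/
theorem evt_daemon_two (hI : Recurrent I) (hP : Proves P (o₁ ::ₘ o₂ ::ₘ Γ) c)
    (hstep : ∀ {K P R y₁ y₂}, P = ⟨.daemon d, K⟩ ::ₘ ⟨.cut d e, K⟩ ::ₘ ⟨n, K⟩ ::ₘ R →
      y₁.name ≠ y₂.name → y₁.name ∉ edgeNames P → y₁.label = o₁.label →
      y₂.name ∉ edgeNames P → y₂.label = o₂.label → Step P (⟨.daemon y₁, K⟩ ::ₘ ⟨.cut y₁ o₁, K⟩ ::ₘ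
        ⟨.daemon y₂, K⟩ ::ₘ ⟨.cut y₂ o₂, K⟩ ::ₘ R)) {W : Graph}
    (hlev : n.Respects I → I o₁.name = I e.name ∧ I o₂.name = I e.name) (hw : n.weight = 3)
    (hW : W = cutGraph d e (⟨n, ∅⟩ ::ₘ P) {⟨.daemon d, ∅⟩})
    (hR : Resp I W) : Evt I (Lighter I W) Γ c W := by
  subst hW
  have hm₁ := hP.mem_names (n := o₁.name) (by simp)
  have hm₂ := hP.mem_names (n := o₂.name) (by simp)
  refine Evt.of_step fun K R hf => ?_
  obtain ⟨y₁, y₂, hne, ⟨hy₁, hl₁, hI₁⟩, hy₂, hl₂, hI₂⟩ := hI.exists_fresh₂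
    (inside K (cutGraph d e (⟨n, ∅⟩ ::ₘ P) {⟨.daemon d, ∅⟩}) + R)
    o₁.label o₂.label o₁.name o₂.name
  have hy₁' := hy₁
  have hy₂' := hy₂
  simp only [mem_edgeNames_add, mem_edgeNames_inside, mem_edgeNames_cons, names_cut, not_or]
    at hy₁' hy₂'
  refine ⟨cutGraph y₂ o₂ (cutGraph y₁ o₁ P {⟨.daemon y₁, ∅⟩}) {⟨.daemon y₂, ∅⟩}, ⟨?_, ?_⟩,
    hf.of_fresh ?_ ?_, ⟨?_, ?_⟩, Or.inl ?_⟩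
  · have := Proves.cut hP (.daemon y₁) (apart_iff.2 ?_) hl₁
    · rw [add_zero] at this
      have := Proves.cut this (.daemon y₂) (apart_iff.2 ?_) hl₂
      · rwa [add_zero] at this
      · simp [Node.owns]; grind
    · simp [Node.owns]; grind
  · simp [Node.Respects, Node.edges] at hR ⊢
    grind
  · simp
    grind
  · simp [Node.owns]; grind
  · simp only [weight_cons, weight_add, weight_singleton, hw]; simp [Node.weight]; omega
  · intro j
    simp only [resp_cons, resp_add] at hR
    have := hlev hR.2.1.1
    simp [Node.Above, Node.Respects, Node.edges] at hR ⊢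
    grind
  · convert hstep (K := K) (R := inside K P + R) (y₁ := y₁) (y₂ := y₂) ?_ hne hy₁ hl₁ hy₂ hl₂
      using 1 <;>
    · simp only [inside_add, Finset.empty_union,
        ← Multiset.singleton_add, inside_singleton]
      abel

/-- A left node with one outgoing edge, cut with a dæmon. -/
theorem evt_daemon_one (hI : Recurrent I) (hP : Proves P (o ::ₘ Γ) c)
    (hstep : ∀ {K P R y}, P = ⟨.daemon d, K⟩ ::ₘ ⟨.cut d e, K⟩ ::ₘ ⟨n, K⟩ ::ₘ R →
      y.name ∉ edgeNames P → y.label = o.label →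
      Step P (⟨.daemon y, K⟩ ::ₘ ⟨.cut y o, K⟩ ::ₘ R)) {W : Graph}
    (hlev : n.Respects I → I e.name ≤ I o.name) (hw : n.weight = 3)
    (hW : W = cutGraph d e (⟨n, ∅⟩ ::ₘ P) {⟨.daemon d, ∅⟩})
    (hR : Resp I W) : Evt I (Lighter I W) Γ c W := by
  subst hW
  have hm₁ := hP.mem_names (n := o.name) (by simp)
  refine Evt.of_step fun K R hf => ?_
  obtain ⟨y, hy, hl₁, hI₁⟩ := hI.exists_fresh
    (inside K (cutGraph d e (⟨n, ∅⟩ ::ₘ P) {⟨.daemon d, ∅⟩}) + R) o.label o.name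
  have hy' := hy
  simp only [mem_edgeNames_add, mem_edgeNames_inside, mem_edgeNames_cons, names_cut, not_or] at hy'
  refine ⟨cutGraph y o P {⟨.daemon y, ∅⟩}, ⟨?_, ?_⟩,
    hf.of_fresh ?_ ?_, ⟨?_, ?_⟩, Or.inl ?_⟩
  · have := Proves.cut hP (.daemon y) (apart_iff.2 ?_) hl₁
    · rwa [add_zero] at this
    · simp [Node.owns]; grind
  · simp [Node.Respects, Node.edges] at hR ⊢
    grind
  · simp
    grind
  · simp [Node.owns]; grind
  · simp only [weight_cons, weight_add, weight_singleton, hw]; simp [Node.weight]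
  · intro j
    simp only [resp_cons, resp_add] at hR
    have := hlev hR.2.1.1
    simp [Node.Above, Node.Respects, Node.edges] at hR ⊢
    grind
  · convert hstep (K := K) (R := inside K P + R) (y := y) ?_ hy hl₁ using 1 <;>
    · simp only [inside_add, Finset.empty_union,
        ← Multiset.singleton_add, inside_singleton]
      abel

/-- Consuming the auxiliary port puts the dæmon and the cut inside the box, which becomes a box
without assumption. The new cut is one level higher. -/
theorem evt_daemon_box {b : ℕ} {x : Edge} (hI : Recurrent I) (hP : Proves P {x} c)
    (ho : o.name ∉ edgeNames P) (hl : o.label = c.label.bang)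
    (hb : b ∉ boxNames P) {W : Graph}
    (hW : W = cutGraph d e (⟨.bangR c o b, ∅⟩ ::ₘ ⟨.bangL e x (some b), ∅⟩ ::ₘ inside {b} P)
      {⟨.daemon d, ∅⟩})
    (hR : Resp I W) : Evt I (Lighter I W) 0 o W := by
  subst hW
  have hm₁ := hP.mem_names (n := x.name) (by simp)
  refine Evt.of_step fun K R hf => ?_
  obtain ⟨y, hy, hl₁, hI₁⟩ := hI.exists_fresh
    (inside K (cutGraph d e (⟨.bangR c o b, ∅⟩ ::ₘ ⟨.bangL e x (some b), ∅⟩ ::ₘ inside {b} P)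
      {⟨.daemon d, ∅⟩}) + R) x.label x.name
  have hy' := hy
  simp only [mem_edgeNames_add, mem_edgeNames_inside, mem_edgeNames_cons, names_cut, names_bangR,
    not_or] at hy'
  have hlev : I e.name ≤ I x.name := by
    simp [Node.Respects] at hR; omega
  refine ⟨⟨.bangR c o b, ∅⟩ ::ₘ inside {b} (cutGraph y x P {⟨.daemon y, ∅⟩}), ⟨?_, ?_⟩,
    hf.of_fresh ?_ ?_, ⟨?_, ?_⟩, Or.inl ?_⟩
  · have := Proves.cut (Γ := 0) hP (.daemon y) (apart_iff.2 ?_) hl₁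
    · refine Proves.box₀ this ?_ hl ?_
      · simp; grind
      · simpa [Node.owns]
    · simp [Node.owns]; grind
  · simp [Node.Respects, Node.edges] at hR ⊢
    grind
  · simp
    grind
  · simp [Node.owns]
  · simp [Node.weight]; omega
  · intro j
    simp [Node.Above, Node.Respects, Node.edges] at hR ⊢
    grind
  · convert Step.daemonBang (K := K) (R := ⟨.bangR c o b, K⟩ ::ₘ (inside ({b} ∪ K) P + R))
      (d := d) (e := e) (o := x) (p := some b) (y := y) ?_ hy hl₁ using 1 <;>
    · simp only [inside_add, Finset.empty_union, Option.toFinset_some,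
        ← Multiset.singleton_add, inside_singleton, inside_inside, Finset.union_comm K]
      abel

/-- The result receives a dæmon. The argument loses its consumer, so a weakening is added to the
main structure and the argument is cut with it, which keeps the graph derivable with the same
inputs. -/
theorem evt_daemon_imp {P₁ P₂ : Graph} {Γ₁ Γ₂ : Multiset Edge} {a : Edge} (hI : Recurrent I)
    (hP₁ : Proves P₁ (o ::ₘ Γ₁) c) (hP₂ : Proves P₂ Γ₂ a) (hP : Apart P₁ P₂) {W : Graph}
    (hW : W = cutGraph d e (⟨.impL e a o, ∅⟩ ::ₘ (P₁ + P₂)) {⟨.daemon d, ∅⟩})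
    (hR : Resp I W) : Evt I (Lighter I W) (Γ₁ + Γ₂) c W := by
  subst hW
  have hm₁ := hP₁.mem_names (n := o.name) (by simp)
  have hm₂ := hP₂.mem_names (Or.inl rfl)
  rw [apart_iff] at hP
  refine Evt.of_step fun K R hf => ?_
  obtain ⟨x, y, hne, ⟨hx, hl₁, hI₁⟩, hy, hl₂, hI₂⟩ := hI.exists_fresh₂
    (inside K (cutGraph d e (⟨.impL e a o, ∅⟩ ::ₘ (P₁ + P₂)) {⟨.daemon d, ∅⟩}) + R)
    a.label o.label a.name o.name
  have hx' := hx
  have hy' := hy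
  simp only [mem_edgeNames_add, mem_edgeNames_inside, mem_edgeNames_cons, names_cut, not_or]
    at hx' hy'
  refine ⟨cutGraph a x (⟨.weak x, ∅⟩ ::ₘ cutGraph y o P₁ {⟨.daemon y, ∅⟩}) P₂, ⟨?_, ?_⟩,
    hf.of_fresh ?_ ?_, ⟨?_, ?_⟩, Or.inl ?_⟩
  · have := Proves.cut hP₁ (.daemon y) (apart_iff.2 ?_) hl₂
    · rw [add_zero] at this
      refine Proves.cut (.weak (i := x) this ?_) hP₂ (apart_iff.2 ?_) hl₁.symm
      · simp; grind
      · simp [Node.owns]; grind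
    · simp [Node.owns]; grind
  · simp [Node.Respects, Node.edges] at hR ⊢
    grind
  · simp
    grind
  · simp [Node.owns]
  · simp [Node.weight]; omega
  · intro j
    simp [Node.Above, Node.Respects, Node.edges] at hR ⊢
    grind
  · convert Step.daemonImp (K := K) (R := inside K (P₁ + P₂) + R) (d := d) (e := e) (a := a)
      (o := o) (x := x) (y := y) ?_ hne hx hl₁ hy hl₂ using 1 <;>
    · simp only [inside_add, Finset.empty_union,
        ← Multiset.singleton_add, inside_singleton]
      abel
end

/-! ## Reduction of a cut with a node other than a box -/

theorem add_eq_cons {α : Type*} {s t u : Multiset α} {a : α} (h : s + t = a ::ₘ u) :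
    (∃ s', s = a ::ₘ s' ∧ u = s' + t) ∨ ∃ t', t = a ::ₘ t' ∧ u = s + t' := by
  have ha : a ∈ s + t := h ▸ Multiset.mem_cons_self a u
  rcases Multiset.mem_add.1 ha with ha | ha <;> obtain ⟨r, rfl⟩ := Multiset.exists_cons_of_mem ha
  · exact Or.inl ⟨r, rfl, by simpa using h.symm⟩
  · exact Or.inr ⟨r, rfl, by simpa using h.symm⟩

theorem singleton_eq_cons {α : Type*} {u : Multiset α} {a b : α} (h : {b} = a ::ₘ u) :
    b = a ∧ u = 0 := by
  have := congrArg Multiset.card h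
  simp at this
  subst this
  simpa using h

theorem Lighter.add {I : ℕ → ℤ} {W W' : Graph} (h : Lighter I W W') (R : Graph) :
    Lighter I (W + R) (W' + R) :=
  ⟨by simpa using h.1, fun j => by simpa using fun h₁ h₂ => ⟨h.2 j h₁, h₂⟩⟩

theorem Lighter.cons {I : ℕ → ℤ} {W W' : Graph} (h : Lighter I W W') (x : Cell) :
    Lighter I (x ::ₘ W) (x ::ₘ W') :=
  ⟨by simpa using h.1, fun j => by simpa using fun h₁ h₂ => ⟨h₁, h.2 j h₂⟩⟩

theorem Lighter.add_left {I : ℕ → ℤ} {W W' : Graph} (h : Lighter I W W') (R : Graph) :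
    Lighter I (R + W) (R + W') :=
  ⟨by simpa using h.1, fun j => by simpa using fun h₁ h₂ => ⟨h₁, h.2 j h₂⟩⟩

theorem Lighter.inside {I : ℕ → ℤ} {W W' : Graph} (h : Lighter I W W') (K : Finset ℕ) :
    Lighter I (inside K W) (inside K W') :=
  ⟨by simpa using h.1, fun j => by simpa using h.2 j⟩

/-- Proof structures whose last rule introduces the output, except for axioms and boxes. -/
inductive Principal : Graph → Multiset Edge → Edge → Prop
  | daemon (d : Edge) : Principal {⟨.daemon d, ∅⟩} 0 d
  | right {n : Node} {A Δ : Multiset Edge} {d₁ d : Edge} {Q : Graph} (hr : RightRule n A d₁ d)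
      (hQ : Proves Q (A + Δ) d₁) (hd : d.name ∉ edgeNames Q)
      (ha : ∀ a ∈ n.eigen, ∀ e ∈ Δ, a ∉ e.label.fv) : Principal (⟨n, ∅⟩ ::ₘ Q) Δ d
  | tensorR {Q₁ Q₂ : Graph} {Δ₁ Δ₂ : Multiset Edge} {d₁ d₂ d : Edge} (hQ₁ : Proves Q₁ Δ₁ d₁)
      (hQ₂ : Proves Q₂ Δ₂ d₂) (hQ : Apart Q₁ Q₂) (hd : d.name ∉ edgeNames (Q₁ + Q₂))
      (hl : d.label = d₁.label.tensor d₂.label) :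
      Principal (⟨.tensorR d₁ d₂ d, ∅⟩ ::ₘ (Q₁ + Q₂)) (Δ₁ + Δ₂) d

theorem Principal.proves {Q : Graph} {Δ : Multiset Edge} {d : Edge} (h : Principal Q Δ d) :
    Proves Q Δ d := by
  cases h with
  | daemon => exact .daemon d
  | right hr hQ hd ha => exact hr.proves hQ hd ha
  | tensorR hQ₁ hQ₂ hQ hd hl => exact .tensorR hQ₁ hQ₂ hQ hd hl

section
variable {I : ℕ → ℤ} {Γ Δ : Multiset Edge} {c d e i : Edge} {P Q : Graph} {n : Node}
  {A : Multiset Edge}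

/-- Both sides of the cut have just introduced their edge, and labels agree. Comparing the heads
excludes distinct connectives; matching pairs are linear steps, and a weakening or a dæmon gives a
garbage collection step. Boxes are not `Principal`, so contractions and `!`-left nodes can meet only
a dæmon here. -/
theorem evt_principal_left (hI : Recurrent I) (hQ : Principal Q Δ d) (hr : LeftRule n e A)
    (hP : Proves P (A + Γ) c) (hi : e.name ∉ edgeNames P) (hl : d.label = e.label)
    (hPQ : Apart (⟨n, ∅⟩ ::ₘ P) Q) {W : Graph} (hW : W = cutGraph d e (⟨n, ∅⟩ ::ₘ P) Q)
    (hR : Resp I W) : Evt I (Lighter I W) (Γ + Δ) c W := by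
  have hh := congrArg Formula.head hl
  cases hr with
  | weak =>
    rw [zero_add] at hP
    cases hQ with
    | daemon => rw [add_zero]; exact evt_daemon_weak hP hW hR
    | tensorR hQ₁ hQ₂ hQ hd hl => exact evt_tensor_weak hI hP hQ₁ hQ₂ hQ hPQ hW hR
    | right hr hQ hd ha =>
      cases hr with
      | impR hl' => exact evt_imp_weak hI hP (by simpa using hQ) hPQ hW hR
      | allR hl' =>
        rw [zero_add] at hQ
        exact evt_right_weak hI hP hQ (.allR hl') Step.allWeak hPQ hW hR
      | parR hl' =>
        rw [zero_add] at hQ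
        exact evt_right_weak hI hP hQ (.parR hl') Step.parWeak hPQ hW hR
  | contr hl₀ hl₁ hl₂ =>
    rw [hl₀] at hh
    cases hQ with
    | daemon =>
      rw [add_zero]
      refine evt_daemon_two hI (by simpa using hP) Step.daemonContr ?_ rfl hW hR
      simp [Node.Respects, Node.edges]
      grind
    | tensorR hQ₁ hQ₂ hQ hd hl => simp [hl] at hh
    | right hr hQ hd ha => cases hr with | _ hl' => simp [hl'] at hh
  | tensorL hl₀ =>
    rw [hl₀] at hh
    cases hQ with
    | daemon =>
      rw [add_zero]
      refine evt_daemon_two hI (by simpa using hP) Step.daemonTensor ?_ rfl hW hR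
      simp [Node.Respects, Node.edges]
      grind
    | tensorR hQ₁ hQ₂ hQ hd hl' =>
      exact evt_tensor (by simpa using hP) hQ₁ hQ₂ hQ hPQ hl' hl₀ hl hW hR
    | right hr hQ hd ha => cases hr with | _ hl' => simp [hl'] at hh
  | allL hl₀ hl₁ =>
    rw [hl₀] at hh
    cases hQ with
    | daemon =>
      rw [add_zero]
      refine evt_daemon_one hI (by simpa using hP) Step.daemonAll ?_ rfl hW hR
      simp [Node.Respects, Node.edges]
      grind
    | tensorR hQ₁ hQ₂ hQ hd hl => simp [hl] at hh
    | right hr hQ hd ha =>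
      cases hr with
      | allR hl' =>
        exact evt_all (by simpa using hP) hi (by simpa using hQ) hd (ha _ rfl) hPQ hl' hl₀ hl₁ hl
          hW hR
      | _ hl' => simp [hl'] at hh
  | parL hl₀ =>
    rw [hl₀] at hh
    cases hQ with
    | daemon =>
      rw [add_zero]
      refine evt_daemon_one hI (by simpa using hP) Step.daemonPar ?_ rfl hW hR
      simp [Node.Respects]
      grind
    | tensorR hQ₁ hQ₂ hQ hd hl => simp [hl] at hh
    | right hr hQ hd ha =>
      cases hr with
      | parR hl' =>
        exact evt_par (by simpa using hP) (by simpa using hQ) hPQ hl' hl₀ hl hW hR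
      | _ hl' => simp [hl'] at hh
  | bangL hl₀ =>
    rw [hl₀] at hh
    cases hQ with
    | daemon =>
      rw [add_zero]
      refine evt_daemon_one hI (by simpa using hP) (fun h₁ h₂ h₃ => ?_) ?_ rfl hW hR
      · simpa using Step.daemonBang h₁ h₂ h₃
      · simp [Node.Respects]
        grind
    | tensorR hQ₁ hQ₂ hQ hd hl => simp [hl] at hh
    | right hr hQ hd ha => cases hr with | _ hl' => simp [hl'] at hh

/-- Induction on `P` climbs to the rule that introduces the input `e`. A rule that does not
introduce it commutes with the cut, and both orders give the same multiset of nodes. When the rule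
is `∀`-right, the inputs of `Q` become inputs of its premise; the hypothesis on eigenvariables
preserves its side condition. -/
theorem evt_principal (hI : Recurrent I) (hQ : Principal Q Δ d) {Γ₀ : Multiset Edge}
    (hP : Proves P Γ₀ c) : ∀ {Γ e}, Γ₀ = e ::ₘ Γ → d.label = e.label → Apart P Q →
      (∀ x ∈ Δ, ∀ a ∈ eigenvars P, a ∉ x.label.fv) → Resp I (cutGraph d e P Q) →
      Evt I (Lighter I (cutGraph d e P Q)) (Γ + Δ) c (cutGraph d e P Q) := by
  have hdQ := hQ.proves.mem_names (Or.inl rfl)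
  induction hP using Proves.rules with
  | ax hn hl' =>
    intro Γ e hΓ hl hPQ _ hR
    obtain ⟨rfl, rfl⟩ := singleton_eq_cons hΓ
    rw [zero_add]
    exact (evt_axR hl' hQ.proves hPQ hl rfl hR).mono fun _ _ h => h.1
  | daemon => intro Γ e hΓ; simp at hΓ
  | @left n i A P Γ₁ c hr hP hi ih =>
    intro Γ e hΓ hl hPQ hE hR
    rcases Multiset.cons_eq_cons.1 hΓ with ⟨rfl, rfl⟩ | ⟨-, Γ', rfl, rfl⟩
    · exact evt_principal_left hI hQ hr hP hi hl hPQ rfl hR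
    · have hW : cutGraph d e (⟨n, ∅⟩ ::ₘ P) Q = ⟨n, ∅⟩ ::ₘ cutGraph d e P Q := by
        simp only [cutGraph, ← Multiset.singleton_add]; abel
      rw [Multiset.add_cons] at hP ih
      rw [apart_iff] at hPQ
      have hm := hP.mem_names (n := e.name) (by simp)
      have hA : Apart P Q := apart_iff.2 ⟨fun m h => hPQ.1 m (by simp [h]),
        fun m h => hPQ.2 m (by simp [h])⟩
      rw [hW, resp_cons] at hR
      have := ih rfl hl hA (fun x hx a ha => hE x hx a (by simp [ha])) hR.2
      rw [add_assoc] at this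
      have hi' := hPQ.1 i.name (by simp [hr.mem_names])
      rw [hW, Multiset.cons_add]
      refine (Evt.left hr ?_ ?_ hR.1 this).mono ?_
      · rw [← add_assoc]; exact .cut hP hQ.proves hA hl
      · simp; grind
      · rintro _ - ⟨P₁, rfl, -, -, h⟩
        exact h.cons _
  | @right n A c o P Γ₁ hr hP ho ha ih =>
    rintro Γ e rfl hl hPQ hE hR
    have hW : cutGraph d e (⟨n, ∅⟩ ::ₘ P) Q = ⟨n, ∅⟩ ::ₘ cutGraph d e P Q := by
      simp only [cutGraph, ← Multiset.singleton_add]; abel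
    rw [Multiset.add_cons] at hP ih
    rw [apart_iff] at hPQ
    have hm := hP.mem_names (n := e.name) (by simp)
    have hA : Apart P Q := apart_iff.2 ⟨fun m h => hPQ.1 m (by simp [h]),
      fun m h => hPQ.2 m (by simp [h])⟩
    rw [hW, resp_cons] at hR
    have := ih rfl hl hA (fun x hx a ha => hE x hx a (by simp [ha])) hR.2
    rw [add_assoc] at this
    have ho' := hPQ.1 o.name (by simp [hr.mem_names])
    rw [hW]
    refine (Evt.right hr ?_ ?_ (fun a h x hx => ?_) hR.1 this).mono ?_
    · rw [← add_assoc]; exact .cut hP hQ.proves hA hl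
    · simp; grind
    · rcases Multiset.mem_add.1 hx with hx | hx
      · exact ha a h x (Multiset.mem_cons_of_mem hx)
      · exact hE x hx a (by simp [h])
    · rintro _ - ⟨P₁, rfl, -, -, h⟩
      exact h.cons _
  | @cut P₁ P₂ Γ₁ Γ₂ c d₁ e₁ hP₁ hP₂ hP hl₁ ih₁ ih₂ =>
    rintro Γ e hΓ hl hPQ hE hR
    have hm₁ := hP₁.mem_names (n := e₁.name) (by simp)
    have hm₂ := hP₂.mem_names (Or.inl rfl)
    have hPQ' := hPQ
    rw [apart_iff] at hPQ
    have hA₁ : Apart P₁ Q := apart_iff.2 ⟨fun m h => hPQ.1 m (by simp [h]),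
      fun m h => hPQ.2 m (by simp [h])⟩
    have hA₂ : Apart P₂ Q := apart_iff.2 ⟨fun m h => hPQ.1 m (by simp [h]),
      fun m h => hPQ.2 m (by simp [h])⟩
    rcases add_eq_cons hΓ with ⟨Γ', rfl, rfl⟩ | ⟨Γ', rfl, rfl⟩
    · have hW : cutGraph d e (cutGraph d₁ e₁ P₁ P₂) Q = cutGraph d₁ e₁ (cutGraph d e P₁ Q) P₂ := by
        simp only [cutGraph, ← Multiset.singleton_add]; abel
      have hm := hP₁.mem_names (n := e.name) (by simp)
      rw [hW] at hR ⊢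
      simp only [resp_cons, resp_add] at hR ih₁
      have := ih₁ (Multiset.cons_swap _ _ _) hl hA₁ (fun x hx a ha => hE x hx a (by simp [ha]))
        hR.2.1
      rw [Multiset.cons_add] at this
      have hA : Apart (cutGraph d e P₁ Q) P₂ := by
        rw [apart_iff] at *
        simp [Node.owns] at *
        grind
      rw [add_right_comm]
      refine (Evt.cutL (by
        rw [← Multiset.cons_add]
        exact .cut (by rwa [Multiset.cons_swap]) hQ.proves hA₁ hl) hP₂ hR.2.2 hA hl₁ hR.1 this).mono ?_
      rintro _ - ⟨P', rfl, -, -, h⟩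
      exact (h.add _).cons _
    · have hW : cutGraph d e (cutGraph d₁ e₁ P₁ P₂) Q = cutGraph d₁ e₁ P₁ (cutGraph d e P₂ Q) := by
        simp only [cutGraph, ← Multiset.singleton_add]; abel
      have hm := hP₂.mem_names (n := e.name) (by simp)
      rw [hW] at hR ⊢
      simp only [resp_cons, resp_add] at hR ih₂
      have := ih₂ rfl hl hA₂ (fun x hx a ha => hE x hx a (by simp [ha])) hR.2.2
      have hA : Apart P₁ (cutGraph d e P₂ Q) := by
        rw [apart_iff] at *
        simp [Node.owns] at *
        grind
      rw [add_assoc]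
      refine (Evt.cutR hP₁ hR.2.1 (.cut hP₂ hQ.proves hA₂ hl) hA hl₁ hR.1 this).mono ?_
      rintro _ - ⟨P', rfl, -, -, h⟩
      exact (h.add_left _).cons _
  | @tensorR P₁ P₂ Γ₁ Γ₂ c d₁ o hP₁ hP₂ hP ho hl₁ ih₁ ih₂ =>
    rintro Γ e hΓ hl hPQ hE hR
    have hm₁ := hP₁.mem_names (Or.inl rfl)
    have hm₂ := hP₂.mem_names (Or.inl rfl)
    rw [apart_iff] at hPQ
    have hA₁ : Apart P₁ Q := apart_iff.2 ⟨fun m h => hPQ.1 m (by simp [h]),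
      fun m h => hPQ.2 m (by simp [h])⟩
    have hA₂ : Apart P₂ Q := apart_iff.2 ⟨fun m h => hPQ.1 m (by simp [h]),
      fun m h => hPQ.2 m (by simp [h])⟩
    rcases add_eq_cons hΓ with ⟨Γ', rfl, rfl⟩ | ⟨Γ', rfl, rfl⟩
    · have hW : cutGraph d e (⟨.tensorR c d₁ o, ∅⟩ ::ₘ (P₁ + P₂)) Q =
          ⟨.tensorR c d₁ o, ∅⟩ ::ₘ (cutGraph d e P₁ Q + P₂) := by
        simp only [cutGraph, ← Multiset.singleton_add]; abel
      have hm := hP₁.mem_names (n := e.name) (by simp)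
      rw [hW] at hR ⊢
      rw [resp_cons, resp_add] at hR
      have := ih₁ rfl hl hA₁ (fun x hx a ha => hE x hx a (by simp [ha])) hR.2.1
      have hA : Apart (cutGraph d e P₁ Q) P₂ := by
        rw [apart_iff] at *
        simp [Node.owns] at *
        grind
      rw [add_right_comm]
      refine (Evt.tensorR ⟨.cut hP₁ hQ.proves hA₁ hl, hR.2.1⟩ ⟨hP₂, hR.2.2⟩ hA ?_ hl₁ hR.1 this
        (.pure (Φ := fun X => X = P₂) ⟨hP₂, hR.2.2⟩ rfl)).mono ?_
      · simp at *; grind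
      · rintro _ - ⟨P', _, rfl, -, -, -, -, h, rfl⟩
        exact (h.add _).cons _
    · have hW : cutGraph d e (⟨.tensorR c d₁ o, ∅⟩ ::ₘ (P₁ + P₂)) Q =
          ⟨.tensorR c d₁ o, ∅⟩ ::ₘ (P₁ + cutGraph d e P₂ Q) := by
        simp only [cutGraph, ← Multiset.singleton_add]; abel
      have hm := hP₂.mem_names (n := e.name) (by simp)
      rw [hW] at hR ⊢
      rw [resp_cons, resp_add] at hR
      have := ih₂ rfl hl hA₂ (fun x hx a ha => hE x hx a (by simp [ha])) hR.2.2
      have hA : Apart P₁ (cutGraph d e P₂ Q) := by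
        rw [apart_iff] at *
        simp [Node.owns] at *
        grind
      rw [add_assoc]
      refine (Evt.tensorR ⟨hP₁, hR.2.1⟩ ⟨.cut hP₂ hQ.proves hA₂ hl, hR.2.2⟩ hA ?_ hl₁ hR.1
        (.pure (Φ := fun X => X = P₁) ⟨hP₁, hR.2.1⟩ rfl) this).mono ?_
      · simp at *; grind
      · rintro _ - ⟨_, P', rfl, -, -, -, -, rfl, h⟩
        exact (h.add_left _).cons _
  | @impL P₁ P₂ Γ₁ Γ₂ c d₁ e₁ f hP₁ hP₂ hP hf hl₁ ih₁ ih₂ =>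
    rintro Γ e hΓ hl hPQ hE hR
    have hm₁ := hP₁.mem_names (n := e₁.name) (by simp)
    have hm₂ := hP₂.mem_names (Or.inl rfl)
    rcases Multiset.cons_eq_cons.1 hΓ with ⟨rfl, rfl⟩ | ⟨-, Γ₀, hΓ', rfl⟩
    · have hh := congrArg Formula.head hl
      rw [hl₁] at hh
      cases hQ with
      | daemon => rw [add_zero]; exact evt_daemon_imp hI hP₁ hP₂ hP rfl hR
      | tensorR hQ₁ hQ₂ hQ hd hl => simp [hl] at hh
      | right hr hQ hd ha =>
        cases hr with
        | impR hl' => exact evt_imp hP₁ hP₂ hP (by simpa using hQ) hPQ hl' hl₁ hl rfl hR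
        | _ hl' => simp [hl'] at hh
    rw [apart_iff] at hPQ
    have hA₁ : Apart P₁ Q := apart_iff.2 ⟨fun m h => hPQ.1 m (by simp [h]),
      fun m h => hPQ.2 m (by simp [h])⟩
    have hA₂ : Apart P₂ Q := apart_iff.2 ⟨fun m h => hPQ.1 m (by simp [h]),
      fun m h => hPQ.2 m (by simp [h])⟩
    rcases add_eq_cons hΓ' with ⟨Γ', rfl, rfl⟩ | ⟨Γ', rfl, rfl⟩
    · have hW : cutGraph d e (⟨.impL f d₁ e₁, ∅⟩ ::ₘ (P₁ + P₂)) Q =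
          ⟨.impL f d₁ e₁, ∅⟩ ::ₘ (cutGraph d e P₁ Q + P₂) := by
        simp only [cutGraph, ← Multiset.singleton_add]; abel
      have hm := hP₁.mem_names (n := e.name) (by simp)
      rw [hW] at hR ⊢
      rw [resp_cons, resp_add] at hR
      have := ih₁ (Multiset.cons_swap _ _ _) hl hA₁ (fun x hx a ha => hE x hx a (by simp [ha]))
        hR.2.1
      rw [Multiset.cons_add] at this
      have hA : Apart (cutGraph d e P₁ Q) P₂ := by
        rw [apart_iff] at *
        simp [Node.owns] at *
        grind
      rw [Multiset.cons_add f, add_right_comm Γ']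
      refine (Evt.impL ⟨by
          rw [← Multiset.cons_add]
          exact .cut (by rwa [Multiset.cons_swap]) hQ.proves hA₁ hl, hR.2.1⟩ ⟨hP₂, hR.2.2⟩ hA ?_ hl₁
        hR.1 this (.pure (Φ := fun X => X = P₂) ⟨hP₂, hR.2.2⟩ rfl)).mono ?_
      · simp at *; grind
      · rintro _ - ⟨P', _, rfl, -, -, -, -, h, rfl⟩
        exact (h.add _).cons _
    · have hW : cutGraph d e (⟨.impL f d₁ e₁, ∅⟩ ::ₘ (P₁ + P₂)) Q =
          ⟨.impL f d₁ e₁, ∅⟩ ::ₘ (P₁ + cutGraph d e P₂ Q) := by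
        simp only [cutGraph, ← Multiset.singleton_add]; abel
      have hm := hP₂.mem_names (n := e.name) (by simp)
      rw [hW] at hR ⊢
      rw [resp_cons, resp_add] at hR
      have := ih₂ rfl hl hA₂ (fun x hx a ha => hE x hx a (by simp [ha])) hR.2.2
      have hA : Apart P₁ (cutGraph d e P₂ Q) := by
        rw [apart_iff] at *
        simp [Node.owns] at *
        grind
      rw [Multiset.cons_add f, add_assoc Γ₁]
      refine (Evt.impL ⟨hP₁, hR.2.1⟩ ⟨.cut hP₂ hQ.proves hA₂ hl, hR.2.2⟩ hA ?_ hl₁ hR.1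
        (.pure (Φ := fun X => X = P₁) ⟨hP₁, hR.2.1⟩ rfl) this).mono ?_
      · simp at *; grind
      · rintro _ - ⟨_, P', rfl, -, -, -, -, rfl, h⟩
        exact (h.add_left _).cons _
  | box₀ => intro Γ e hΓ; simp at hΓ
  | @box₁ P c o i x b hP ho hl₀ hi hio hl' hb ih =>
    rintro Γ e hΓ hl hPQ hE hR
    obtain ⟨rfl, rfl⟩ := singleton_eq_cons hΓ
    have hh := congrArg Formula.head hl
    rw [hl'] at hh
    cases hQ with
    | daemon => exact evt_daemon_box hI hP ho hl₀ hb rfl hR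
    | tensorR hQ₁ hQ₂ hQ hd hl => simp [hl] at hh
    | right hr hQ hd ha => cases hr with | _ hl' => simp [hl'] at hh
end

/-! ### Nets in which all cuts are cuts with boxes -/

/-- The edge `d` is the output of a `!`-box of `P`. -/
def BangOut (P : Graph) (d : Edge) : Prop := ∃ x ∈ P, ∃ c b, x.node = .bangR c d b

/-- Every cut of `P` is a cut with a `!`-box. -/
def BangCuts (P : Graph) : Prop := ∀ x ∈ P, ∀ d e, x.node = .cut d e → BangOut P d

theorem BangOut.mono {P P' : Graph} {d : Edge} (h : BangOut P d)
    (hP : ∀ x ∈ P, ∃ y ∈ P', y.node = x.node) : BangOut P' d := by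
  obtain ⟨x, hx, c, b, hn⟩ := h
  obtain ⟨y, hy, hyx⟩ := hP x hx
  exact ⟨y, hy, c, b, hyx.trans hn⟩

theorem BangOut.add_right {P : Graph} {d : Edge} (h : BangOut P d) (R : Graph) :
    BangOut (P + R) d := h.mono fun x hx => ⟨x, by simp [hx], rfl⟩

theorem BangOut.add_left {P : Graph} {d : Edge} (h : BangOut P d) (R : Graph) :
    BangOut (R + P) d := h.mono fun x hx => ⟨x, by simp [hx], rfl⟩

theorem BangOut.cons {P : Graph} {d : Edge} (h : BangOut P d) (x : Cell) :
    BangOut (x ::ₘ P) d := h.mono fun x hx => ⟨x, by simp [hx], rfl⟩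

theorem BangOut.inside {P : Graph} {d : Edge} (h : BangOut P d) (K : Finset ℕ) :
    BangOut (inside K P) d :=
  h.mono fun x hx => ⟨⟨x.node, x.boxes ∪ K⟩, Multiset.mem_map_of_mem _ hx, rfl⟩

theorem BangCuts.add {P Q : Graph} (hP : BangCuts P) (hQ : BangCuts Q) : BangCuts (P + Q) := by
  intro x hx d e h
  rcases Multiset.mem_add.1 hx with hx | hx
  · exact (hP x hx d e h).add_right Q
  · exact (hQ x hx d e h).add_left P

theorem BangCuts.cons {P : Graph} {x : Cell} (hP : BangCuts P) (hx : ∀ d e, x.node ≠ .cut d e) :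
    BangCuts (x ::ₘ P) := by
  intro y hy d e h
  rcases Multiset.mem_cons.1 hy with rfl | hy
  · exact absurd h (hx d e)
  · exact (hP y hy d e h).cons x

theorem BangCuts.inside {P : Graph} (hP : BangCuts P) (K : Finset ℕ) :
    BangCuts (inside K P) := by
  intro y hy d e h
  obtain ⟨x, hx, rfl⟩ := Multiset.mem_map.1 hy
  exact (hP x hx d e h).inside K

theorem LeftRule.ne_cut {n : Node} {i : Edge} {A : Multiset Edge} (h : LeftRule n i A)
    (d e : Edge) : n ≠ .cut d e := by cases h <;> simp
theorem RightRule.ne_cut {n : Node} {c o : Edge} {A : Multiset Edge} (h : RightRule n A c o)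
    (d e : Edge) : n ≠ .cut d e := by cases h <;> simp

section
variable {I : ℕ → ℤ} {Γ Δ : Multiset Edge} {c d e i : Edge} {P Q : Graph} {n : Node}

theorem finite_fvs (Δ : Multiset Edge) : {a | ∃ x ∈ Δ, a ∈ x.label.fv}.Finite := by
  have : {a | ∃ x ∈ Δ, a ∈ x.label.fv} = ⋃ x ∈ {x | x ∈ Δ}, x.label.fv := by
    ext; simp
  rw [this]
  exact Set.Finite.biUnion (by classical exact Multiset.finite_toSet Δ) fun x _ => x.label.finite_fv

/-- The eigenvariables of `P` are first moved away from the inputs of `Q`; as this keeps the weight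
and the bounds on cuts, the gain of `evt_principal` carries over to the original graph. -/
theorem evt_cut_principal (hI : Recurrent I) (hP : Proves P (e ::ₘ Γ) c) (hQ : Principal Q Δ d)
    (hl : d.label = e.label) (hPQ : Apart P Q) (hR : Resp I (cutGraph d e P Q)) :
    Evt I (Lighter I (cutGraph d e P Q)) (Γ + Δ) c (cutGraph d e P Q) := by
  have hR' := hR
  rw [resp_cons, resp_add] at hR
  refine (Evt.cutL hP hQ.proves hR.2.2 hPQ hl hR.1
    (hP.evt_eigenvars hR.2.1 _ (finite_fvs Δ))).bind ?_
  rintro _ hN ⟨P₁, rfl, hP₁, hPQ, hG, hw, hg⟩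
  refine (evt_principal hI hQ hP₁.1 rfl hl hPQ (fun x hx a ha ha' => hG a ha ⟨x, hx, ha'⟩)
    hN.2).mono fun P' _ h => ⟨?_, fun j hj => h.2 j ?_⟩
  · simpa [hw] using h.1
  · simp only [good_cons, good_add] at hj ⊢
    exact ⟨hj.1, hg j hj.2.1, hj.2.2⟩

/-- The mirror image of `evt_principal`: induction on `Q` passes the rules that leave the output
unchanged, namely left rules, `⊸`-left and cuts, until the rule producing `d` appears. This is an
axiom or a principal rule, boxes being excluded. No `∀`-right node of `Q` is passed, so no
eigenvariable condition arises. -/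
theorem evt_cut_of_not_bangOut (hI : Recurrent I) (hP : Proves P (e ::ₘ Γ) c)
    (hQ : Proves Q Δ d) : d.label = e.label → Apart P Q → ¬ BangOut Q d →
      Resp I (cutGraph d e P Q) →
      Evt I (Lighter I (cutGraph d e P Q)) (Γ + Δ) c (cutGraph d e P Q) := by
  have hm := hP.mem_names (n := e.name) (by simp)
  induction hQ using Proves.rules with
  | ax hn hl' =>
    intro hl hPQ _ hR
    exact evt_axL hl' hP hPQ hl rfl hR
  | daemon => intro hl hPQ _ hR; exact evt_cut_principal hI hP (.daemon _) hl hPQ hR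
  | right hr hQ hd ha =>
    intro hl hPQ _ hR; exact evt_cut_principal hI hP (.right hr hQ hd ha) hl hPQ hR
  | tensorR hQ₁ hQ₂ hQ hd hl' =>
    intro hl hPQ _ hR; exact evt_cut_principal hI hP (.tensorR hQ₁ hQ₂ hQ hd hl') hl hPQ hR
  | @left n i A Q Δ d hr hQ hi ih =>
    intro hl hPQ hb hR
    have hW : cutGraph d e P (⟨n, ∅⟩ ::ₘ Q) = ⟨n, ∅⟩ ::ₘ cutGraph d e P Q := by
      simp only [cutGraph, ← Multiset.singleton_add]; abel
    rw [hW, resp_cons] at hR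
    have hdQ := hQ.mem_names (Or.inl rfl)
    have hA : Apart P Q := by
      rw [apart_iff] at *
      simp at *
      grind
    have := ih hl hA (fun h => hb (h.cons _)) hR.2
    rw [add_left_comm] at this
    rw [hW, Multiset.add_cons]
    have hi' := hPQ.symm.names (n := i.name) (by simp [hr.mem_names])
    refine (Evt.left hr ?_ ?_ hR.1 this).mono ?_
    · rw [add_left_comm]; exact .cut hP hQ hA hl
    · simp; grind
    · rintro _ - ⟨P₁, rfl, -, -, h⟩
      exact h.cons _
  | @cut Q₁ Q₂ Δ₁ Δ₂ d d₁ e₁ hQ₁ hQ₂ hQ hl₁ ih₁ ih₂ =>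
    intro hl hPQ hb hR
    have hW : cutGraph d e P (cutGraph d₁ e₁ Q₁ Q₂) = cutGraph d₁ e₁ (cutGraph d e P Q₁) Q₂ := by
      simp only [cutGraph, ← Multiset.singleton_add]; abel
    rw [hW] at hR ⊢
    have hm₁ := hQ₁.mem_names (Or.inl rfl)
    have hA₁ : Apart P Q₁ := by
      rw [apart_iff] at *
      simp at *
      grind
    have hA : Apart (cutGraph d e P Q₁) Q₂ := by
      rw [apart_iff] at *
      simp [Node.owns] at *
      grind
    rw [resp_cons, resp_add] at hR
    have := ih₁ hl hA₁ (fun h => hb ((h.add_right _).cons _)) hR.2.1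
    rw [Multiset.add_cons] at this
    rw [← add_assoc]
    refine (Evt.cutL (by
      rw [← Multiset.add_cons]; exact .cut hP hQ₁ hA₁ hl) hQ₂ hR.2.2 hA hl₁ hR.1 this).mono ?_
    rintro _ - ⟨P', rfl, -, -, h⟩
    exact (h.add _).cons _
  | @impL Q₁ Q₂ Δ₁ Δ₂ d d₁ e₁ f hQ₁ hQ₂ hQ hf hl₁ ih₁ ih₂ =>
    intro hl hPQ hb hR
    have hW : cutGraph d e P (⟨.impL f d₁ e₁, ∅⟩ ::ₘ (Q₁ + Q₂)) =
        ⟨.impL f d₁ e₁, ∅⟩ ::ₘ (cutGraph d e P Q₁ + Q₂) := by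
      simp only [cutGraph, ← Multiset.singleton_add]; abel
    rw [hW] at hR ⊢
    have hm₁ := hQ₁.mem_names (Or.inl rfl)
    have hA₁ : Apart P Q₁ := by
      rw [apart_iff] at *
      simp at *
      grind
    have hA : Apart (cutGraph d e P Q₁) Q₂ := by
      rw [apart_iff] at *
      simp [Node.owns] at *
      grind
    rw [resp_cons, resp_add] at hR
    have := ih₁ hl hA₁ (fun h => hb ((h.add_right _).cons _)) hR.2.1
    rw [Multiset.add_cons] at this
    rw [Multiset.add_cons, ← add_assoc Γ]
    have hf' := hPQ.symm.names (n := f.name) (by simp)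
    refine (Evt.impL ⟨by rw [← Multiset.add_cons]; exact .cut hP hQ₁ hA₁ hl, hR.2.1⟩ ⟨hQ₂, hR.2.2⟩
      hA ?_ hl₁ hR.1 this (.pure (Φ := fun X => X = Q₂) ⟨hQ₂, hR.2.2⟩ rfl)).mono ?_
    · simp at *; grind
    · rintro _ - ⟨P', _, rfl, -, -, -, -, h, rfl⟩
      exact (h.add _).cons _
  | box₀ =>
    intro hl hPQ hb
    exact absurd ⟨_, Multiset.mem_cons_self _ _, _, _, rfl⟩ hb
  | box₁ =>
    intro hl hPQ hb
    exact absurd ⟨_, Multiset.mem_cons_self _ _, _, _, rfl⟩ hb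

/-- The progress property for the weight: a cut that is not with a box can be reduced by the
preceding lemmas, and progress in a premise is progress in the whole because the rules are
compatible with `Evt` and `Lighter`. Contents of boxes are included. -/
theorem Proves.bangCuts_or_lighter (hI : Recurrent I) (h : Proves P Γ c) :
    Resp I P → BangCuts P ∨ Evt I (Lighter I P) Γ c P := by
  induction h using Proves.rules with
  | ax => intro _; left; simp [BangCuts]
  | daemon => intro _; left; simp [BangCuts]
  | left hr hP hi ih =>
    intro hR
    rw [resp_cons] at hR
    rcases ih hR.2 with h | h
    · exact Or.inl (h.cons hr.ne_cut)
    · right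
      refine (Evt.left hr hP hi hR.1 h).mono ?_
      rintro _ - ⟨P₁, rfl, -, -, h⟩
      exact h.cons _
  | right hr hP ho ha ih =>
    intro hR
    rw [resp_cons] at hR
    rcases ih hR.2 with h | h
    · exact Or.inl (h.cons hr.ne_cut)
    · right
      refine (Evt.right hr hP ho ha hR.1 h).mono ?_
      rintro _ - ⟨P₁, rfl, -, -, h⟩
      exact h.cons _
  | @cut P Q Γ Δ c d e hP hQ hPQ hl ihP ihQ =>
    intro hR'
    have hR := hR'
    rw [resp_cons, resp_add] at hR
    rcases ihP hR.2.1 with h | h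
    · rcases ihQ hR.2.2 with h' | h'
      · by_cases hb : BangOut Q d
        · left
          intro y hy d' e' hd
          rcases Multiset.mem_cons.1 hy with rfl | hy
          · obtain ⟨rfl, rfl⟩ := Node.cut.inj hd
            exact (hb.add_left _).cons _
          · exact (h.add h' y hy d' e' hd).cons _
        · exact Or.inr (evt_cut_of_not_bangOut hI hP hQ hl hPQ hb hR')
      · right
        refine (Evt.cutR hP hR.2.1 hQ hPQ hl hR.1 h').mono ?_
        rintro _ - ⟨P₁, rfl, -, -, h⟩
        exact (h.add_left _).cons _
    · right
      refine (Evt.cutL hP hQ hR.2.2 hPQ hl hR.1 h).mono ?_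
      rintro _ - ⟨P₁, rfl, -, -, h⟩
      exact (h.add _).cons _
  | @tensorR P Q Γ Δ c d o hP hQ hPQ ho hl ihP ihQ =>
    intro hR
    rw [resp_cons, resp_add] at hR
    rcases ihP hR.2.1 with h | h
    · rcases ihQ hR.2.2 with h' | h'
      · exact Or.inl ((h.add h').cons (by simp))
      · right
        refine (Evt.tensorR ⟨hP, hR.2.1⟩ ⟨hQ, hR.2.2⟩ hPQ ho hl hR.1
          (.pure (Φ := fun X => X = P) ⟨hP, hR.2.1⟩ rfl) h').mono ?_
        rintro _ - ⟨_, P', rfl, -, -, -, -, rfl, h₁⟩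
        exact (h₁.add_left _).cons _
    · right
      refine (Evt.tensorR ⟨hP, hR.2.1⟩ ⟨hQ, hR.2.2⟩ hPQ ho hl hR.1 h
        (.pure (Φ := fun X => X = Q) ⟨hQ, hR.2.2⟩ rfl)).mono ?_
      rintro _ - ⟨P', _, rfl, -, -, -, -, h, rfl⟩
      exact (h.add _).cons _
  | @impL P Q Γ Δ c d e f hP hQ hPQ hf hl ihP ihQ =>
    intro hR
    rw [resp_cons, resp_add] at hR
    rcases ihP hR.2.1 with h | h
    · rcases ihQ hR.2.2 with h' | h'
      · exact Or.inl ((h.add h').cons (by simp))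
      · right
        refine (Evt.impL ⟨hP, hR.2.1⟩ ⟨hQ, hR.2.2⟩ hPQ hf hl hR.1
          (.pure (Φ := fun X => X = P) ⟨hP, hR.2.1⟩ rfl) h').mono ?_
        rintro _ - ⟨_, P', rfl, -, -, -, -, rfl, h₁⟩
        exact (h₁.add_left _).cons _
    · right
      refine (Evt.impL ⟨hP, hR.2.1⟩ ⟨hQ, hR.2.2⟩ hPQ hf hl hR.1 h
        (.pure (Φ := fun X => X = Q) ⟨hQ, hR.2.2⟩ rfl)).mono ?_
      rintro _ - ⟨P', _, rfl, -, -, -, -, h, rfl⟩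
      exact (h.add _).cons _
  | box₀ hP ho hl hb ih =>
    intro hR
    rw [resp_cons, resp_inside] at hR
    rcases ih hR.2 with h | h
    · exact Or.inl ((h.inside _).cons (by simp))
    · right
      refine (Evt.box₀ hP ho hl hb hR.1 h).mono ?_
      rintro _ - ⟨P₁, rfl, -, -, -, h⟩
      exact (h.inside _).cons _
  | box₁ hP ho hl hi hio hl' hb ih =>
    intro hR
    simp only [resp_cons, resp_inside] at hR
    rcases ih hR.2.2 with h | h
    · exact Or.inl (((h.inside _).cons (by simp)).cons (by simp))
    · right
      refine (Evt.box₁ hP ho hl hi hio hl' hb hR.1 hR.2.1 h).mono ?_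
      rintro _ - ⟨P₁, rfl, -, -, -, -, h⟩
      exact ((h.inside _).cons _).cons _

/-- A net reduces to one in which all cuts are cuts with `!`-boxes. -/
theorem Net.evt_bangCuts (hI : Recurrent I) {j : ℤ} (hP : Net I P Γ c) (hj : Good I j P) :
    Evt I (fun P' => Good I j P' ∧ BangCuts P') Γ c P := by
  induction hw : weight P using Nat.strong_induction_on generalizing P with
  | _ w ih =>
    subst hw
    rcases hP.1.bangCuts_or_lighter hI hP.2 with h | h
    · exact .pure hP ⟨hj, h⟩
    · exact h.bind fun P' hP' hL => ih _ hL.1 hP' (hL.2 j hj) rfl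
end

/-! ## Families of boxes -/

/-- `!`-boxes whose output has level at least `j`, and whose content has cuts of higher levels
only. -/
inductive BangBox (I : ℕ → ℤ) (j : ℤ) : Graph → Multiset Edge → Edge → Prop
  | box₀ {X : Graph} {c d : Edge} {b : ℕ} (hX : Proves X 0 c) (hd : d.name ∉ edgeNames X)
      (hl : d.label = c.label.bang) (hb : b ∉ boxNames X) (hg : Good I (j + 1) X)
      (hj : j ≤ I d.name) : BangBox I j (⟨.bangR c d b, ∅⟩ ::ₘ inside {b} X) 0 d
  | box₁ {X : Graph} {c d i x : Edge} {b : ℕ} (hX : Proves X {x} c) (hd : d.name ∉ edgeNames X)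
      (hl : d.label = c.label.bang) (hi : i.name ∉ edgeNames X) (hid : i.name ≠ d.name)
      (hl' : i.label = x.label.bang) (hb : b ∉ boxNames X) (hg : Good I (j + 1) X)
      (hj : j ≤ I d.name) :
      BangBox I j (⟨.bangR c d b, ∅⟩ ::ₘ ⟨.bangL i x (some b), ∅⟩ ::ₘ inside {b} X) {i} d

/-- Pairwise disjoint boxes `G` with inputs `Δ`, and cuts `C` of their outputs with `E`. -/
inductive Boxes (I : ℕ → ℤ) (j : ℤ) : Multiset Edge → Graph → Graph → Multiset Edge → Prop
  | nil : Boxes I j 0 0 0 0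
  | cons {Q C G : Graph} {E Δ Δ' : Multiset Edge} {d e : Edge} (hQ : BangBox I j Q Δ d)
      (hl : d.label = e.label) (hG : Boxes I j E C G Δ') (hA : Apart Q G) :
      Boxes I j (e ::ₘ E) (⟨.cut d e, ∅⟩ ::ₘ C) (Q + G) (Δ + Δ')

section
variable {I : ℕ → ℤ} {j : ℤ} {E E₁ E₂ Γ Δ : Multiset Edge} {c d e i : Edge} {P Q C G : Graph}

theorem BangBox.proves (h : BangBox I j Q Δ d) : Proves Q Δ d := by
  cases h with
  | box₀ hX hd hl hb => exact .box₀ hX hd hl hb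
  | box₁ hX hd hl hi hid hl' hb => exact .box₁ hX hd hl hi hid hl' hb

theorem BangBox.good (h : BangBox I j Q Δ d) : Good I (j + 1) Q := by
  cases h <;> simpa [Node.Above]

theorem BangBox.head (h : BangBox I j Q Δ d) : d.label.head = 4 := by
  cases h with
  | box₀ _ _ hl => rw [hl, Formula.head_bang]
  | box₁ _ _ hl => rw [hl, Formula.head_bang]

theorem Boxes.eq_zero (h : Boxes I j 0 C G Δ) : C = 0 ∧ G = 0 ∧ Δ = 0 := by
  generalize hE : (0 : Multiset Edge) = E at h
  cases h with
  | nil => simp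
  | cons => simp at hE

/-- At a rule with two premises, each cut input belongs to one of them, and the family is
distributed accordingly. -/
theorem Boxes.split (h : Boxes I j E C G Δ) : ∀ {E₁ E₂}, E = E₁ + E₂ →
    ∃ C₁ G₁ Δ₁ C₂ G₂ Δ₂, Boxes I j E₁ C₁ G₁ Δ₁ ∧ Boxes I j E₂ C₂ G₂ Δ₂ ∧ Apart G₁ G₂ ∧
      C = C₁ + C₂ ∧ G = G₁ + G₂ ∧ Δ = Δ₁ + Δ₂ := by
  induction h with
  | nil =>
    intro E₁ E₂ hE
    obtain ⟨rfl, rfl⟩ := add_eq_zero.1 hE.symm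
    exact ⟨0, 0, 0, 0, 0, 0, .nil, .nil, by simp [apart_iff], by simp⟩
  | @cons Q C G E Δ Δ' d e hQ hl hG hA ih =>
    intro E₁ E₂ hE
    rcases add_eq_cons hE.symm with ⟨E', rfl, rfl⟩ | ⟨E', rfl, rfl⟩
    · obtain ⟨C₁, G₁, Δ₁, C₂, G₂, Δ₂, h₁, h₂, hA', rfl, rfl, rfl⟩ := ih rfl
      rw [apart_iff] at hA hA'
      simp only [mem_edgeNames_add, mem_boxNames_add] at hA
      refine ⟨_, _, _, _, _, _, .cons hQ hl h₁ (apart_iff.2 ?_), h₂, apart_iff.2 ?_, ?_, ?_, ?_⟩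
      · grind
      · simp only [mem_edgeNames_add, mem_boxNames_add]; grind
      · rw [Multiset.cons_add]
      · rw [add_assoc]
      · rw [add_assoc]
    · obtain ⟨C₁, G₁, Δ₁, C₂, G₂, Δ₂, h₁, h₂, hA', rfl, rfl, rfl⟩ := ih rfl
      rw [apart_iff] at hA hA'
      simp only [mem_edgeNames_add, mem_boxNames_add] at hA
      refine ⟨_, _, _, _, _, _, h₁, .cons hQ hl h₂ (apart_iff.2 ?_), apart_iff.2 ?_, ?_, ?_, ?_⟩
      · grind
      · simp only [mem_edgeNames_add, mem_boxNames_add]; grind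
      · rw [Multiset.add_cons]
      · rw [add_left_comm]
      · rw [add_left_comm]

theorem Boxes.split_cons (h : Boxes I j (e ::ₘ E) C G Δ) :
    ∃ d Q Δ₁ C₂ G₂ Δ₂, BangBox I j Q Δ₁ d ∧ d.label = e.label ∧ Boxes I j E C₂ G₂ Δ₂ ∧
      Apart Q G₂ ∧ C = ⟨.cut d e, ∅⟩ ::ₘ C₂ ∧ G = Q + G₂ ∧ Δ = Δ₁ + Δ₂ := by
  obtain ⟨C₁, G₁, Δ₁, C₂, G₂, Δ₂, h₁, h₂, hA, rfl, rfl, rfl⟩ :=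
    h.split (Multiset.singleton_add e E).symm
  generalize hE : ({e} : Multiset Edge) = E₀ at h₁
  cases h₁ with
  | nil => simp at hE
  | cons hQ hl hG hA' =>
    obtain ⟨rfl, rfl⟩ := singleton_eq_cons hE
    obtain ⟨rfl, rfl, rfl⟩ := hG.eq_zero
    rw [add_zero] at hA
    exact ⟨_, _, _, _, _, _, hQ, hl, h₂, hA, by simp, by simp, by simp⟩

theorem Boxes.names (h : Boxes I j E C G Δ) :
    (∀ n ∈ edgeNames C, n ∈ edgeNames G ∨ n ∈ namesOf E) ∧ ∀ b, b ∉ boxNames C := by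
  induction h with
  | nil => simp
  | cons hQ hl hG hA ih =>
    have := hQ.proves.mem_names (Or.inl rfl)
    simp [Node.owns]
    grind

/-- The cut rule is iterated over the family; each box is disjoint from `P` and from the boxes
already cut. -/
theorem Boxes.proves (h : Boxes I j E C G Δ) : ∀ {P Γ}, Proves P (E + Γ) c → Apart P G →
    Proves (P + (C + G)) (Γ + Δ) c := by
  induction h with
  | nil => intro P Γ hP _; simpa using hP
  | @cons Q C G E Δ Δ' d e hQ hl hG hA ih =>
    intro P Γ hP hPG
    have hn := hG.names
    rw [Multiset.cons_add, ← Multiset.add_cons] at hP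
    have hm := fun n h => hP.mem_names (n := n) h
    rw [apart_iff] at hPG hA
    simp only [mem_edgeNames_add, mem_boxNames_add] at hPG
    have := ih hP (apart_iff.2 (by grind))
    rw [Multiset.cons_add] at this
    have := Proves.cut this hQ.proves (apart_iff.2 ?_) hl
    · convert this using 1
      · simp only [← Multiset.singleton_add]; abel
      · abel
    · simp at *
      grind

/-- Common refinement of two decompositions: the inputs of a rule with two premises are split by
premise, and also into those cut with boxes and the others. -/
theorem add_eq_add {α : Type*} {s t : Multiset α} : ∀ {u v : Multiset α}, s + t = u + v →
    ∃ u₁ u₂ v₁ v₂, s = u₁ + v₁ ∧ t = u₂ + v₂ ∧ u = u₁ + u₂ ∧ v = v₁ + v₂ := by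
  induction s using Multiset.induction with
  | empty => intro u v h; exact ⟨0, u, 0, v, by simpa using h⟩
  | cons a s ih =>
    intro u v h
    rw [Multiset.cons_add] at h
    rcases add_eq_cons h.symm with ⟨u', rfl, h'⟩ | ⟨v', rfl, h'⟩
    · obtain ⟨u₁, u₂, v₁, v₂, rfl, rfl, rfl, rfl⟩ := ih h'
      exact ⟨a ::ₘ u₁, u₂, v₁, v₂, by simp⟩
    · obtain ⟨u₁, u₂, v₁, v₂, rfl, rfl, rfl, rfl⟩ := ih h'
      exact ⟨u₁, u₂, a ::ₘ v₁, v₂, by simp⟩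

/-! ## Borders of boxes -/

theorem IsContent.of_notMem {b : ℕ} {X R : Graph} (hX : ∀ x ∈ X, b ∈ x.boxes)
    (hR : b ∉ boxUses R) : IsContent b X R :=
  ⟨hX, fun x hx h => hR ⟨x, hx, Or.inl h⟩, fun x hx i o h => hR ⟨x, hx, Or.inr (by
    rw [h]; rfl)⟩⟩

theorem mem_boxes_inside {b : ℕ} {K : Finset ℕ} (hb : b ∈ K) (X : Graph) :
    ∀ x ∈ inside K X, b ∈ x.boxes := by
  intro x hx
  obtain ⟨y, -, rfl⟩ := Multiset.mem_map.1 hx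
  exact Finset.mem_union_right _ hb

theorem dissolve_add (b : ℕ) (p : Option ℕ) (P Q : Graph) :
    dissolve b p (P + Q) = dissolve b p P + dissolve b p Q := Multiset.map_add _ _ _

theorem dissolve_of_notMem {b : ℕ} {P : Graph} (h : b ∉ boxUses P) (p : Option ℕ) :
    dissolve b p P = P := by
  unfold dissolve
  conv_rhs => rw [← Multiset.map_id P]
  refine Multiset.map_congr rfl fun x hx => ?_
  have h₁ : b ∉ x.boxes := fun hb => h ⟨x, hx, Or.inl hb⟩
  have h₂ : b ∉ x.node.uses := fun hb => h ⟨x, hx, Or.inr hb⟩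
  obtain ⟨n, K⟩ := x
  cases n with
  | bangL i o q => cases q <;> simp_all [Node.uses, eq_comm]
  | _ => simp_all

/-- Since `b` occurs neither in `X` nor among the boxes around, erasing its border removes exactly
the outer layer it contributed; whatever box `p` prescribes takes its place. -/
theorem dissolve_inside {b : ℕ} {K : Finset ℕ} {X : Graph} (hX : b ∉ boxUses X) (hK : b ∉ K)
    (p : Option ℕ) : dissolve b p (inside (insert b K) X) = inside (K ∪ p.toFinset) X := by
  unfold dissolve inside
  rw [Multiset.map_map]
  refine Multiset.map_congr rfl fun x hx => ?_
  have h₁ : b ∉ x.boxes := fun hb => hX ⟨x, hx, Or.inl hb⟩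
  have h₂ : b ∉ x.node.uses := fun hb => hX ⟨x, hx, Or.inr hb⟩
  have h₃ : (x.boxes ∪ insert b K).erase b ∪ p.toFinset = x.boxes ∪ (K ∪ p.toFinset) := by
    rw [← Finset.union_assoc]
    congr 1
    ext m
    simp only [Finset.mem_erase, Finset.mem_union, Finset.mem_insert]
    constructor
    · tauto
    · rintro (h | h)
      · exact ⟨by rintro rfl; exact h₁ h, Or.inl h⟩
      · exact ⟨by rintro rfl; exact hK h, Or.inr (Or.inr h)⟩
  obtain ⟨n, K⟩ := x
  cases n with
  | bangL i o q => cases q <;> simp_all [Node.uses, eq_comm]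
  | _ => simp_all

theorem dissolve_port {b : ℕ} {K : Finset ℕ} (hK : b ∉ K) (p : Option ℕ) (i x : Edge) :
    dissolve b p {⟨.bangL i x (some b), K⟩} = {⟨.bangL i x p, K⟩} := by
  simp [dissolve, hK]
end

theorem Proves.notMem_boxUses_inside {P : Graph} {Γ : Multiset Edge} {c : Edge} (h : Proves P Γ c)
    {b : ℕ} (hb : b ∉ boxNames P) {K : Finset ℕ} (hK : b ∉ K) : b ∉ boxUses (inside K P) := by
  intro h'
  rcases mem_boxUses_inside _ _ _ h' with h' | h'
  · exact hb (h.boxUses_sub h')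
  · exact hK h'

section
variable {I : ℕ → ℤ} {j : ℤ} {Γ Δ : Multiset Edge} {c d e i o o₁ o₂ x : Edge} {P Q C G : Graph}

/-! ## Exponential steps -/

/-- The reduct is given explicitly, because in the application `P` still carries the other boxes of
the family, which remain to be absorbed. -/
theorem evt_box_weak (hP : Proves P Γ c) (hQ : BangBox I j Q Δ d)
    (hPQ : Apart (⟨.weak e, ∅⟩ ::ₘ P) Q) {W : Graph}
    (hW : W = cutGraph d e (⟨.weak e, ∅⟩ ::ₘ P) Q) (hR : Resp I W) :
    Evt I (fun P' => (Δ = 0 ∧ P' = P) ∨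
      ∃ i, Δ = {i} ∧ P' = ⟨.weak i, ∅⟩ ::ₘ P ∧ i.name ∉ edgeNames P) (Γ + Δ) c W := by
  subst hW
  simp only [resp_cons, resp_add] at hR
  cases hQ with
  | @box₀ X c₁ d b hX hd hl hb hg hj =>
    have hbP : b ∉ boxNames P := fun h => hPQ.boxes (n := b) (by simp [h]) (by simp [Node.owns])
    rw [add_zero]
    refine Evt.of_step fun K R hf => ⟨P, ⟨hP, hR.2.1.2⟩, hf.mono ?_ ?_, Or.inl ⟨rfl, rfl⟩,
      Or.inl ?_⟩
    · simp; tauto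
    · simp; tauto
    · have hbf := hf.box b (by simp [Node.owns])
      have hbS : b ∉ boxUses (inside K P + R) := by
        simpa using ⟨hP.notMem_boxUses_inside hbP hbf.2, hbf.1⟩
      convert Step.bangWeak₀ (K := K) (c := c₁) (d := d) (e := e)
        (IsContent.of_notMem (mem_boxes_inside (K := {b} ∪ K) (by simp) X) hbS) using 1
      simp only [inside_add, inside_singleton, inside_inside, Finset.empty_union,
        ← Multiset.singleton_add]
      abel
  | @box₁ X c₁ d i x b hX hd hl hi hid hl' hb hg hj =>
    have hbP : b ∉ boxNames P := fun h => hPQ.boxes (n := b) (by simp [h]) (by simp [Node.owns])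
    have hiP : i.name ∉ edgeNames P := fun h => hPQ.names (n := i.name) (by simp [h]) (by simp)
    refine Evt.of_step fun K R hf => ⟨⟨.weak i, ∅⟩ ::ₘ P, ⟨?_, ?_⟩, hf.mono ?_ ?_,
      Or.inr ⟨i, rfl, rfl, hiP⟩, Or.inl ?_⟩
    · rw [add_comm, Multiset.singleton_add]; exact .weak hP hiP
    · simpa [Node.Respects, Node.edges] using hR.2.1.2
    · simp; tauto
    · simp [Node.owns]; tauto
    · have hbf := hf.box b (by simp [Node.owns])
      have hbS : b ∉ boxUses (inside K P + R) := by
        simpa using ⟨hP.notMem_boxUses_inside hbP hbf.2, hbf.1⟩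
      convert Step.bangWeak₁ (K := K) (c := c₁) (d := d) (e := e) (i := i) (x := x)
        (IsContent.of_notMem (mem_boxes_inside (K := {b} ∪ K) (by simp) X) hbS) using 1 <;>
      · simp only [inside_add, inside_singleton, inside_inside, Finset.empty_union,
          ← Multiset.singleton_add]
        abel

/-- The premise of `!`-right lies one level above its conclusion, so the new cut has level at least
`j + 1`. Without a surrounding box for the port, the border of the box is erased, and its own
auxiliary port, if any, becomes a plain `!`-left node. The content `X` is exposed separately so that
boxes still cut with `P` can be treated without it. -/
theorem evt_box_bang (hP : Proves P (o ::ₘ Γ) c) (hl : e.label = o.label.bang)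
    (hQ : BangBox I j Q Δ d) (hde : d.label = e.label)
    (hPQ : Apart (⟨.bangL e o none, ∅⟩ ::ₘ P) Q) {W : Graph}
    (hW : W = cutGraph d e (⟨.bangL e o none, ∅⟩ ::ₘ P) Q) (hR : Resp I W) :
    Evt I (fun P' => ∃ c₁ X, P' = cutGraph c₁ o P X ∧ Net I X Δ c₁ ∧ Apart P X ∧
      c₁.label = o.label ∧ Good I (j + 1) X ∧ j + 1 ≤ I c₁.name) (Γ + Δ) c W := by
  subst hW
  have hm := hP.mem_names (n := o.name) (by simp)
  rw [apart_iff] at hPQ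
  cases hQ with
  | @box₀ X c₁ d b hX hd hl₁ hb hg hj =>
    have hm₁ := hX.mem_names (Or.inl rfl)
    have hbP : b ∉ boxNames P := fun h => hPQ.2 b (by simp [h]) (by simp [Node.owns])
    have hA : Apart P X := apart_iff.2 (by simp [Node.owns] at hPQ; grind)
    have hcl : c₁.label = o.label := Formula.bang_inj (hl₁.symm.trans (hde.trans hl))
    refine Evt.of_step fun K R hf => ⟨cutGraph c₁ o P X, ⟨.cut hP hX hA hcl, ?_⟩, hf.mono ?_ ?_,
      ⟨c₁, X, rfl, ⟨hX, ?_⟩, hA, hcl, hg, ?_⟩, Or.inl ?_⟩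
    · simp [Node.Respects, Node.edges] at hR ⊢; grind
    · simp; grind
    · simp [Node.owns]; grind
    · simp at hR; tauto
    · simp [Node.Respects] at hR; omega
    · have hbf := hf.box b (by simp [Node.owns])
      have hbS : b ∉ boxUses (inside K P + R) := by
        simpa using ⟨hP.notMem_boxUses_inside hbP hbf.2, hbf.1⟩
      convert Step.bang (K := K) (c := c₁) (d := d) (e := e) (o := o) (b := b) (p := none)
        (R := inside K P + R + inside (insert b K) X) using 1
      · simp only [inside_add, inside_singleton, inside_inside, Finset.empty_union,
          ← Multiset.singleton_add, Finset.insert_eq]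
        abel
      · rw [dissolve_add, dissolve_of_notMem hbS,
          dissolve_inside (fun h => hb (hX.boxUses_sub h)) hbf.2]
        simp only [inside_add, inside_singleton, Finset.empty_union, Option.toFinset_none,
          Finset.union_empty, ← Multiset.singleton_add]
        abel
  | @box₁ X c₁ d i x b hX hd hl₁ hi hid hl' hb hg hj =>
    have hm₁ := hX.mem_names (Or.inl rfl)
    have hm₂ := hX.mem_names (n := x.name) (by simp)
    have hbP : b ∉ boxNames P := fun h => hPQ.2 b (by simp [h]) (by simp [Node.owns])
    have hcl : c₁.label = o.label := Formula.bang_inj (hl₁.symm.trans (hde.trans hl))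
    have hX' : Proves (⟨.bangL i x none, ∅⟩ ::ₘ X) {i} c₁ := .bangL hX hi hl'
    have hA : Apart P (⟨.bangL i x none, ∅⟩ ::ₘ X) := apart_iff.2 (by
      simp [Node.owns] at hPQ ⊢; grind)
    refine Evt.of_step fun K R hf => ⟨cutGraph c₁ o P _, ⟨.cut hP hX' hA hcl, ?_⟩,
      hf.mono ?_ ?_, ⟨c₁, _, rfl, ⟨hX', ?_⟩, hA, hcl, ?_, ?_⟩, Or.inl ?_⟩
    · simp [Node.Respects, Node.edges] at hR ⊢; grind
    · simp; grind
    · simp [Node.owns]; grind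
    · simp [Node.Respects] at hR ⊢; tauto
    · simpa [Node.Above]
    · simp [Node.Respects] at hR; omega
    · have hbf := hf.box b (by simp [Node.owns])
      have hbS : b ∉ boxUses (inside K P + R) := by
        simpa using ⟨hP.notMem_boxUses_inside hbP hbf.2, hbf.1⟩
      convert Step.bang (K := K) (c := c₁) (d := d) (e := e) (o := o) (b := b) (p := none)
        (R := inside K P + R + inside (insert b K) X + {⟨.bangL i x (some b), K⟩}) using 1
      · simp only [inside_add, inside_singleton, inside_inside, Finset.empty_union,
          ← Multiset.singleton_add, Finset.insert_eq]
        abel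
      · rw [dissolve_add, dissolve_add, dissolve_of_notMem hbS, dissolve_port hbf.2,
          dissolve_inside (fun h => hb (hX.boxUses_sub h)) hbf.2]
        simp only [inside_add, inside_singleton, Finset.empty_union, Option.toFinset_none,
          Finset.union_empty, ← Multiset.singleton_add]
        abel

/-- The two boxes merge into the box `b'`, which inherits the assumption of the other one. The only
cut of level possibly `j` is replaced by one a level higher, and both contents had no cut at level
`j`, so the argument does not have to enter `P`. -/
theorem evt_box_box {b' : ℕ} (hP : Proves P {x} c) (ho : o.name ∉ edgeNames P)
    (hlo : o.label = c.label.bang) (hb' : b' ∉ boxNames P) (hl : e.label = x.label.bang)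
    (hg' : Good I (j + 1) P) (hQ : BangBox I j Q Δ d) (hde : d.label = e.label)
    (hPQ : Apart (⟨.bangR c o b', ∅⟩ ::ₘ ⟨.bangL e x (some b'), ∅⟩ ::ₘ inside {b'} P) Q) {W : Graph}
    (hW : W = cutGraph d e
      (⟨.bangR c o b', ∅⟩ ::ₘ ⟨.bangL e x (some b'), ∅⟩ ::ₘ inside {b'} P) Q) (hR : Resp I W) :
    Evt I (Good I (j + 1)) Δ o W := by
  subst hW
  have hm := hP.mem_names (n := x.name) (by simp)
  have hm' := hP.mem_names (Or.inl rfl)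
  rw [apart_iff] at hPQ
  cases hQ with
  | @box₀ X c₁ d b hX hd hl₁ hb hg hj =>
    have hm₁ := hX.mem_names (Or.inl rfl)
    have hbP : b ∉ boxNames P := fun h => hPQ.2 b (by simp [h]) (by simp [Node.owns])
    have hbb : b ≠ b' := fun h => hPQ.2 b (by simp [Node.owns, h]) (by simp [Node.owns])
    have hA : Apart P X := apart_iff.2 (by simp [Node.owns] at hPQ; grind)
    have hcl : c₁.label = x.label := Formula.bang_inj (hl₁.symm.trans (hde.trans hl))
    have hPX := Proves.cut (Γ := 0) hP hX hA hcl
    refine Evt.of_step fun K R hf => ⟨_, ⟨.box₀ (o := o) (b := b') hPX ?_ hlo ?_, ?_⟩, hf.mono ?_ ?_, ?_,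
      Or.inl ?_⟩
    · simp at hPQ ⊢; grind
    · simp [Node.owns] at hPQ ⊢; grind
    · simp [Node.Respects, Node.edges] at hR ⊢; grind
    · simp; grind
    · simp [Node.owns]; grind
    · simp [Node.Respects, Node.Above] at hR ⊢; grind
    · have hbf := hf.box b (by simp [Node.owns])
      have hbS : b ∉ boxUses ({⟨.bangR c o b', K⟩} + inside (K ∪ {b'}) P + R) := by
        simp only [mem_boxUses_add, mem_boxUses_singleton, Node.uses, Set.mem_singleton_iff]
        have := hP.notMem_boxUses_inside hbP (K := K ∪ {b'}) (by simpa [hbb] using hbf.2)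
        tauto
      convert Step.bang (K := K) (c := c₁) (d := d) (e := e) (o := x) (b := b) (p := some b')
        (R := {⟨.bangR c o b', K⟩} + inside (K ∪ {b'}) P + R + inside (insert b K) X) using 1
      · simp only [inside_add, inside_singleton, inside_inside, Finset.empty_union,
          ← Multiset.singleton_add, Finset.insert_eq, Finset.union_comm K]
        abel
      · rw [dissolve_add, dissolve_of_notMem hbS,
          dissolve_inside (fun h => hb (hX.boxUses_sub h)) hbf.2]
        simp only [inside_add, inside_singleton, inside_inside, Finset.empty_union, Option.toFinset_some,
          Finset.union_comm K, ← Multiset.singleton_add]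
        abel
  | @box₁ X c₁ d i y b hX hd hl₁ hi hid hl' hb hg hj =>
    have hm₁ := hX.mem_names (Or.inl rfl)
    have hm₂ := hX.mem_names (n := y.name) (by simp)
    have hbP : b ∉ boxNames P := fun h => hPQ.2 b (by simp [h]) (by simp [Node.owns])
    have hbb : b ≠ b' := fun h => hPQ.2 b (by simp [Node.owns, h]) (by simp [Node.owns])
    have hA : Apart P X := apart_iff.2 (by simp [Node.owns] at hPQ; grind)
    have hcl : c₁.label = x.label := Formula.bang_inj (hl₁.symm.trans (hde.trans hl))
    have hPX := Proves.cut (Γ := 0) hP hX hA hcl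
    rw [zero_add] at hPX
    refine Evt.of_step fun K R hf => ⟨_, ⟨.box₁ (o := o) (b := b') hPX ?_ hlo (i := i) ?_ ?_ hl' ?_, ?_⟩,
      hf.mono ?_ ?_, ?_, Or.inl ?_⟩
    · simp at hPQ ⊢; grind
    · simp at hPQ ⊢; grind
    · simp at hPQ ⊢; grind
    · simp [Node.owns] at hPQ ⊢; grind
    · simp [Node.Respects, Node.edges] at hR ⊢; grind
    · simp; grind
    · simp [Node.owns]; grind
    · simp [Node.Respects, Node.Above] at hR ⊢; grind
    · have hbf := hf.box b (by simp [Node.owns])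
      have hbS : b ∉ boxUses ({⟨.bangR c o b', K⟩} + inside (K ∪ {b'}) P + R) := by
        simp only [mem_boxUses_add, mem_boxUses_singleton, Node.uses, Set.mem_singleton_iff]
        have := hP.notMem_boxUses_inside hbP (K := K ∪ {b'}) (by simpa [hbb] using hbf.2)
        tauto
      convert Step.bang (K := K) (c := c₁) (d := d) (e := e) (o := x) (b := b) (p := some b')
        (R := {⟨.bangR c o b', K⟩} + inside (K ∪ {b'}) P + R + inside (insert b K) X +
          {⟨.bangL i y (some b), K⟩}) using 1
      · simp only [inside_add, inside_singleton, inside_inside, Finset.empty_union,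
          ← Multiset.singleton_add, Finset.insert_eq, Finset.union_comm K]
        abel
      · rw [dissolve_add, dissolve_add, dissolve_of_notMem hbS, dissolve_port hbf.2,
          dissolve_inside (fun h => hb (hX.boxUses_sub h)) hbf.2]
        simp only [inside_add, inside_singleton, inside_inside, Finset.empty_union, Option.toFinset_some,
          Finset.union_comm K, ← Multiset.singleton_add]
        abel
end

/-! ## Duplication of a box -/

theorem Recurrent.exists_shift {I : ℕ → ℤ} (h : Recurrent I) {S : Set ℕ} (hS : S.Finite) :
    ∃ k, (∀ n, I (n + k) = I n) ∧ ∀ n, n + k ∉ S := by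
  obtain ⟨N, hN, h⟩ := h
  obtain ⟨M, hM⟩ := hS.bddAbove
  -- A multiple of the period, to preserve levels, that exceeds the bound `M` of the forbidden
  -- names.
  refine ⟨(M + 1) * N, fun n => ?_, fun n hn => ?_⟩
  · induction M + 1 with
    | zero => simp
    | succ k ih => rw [Nat.succ_mul, ← add_assoc, h, ih]
  · have := hM hn
    nlinarith

/-- A translation supplies fresh names on the same levels. Two renamings of boxes are needed: the
step wants one that fixes the surrounding boxes `K`, which is `g`, whereas preservation of proof
structures wants a globally injective one, which is the translation `g'`. They agree on the boxes of
`Q`, so they produce the same copy. -/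
theorem Recurrent.exists_copy {I : ℕ → ℤ} (h : Recurrent I) (W : Graph) {Q : Graph}
    {K : Finset ℕ} (hK : ∀ b ∈ boxUses Q, b ∉ K) : ∃ f g g' : ℕ → ℕ, f.Injective ∧ g'.Injective ∧
      (∀ n, I (f n) = I n) ∧ (∀ n, f n ∉ edgeNames W) ∧ (∀ n, g' n ∉ boxUses W ∧ g' n ∉ K) ∧
      (∀ b ∈ boxUses Q, g b = g' b) ∧ IsCopy W (inside K Q) K f g ∧
      Graph.map (Edge.rename f) g id (inside K Q) =
        inside K (Graph.map (Edge.rename f) g' id Q) := by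
  obtain ⟨k, hk, hk'⟩ := h.exists_shift (finite_edgeNames W)
  obtain ⟨M, hM⟩ := ((finite_boxUses W).union K.finite_toSet).bddAbove
  have hM' : ∀ n, n + (M + 1) ∉ boxUses W ∧ n + (M + 1) ∉ K := fun n =>
    ⟨fun h => by have := hM (Or.inl h); omega, fun h => by have := hM (Or.inr h); omega⟩
  have hg : ∀ b ∈ boxUses Q, (fun n => if n ∈ K then n else n + (M + 1)) b = b + (M + 1) :=
    fun b hb => if_neg (hK b hb)
  have hg' : ∀ b ∈ boxNames (inside K Q),
      (fun n => if n ∈ K then n else n + (M + 1)) b = b + (M + 1) := fun b hb =>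
    hg b (mem_boxUses_of_boxNames _ _ (by simpa using hb))
  refine ⟨fun n => n + k, fun n => if n ∈ K then n else n + (M + 1), fun n => n + (M + 1),
    add_left_injective k, add_left_injective _, hk, hk', hM', hg,
    ⟨(add_left_injective k).injOn, fun n _ => hk' n, ?_, ?_, fun b hb => if_pos hb⟩, ?_⟩
  · intro b hb b' hb' h
    rw [hg' b hb, hg' b' hb'] at h
    simpa using h
  · intro b hb h
    have h' := hg' b hb
    simp only at h'
    rw [h'] at h
    exact (hM' b).1 (mem_boxUses_of_boxNames _ _ h)
  · rw [map_inside, map_congr _ _ _ (fun _ _ => rfl) hg fun _ _ => rfl]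
    congr 1
    conv_rhs => rw [← Finset.image_id (s := K)]
    exact Finset.image_congr fun b hb => if_pos hb

section
variable {I : ℕ → ℤ} {j : ℤ} {Γ Δ : Multiset Edge} {c d e o₁ o₂ : Edge} {P Q : Graph}

-- The original box keeps its output `d` and the copy has `d₂`; both satisfy the conditions of
-- `BangBox`, because the renaming preserves levels and contents are not altered otherwise. If the
-- box has an assumption, both copies receive fresh inputs, contracted by a node outside everything
-- else. The disjunction exposes this node so that it can be set aside while the two boxes are
-- absorbed.
set_option maxHeartbeats 1000000 in
theorem evt_box_contr (hI : Recurrent I) (hP : Proves P (o₁ ::ₘ o₂ ::ₘ Γ) c)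
    (hl₁ : o₁.label = e.label) (hl₂ : o₂.label = e.label)
    (hQ : BangBox I j Q Δ d) (hde : d.label = e.label)
    (hPQ : Apart (⟨.contr e o₁ o₂, ∅⟩ ::ₘ P) Q) {W : Graph}
    (hW : W = cutGraph d e (⟨.contr e o₁ o₂, ∅⟩ ::ₘ P) Q) (hR : Resp I W) :
    Evt I (fun P' => ∃ Q₁ Q₂ d₂ Δ₁ Δ₂ X, BangBox I j Q₁ Δ₁ d ∧ BangBox I j Q₂ Δ₂ d₂ ∧
      d₂.label = d.label ∧ Apart P (Q₁ + Q₂) ∧ Apart Q₁ Q₂ ∧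
      X = ⟨.cut d o₁, ∅⟩ ::ₘ ⟨.cut d₂ o₂, ∅⟩ ::ₘ (P + (Q₁ + Q₂)) ∧
      ((Δ = 0 ∧ Δ₁ = 0 ∧ Δ₂ = 0 ∧ P' = X) ∨
        ∃ i i₁ i₂, Δ = {i} ∧ Δ₁ = {i₁} ∧ Δ₂ = {i₂} ∧ LeftRule (.contr i i₁ i₂) i {i₁, i₂} ∧
          i₁.label = i.label ∧ i₂.label = i.label ∧ i.name ∉ edgeNames X ∧
          P' = ⟨.contr i i₁ i₂, ∅⟩ ::ₘ X)) (Γ + Δ) c W := by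
  subst hW
  have ho₁ := hP.mem_names (n := o₁.name) (by simp)
  have ho₂ := hP.mem_names (n := o₂.name) (by simp)
  -- Both cases end with `P` cut with a family of two boxes, so one derivation serves for both.
  have build : ∀ {Q₁ Q₂ Δ₁ Δ₂ d₂}, BangBox I j Q₁ Δ₁ d → BangBox I j Q₂ Δ₂ d₂ →
      d₂.label = d.label → Apart P (Q₁ + Q₂) → Apart Q₁ Q₂ →
      Proves (⟨.cut d o₁, ∅⟩ ::ₘ ⟨.cut d₂ o₂, ∅⟩ ::ₘ (P + (Q₁ + Q₂))) (Γ + (Δ₁ + Δ₂)) c := by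
    intro Q₁ Q₂ Δ₁ Δ₂ d₂ h₁ h₂ hd hA hA'
    have hB := Boxes.cons h₁ (e := o₁) (hde.trans hl₁.symm) (.cons h₂ (e := o₂)
      (hd.trans (hde.trans hl₂.symm)) .nil (by simp [apart_iff])) (by simpa using hA')
    have := hB.proves (P := P) (Γ := Γ) (c := c) (by simpa using hP) (by simpa using hA)
    convert this using 1
    · simp only [← Multiset.singleton_add]; abel
    · abel
  cases hQ with
  | @box₀ X c₁ d b hX hd hl hb hg hj =>
    have hdX := hX.mem_names (Or.inl rfl)
    have hQ' : Proves (⟨.bangR c₁ d b, ∅⟩ ::ₘ inside {b} X) 0 d := .box₀ hX hd hl hb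
    have hbP : b ∉ boxNames P := fun h => hPQ.boxes (n := b) (by simp [h]) (by simp [Node.owns])
    refine Evt.of_step fun K R hf => ?_
    obtain ⟨f, g, g', hf₁, hg₁, hIf, hf₂, hg₂, hgg, hcopy, hmap⟩ := hI.exists_copy
      (inside K (cutGraph d e (⟨.contr e o₁ o₂, ∅⟩ ::ₘ P) (⟨.bangR c₁ d b, ∅⟩ ::ₘ inside {b} X)) + R)
      (Q := ⟨.bangR c₁ d b, ∅⟩ ::ₘ inside {b} X) (K := K)
      fun b' h => (hf.box b' (by
        rw [mem_boxNames_cons, mem_boxNames_add]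
        exact Or.inr (Or.inr (hQ'.boxUses_sub h)))).2
    have hfn : ∀ n m, n = f m → n ∉ edgeNames
      (inside K (cutGraph d e (⟨.contr e o₁ o₂, ∅⟩ ::ₘ P) (⟨.bangR c₁ d b, ∅⟩ ::ₘ inside {b} X)) + R) :=
      fun n m h => h ▸ hf₂ m
    have hgn : ∀ n m, n = g' m → n ∉ boxUses
      (inside K (cutGraph d e (⟨.contr e o₁ o₂, ∅⟩ ::ₘ P) (⟨.bangR c₁ d b, ∅⟩ ::ₘ inside {b} X)) + R) :=
      fun n m h => h ▸ (hg₂ m).1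
    have hgn' := fun n m h h' => hgn n m h (mem_boxUses_of_boxNames _ _ h')
    have hmE := edgeNames_map (fe := Edge.rename f) (f := f) (fun _ => rfl) g' id X
    have hmB := boxNames_map (Edge.rename f) g' id X
    have hQ₁ : BangBox I j _ 0 d := .box₀ hX hd hl hb hg hj
    have hQ₂ : BangBox I j (⟨.bangR (c₁.rename f) (d.rename f) (g' b), ∅⟩ ::ₘ
        inside {g' b} (Graph.map (Edge.rename f) g' id X)) 0 (d.rename f) := by
      refine .box₀ (by simpa using hX.rename hf₁ hg₁) ?_ hl ?_ ?_ ?_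
      · rw [hmE]; rintro ⟨m, hm, h⟩; exact hd (hf₁ h ▸ hm)
      · rw [hmB]; rintro ⟨m, hm, h⟩; exact hb (hg₁ h ▸ hm)
      · rwa [good_map fun e => hIf e.name]
      · simpa [Edge.rename, hIf] using hj
    simp only [mem_edgeNames_add, mem_edgeNames_inside, mem_edgeNames_cons, mem_boxNames_add,
      mem_boxNames_inside, mem_boxNames_cons, names_cut, names_contr, names_bangR, Node.owns]
      at hfn hgn'
    rw [apart_iff] at hPQ
    have hA : Apart P (⟨.bangR c₁ d b, ∅⟩ ::ₘ inside {b} X +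
        (⟨.bangR (c₁.rename f) (d.rename f) (g' b), ∅⟩ ::ₘ
        inside {g' b} (Graph.map (Edge.rename f) g' id X))) := by
      rw [apart_iff]
      simp [Node.owns, hmE, hmB, Edge.rename] at hPQ ⊢
      grind
    have hA' : Apart (⟨.bangR c₁ d b, ∅⟩ ::ₘ inside {b} X)
        (⟨.bangR (c₁.rename f) (d.rename f) (g' b), ∅⟩ ::ₘ
        inside {g' b} (Graph.map (Edge.rename f) g' id X)) := by
      rw [apart_iff]
      simp [Node.owns, hmE, hmB, Edge.rename] at hPQ ⊢
      grind
    refine ⟨_, ⟨build hQ₁ hQ₂ rfl hA hA', ?_⟩, ⟨?_, ?_⟩,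
      ⟨_, _, _, _, _, _, hQ₁, hQ₂, rfl, hA, hA', rfl, Or.inl ⟨rfl, rfl, rfl, rfl⟩⟩, Or.inl ?_⟩
    · have := resp_map (I := I) (fe := Edge.rename f) (fun e => hIf e.name) g' id X
      simp [Node.Respects, Node.edges, Edge.rename, hIf] at hR ⊢
      grind
    · have := hf.edge
      simp [hmE, Edge.rename] at this ⊢
      grind
    · have := hf.box
      have h₂ := fun n m (h : n = g' m) => h ▸ (hg₂ m).2
      simp [hmB, Node.owns] at this hgn ⊢
      grind
    · have hbf := hf.box b (by simp [Node.owns])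
      have hbS : b ∉ boxUses (inside K P + R) := by
        simpa using ⟨(hP.notMem_boxUses_inside hbP hbf.2), hbf.1⟩
      convert Step.contr₀ (K := K) (c := c₁) (d := d) (e := e) (o₁ := o₁) (o₂ := o₂)
        (IsContent.of_notMem (mem_boxes_inside (K := {b} ∪ K) (by simp) X) hbS) rfl rfl
        (f := f) (g := g) ?_ using 1
      · simp only [inside_add, inside_singleton, inside_inside, Finset.empty_union,
          ← Multiset.singleton_add]
        abel
      · have e₁ : (⟨.bangR c₁ d b, K⟩ ::ₘ inside ({b} ∪ K) X : Graph) =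
            inside K (⟨.bangR c₁ d b, ∅⟩ ::ₘ inside {b} X) := by simp
        rw [e₁, hmap]
        simp only [inside_add, inside_singleton, inside_inside, Finset.empty_union,
          ← Multiset.singleton_add, map_add, map_singleton, map_inside, Node.map,
          Finset.image_empty, Finset.image_singleton]
        abel
      · convert hcopy using 1
        · simp only [inside_add, inside_singleton, inside_inside, Finset.empty_union,
            ← Multiset.singleton_add]
          abel
        · simp
  | @box₁ X c₁ d i x b hX hd hl hi hid hl' hb hg hj =>
    have hdX := hX.mem_names (Or.inl rfl)
    have hxX := hX.mem_names (n := x.name) (by simp)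
    have hQ' : Proves (⟨.bangR c₁ d b, ∅⟩ ::ₘ ⟨.bangL i x (some b), ∅⟩ ::ₘ inside {b} X) {i} d :=
      .box₁ hX hd hl hi hid hl' hb
    have hbP : b ∉ boxNames P := fun h => hPQ.boxes (n := b) (by simp [h]) (by simp [Node.owns])
    refine Evt.of_step fun K R hf => ?_
    -- The two new inputs must be fresh for the whole net and also for the copy, so the net is named
    -- and its edges and boxes are described once.
    generalize hT : inside K (cutGraph d e (⟨.contr e o₁ o₂, ∅⟩ ::ₘ P)
      (⟨.bangR c₁ d b, ∅⟩ ::ₘ ⟨.bangL i x (some b), ∅⟩ ::ₘ inside {b} X)) + R = T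
    obtain ⟨f, g, g', hf₁, hg₁, hIf, hf₂, hg₂, hgg, hcopy, hmap⟩ := hI.exists_copy T
      (Q := ⟨.bangR c₁ d b, ∅⟩ ::ₘ inside {b} X) (K := K)
      fun b' h => (hf.box b' (by
        rw [mem_boxNames_cons, mem_boxNames_add]
        refine Or.inr (Or.inr (hQ'.boxUses_sub ?_))
        simp only [mem_boxUses_cons] at h ⊢
        tauto)).2
    obtain ⟨i₁, i₂, hne, ⟨hi₁, hli₁, hIi₁⟩, hi₂, hli₂, hIi₂⟩ := hI.exists_fresh₂
      (T + Graph.map (Edge.rename f) g id (inside K (⟨.bangR c₁ d b, ∅⟩ ::ₘ inside {b} X)))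
      i.label i.label i.name i.name
    have hfn := hf₂
    have hgn : ∀ n, g' n ∉ boxUses T := fun n => (hg₂ n).1
    have hgn' := fun n h' => hgn n (mem_boxUses_of_boxNames _ _ h')
    have hmE := edgeNames_map (fe := Edge.rename f) (f := f) (fun _ => rfl) g' id X
    have hmB := boxNames_map (Edge.rename f) g' id X
    have hi₁' := hi₁
    have hi₂' := hi₂
    have hTn : ∀ n, n ∈ edgeNames T ↔ (n = d.name ∨ n = e.name) ∨ (n = e.name ∨ n = o₁.name ∨
        n = o₂.name) ∨ n ∈ edgeNames P ∨ (n = c₁.name ∨ n = d.name) ∨ (n = i.name ∨ n = x.name) ∨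
        n ∈ edgeNames X ∨ n ∈ edgeNames R := by
      intro n; rw [← hT]; simp; grind
    have hTb : ∀ n, n ∈ boxNames T ↔ n = b ∨ n ∈ boxNames P ∨ n ∈ boxNames X ∨
        n ∈ boxNames R := by
      intro n; rw [← hT]; simp [Node.owns]; grind
    simp only [mem_edgeNames_add, hmap, mem_edgeNames_inside, map_cons, map_inside,
      mem_edgeNames_cons, Node.map, names_bangR, hmE, hTn, not_or] at hi₁' hi₂'
    have hQ₁ : BangBox I j (⟨.bangR c₁ d b, ∅⟩ ::ₘ ⟨.bangL i₁ x (some b), ∅⟩ ::ₘ inside {b} X)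
        {i₁} d := .box₁ hX hd hl (by grind) (by grind) (hli₁.trans hl') hb hg hj
    have hQ₂ : BangBox I j (⟨.bangR (c₁.rename f) (d.rename f) (g' b), ∅⟩ ::ₘ
        ⟨.bangL i₂ (x.rename f) (some (g' b)), ∅⟩ ::ₘ
        inside {g' b} (Graph.map (Edge.rename f) g' id X)) {i₂} (d.rename f) := by
      refine .box₁ (by simpa using hX.rename hf₁ hg₁) ?_ hl ?_ ?_ (hli₂.trans hl') ?_ ?_ ?_
      · rw [hmE]; rintro ⟨m, hm, h⟩; exact hd (hf₁ h ▸ hm)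
      · rw [hmE]; grind
      · grind [Edge.rename]
      · rw [hmB]; rintro ⟨m, hm, h⟩; exact hb (hg₁ h ▸ hm)
      · rwa [good_map fun e => hIf e.name]
      · simpa [Edge.rename, hIf] using hj
    simp only [hTn, hTb, not_or, imp_false] at hfn hgn'
    rw [apart_iff] at hPQ
    have hA : Apart P (⟨.bangR c₁ d b, ∅⟩ ::ₘ ⟨.bangL i₁ x (some b), ∅⟩ ::ₘ inside {b} X +
        (⟨.bangR (c₁.rename f) (d.rename f) (g' b), ∅⟩ ::ₘ
        ⟨.bangL i₂ (x.rename f) (some (g' b)), ∅⟩ ::ₘ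
        inside {g' b} (Graph.map (Edge.rename f) g' id X))) := by
      refine apart_iff.2 ⟨fun n hn hn' => ?_, fun n hn hn' => ?_⟩
      · have := hPQ.1 n (by simp [hn])
        simp [hmE, Edge.rename] at this hn'
        rcases hn' with ((h | h) | (h | h) | h) | ((h | h) | (h | h) | ⟨m, hm, h⟩) <;> grind
      · have := hPQ.2 n (by simp [hn])
        simp [Node.owns, hmB] at this hn'
        grind
    have hA' : Apart (⟨.bangR c₁ d b, ∅⟩ ::ₘ ⟨.bangL i₁ x (some b), ∅⟩ ::ₘ inside {b} X)
        (⟨.bangR (c₁.rename f) (d.rename f) (g' b), ∅⟩ ::ₘ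
        ⟨.bangL i₂ (x.rename f) (some (g' b)), ∅⟩ ::ₘ
        inside {g' b} (Graph.map (Edge.rename f) g' id X)) := by
      refine apart_iff.2 ⟨fun n hn hn' => ?_, fun n hn hn' => ?_⟩
      · simp [hmE, Edge.rename] at hi₁' hi₂' hn hn'
        clear hPQ hA
        rcases hn with (h₁ | h₁) | (h₁ | h₁) | h₁ <;>
          rcases hn' with (h | h) | (h | h) | ⟨m, hm, h⟩ <;> grind
      · simp [Node.owns, hmB] at hn hn'
        grind
    have hr : LeftRule (.contr i i₁ i₂) i {i₁, i₂} :=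
      .contr hl' (hli₁.trans hl') (hli₂.trans hl')
    have hX' := build hQ₁ hQ₂ rfl hA hA'
    have hiX : i.name ∉ edgeNames (⟨.cut d o₁, ∅⟩ ::ₘ ⟨.cut (d.rename f) o₂, ∅⟩ ::ₘ (P +
        (⟨.bangR c₁ d b, ∅⟩ ::ₘ ⟨.bangL i₁ x (some b), ∅⟩ ::ₘ inside {b} X +
        (⟨.bangR (c₁.rename f) (d.rename f) (g' b), ∅⟩ ::ₘ
        ⟨.bangL i₂ (x.rename f) (some (g' b)), ∅⟩ ::ₘ
        inside {g' b} (Graph.map (Edge.rename f) g' id X))))) := by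
      have h₀ := fun n h h' => hPQ.1 n h (show n ∈ _ by simpa using Or.inr (Or.inl (Or.inl h')))
      have h₁ := h₀ i.name
      have h₂ := hfn
      simp at h₁
      intro h
      simp [hmE, Edge.rename] at h
      clear hPQ h₀ hA hA'
      grind
    refine ⟨_, ⟨?_, ?_⟩, ⟨?_, ?_⟩,
      ⟨_, _, _, _, _, _, hQ₁, hQ₂, rfl, hA, hA', rfl, Or.inr ⟨i, i₁, i₂, rfl, rfl, rfl, hr, hli₁,
        hli₂, hiX, rfl⟩⟩, Or.inl ?_⟩
    · rw [add_comm Γ] at hX'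
      rw [add_comm Γ]
      exact hr.proves hX' hiX
    · have := resp_map (I := I) (fe := Edge.rename f) (fun e => hIf e.name) g' id X
      simp [Node.Respects, Node.edges, Edge.rename, hIf] at hR ⊢
      grind
    · have := hf.edge
      simp [hmE, Edge.rename] at this ⊢
      grind
    · have := hf.box
      have h₂ := fun m => (hg₂ m).2
      rw [← hT] at hgn
      simp [hmB, Node.owns] at this hgn ⊢
      grind
    · have hbf := hf.box b (by simp [Node.owns])
      have hbS : b ∉ boxUses (inside K P + R) := by
        simpa using ⟨(hP.notMem_boxUses_inside hbP hbf.2), hbf.1⟩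
      have e₁ : (⟨.bangR c₁ d b, K⟩ ::ₘ inside ({b} ∪ K) X : Graph) =
          inside K (⟨.bangR c₁ d b, ∅⟩ ::ₘ inside {b} X) := by simp
      have e₂ : T = ⟨.cut d e, K⟩ ::ₘ ⟨.contr e o₁ o₂, K⟩ ::ₘ ⟨.bangL i x (some b), K⟩ ::ₘ
          (⟨.bangR c₁ d b, K⟩ ::ₘ inside ({b} ∪ K) X + (inside K P + R)) := by
        rw [← hT]
        simp only [inside_add, inside_singleton, inside_inside, Finset.empty_union,
          ← Multiset.singleton_add]
        abel
      have e₃ : ∀ n, n ∉ edgeNames (T + Graph.map (Edge.rename f) g id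
          (inside K (⟨.bangR c₁ d b, ∅⟩ ::ₘ inside {b} X))) → n ∉ edgeNames T ∪
          f '' edgeNames (⟨.bangR c₁ d b, K⟩ ::ₘ inside ({b} ∪ K) X) := by
        intro n hn
        rw [e₁]
        rintro (h | ⟨m, hm, rfl⟩)
        · exact hn (by rw [mem_edgeNames_add]; exact Or.inl h)
        · refine hn ?_
          rw [mem_edgeNames_add, edgeNames_map (f := f) (fun _ => rfl)]
          exact Or.inr ⟨m, hm, rfl⟩
      convert Step.contr₁ (K := K) (c := c₁) (d := d) (e := e) (o₁ := o₁) (o₂ := o₂) (i := i)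
        (x := x)
        (IsContent.of_notMem (mem_boxes_inside (K := {b} ∪ K) (by simp) X) hbS) rfl e₂
        (f := f) (g := g) (by rwa [e₁]) hne (e₃ _ hi₁) hli₁ (e₃ _ hi₂) hli₂ using 1
      rw [e₁, hmap, hgg b (by simp [Node.uses])]
      simp only [inside_add, inside_singleton, inside_inside, Finset.empty_union,
        ← Multiset.singleton_add, map_add, map_singleton, map_inside, Node.map,
        Finset.image_empty, Finset.image_singleton]
      abel
end

/-! ## Cuts with boxes -/

/-- All the cuts of inputs of `P` with boxes can be raised above the level `j`. -/
def Absorbs (I : ℕ → ℤ) (j : ℤ) (P : Graph) (Γ₀ : Multiset Edge) (c : Edge) : Prop :=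
  ∀ ⦃E Γ C G Δ⦄, Γ₀ = E + Γ → Boxes I j E C G Δ → Apart P G →
    (∀ x ∈ Δ, ∀ a ∈ eigenvars P, a ∉ x.label.fv) → Resp I (P + (C + G)) →
    Evt I (Good I (j + 1)) (Γ + Δ) c (P + (C + G))

section
variable {I : ℕ → ℤ} {j : ℤ} {A E E₁ E₂ Γ Δ : Multiset Edge} {c d e i o : Edge}
  {P Q C G : Graph} {n : Node}

theorem Boxes.mem_edgeNames (h : Boxes I j E C G Δ) (hE : ∀ n ∈ namesOf E, n ∈ edgeNames P)
    (n : ℕ) : n ∈ edgeNames (P + (C + G)) ↔ n ∈ edgeNames P ∨ n ∈ edgeNames G := by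
  have := h.names.1 n
  simp only [mem_edgeNames_add]
  grind

theorem Boxes.mem_boxNames (h : Boxes I j E C G Δ) (n : ℕ) :
    n ∈ boxNames (P + (C + G)) ↔ n ∈ boxNames P ∨ n ∈ boxNames G := by
  have := h.names.2 n
  simp only [mem_boxNames_add]
  grind

/-- This case forces the use of families. For the duplication, the remaining boxes count as part of
the structure being cut; afterwards they are regrouped with the two copies, and the enlarged family
is cut with inputs of the premise `P`, where the induction hypothesis applies regardless of the
number of boxes. -/
theorem evt_boxes_contr (hI : Recurrent I) {o₁ o₂ : Edge} (hl₁ : o₁.label = e.label)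
    (hl₂ : o₂.label = e.label) (hP : Proves P (o₁ ::ₘ o₂ ::ₘ (E + Γ)) c)
    (hQ : BangBox I j Q Δ d) (hde : d.label = e.label) {Δ' : Multiset Edge}
    (hG : Boxes I j E C G Δ') (hQG : Apart Q G)
    (hA : Apart (⟨.contr e o₁ o₂, ∅⟩ ::ₘ P) (Q + G))
    (ha : ∀ x ∈ Δ + Δ', ∀ a ∈ eigenvars P, a ∉ x.label.fv)
    (ih : Absorbs I j P (o₁ ::ₘ o₂ ::ₘ (E + Γ)) c) {W : Graph}
    (hW : W = ⟨.contr e o₁ o₂, ∅⟩ ::ₘ P + (⟨.cut d e, ∅⟩ ::ₘ C + (Q + G))) (hR : Resp I W) :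
    Evt I (Good I (j + 1)) (Γ + (Δ + Δ')) c W := by
  have hE : ∀ n ∈ namesOf E, n ∈ edgeNames P := fun n h => hP.mem_names (by simp [h])
  have hn := hG.mem_edgeNames hE
  have hb := hG.mem_boxNames (P := P)
  rw [apart_iff] at hA hQG
  have hP' : Proves (P + (C + G)) (o₁ ::ₘ o₂ ::ₘ (Γ + Δ')) c := by
    have := hG.proves (P := P) (Γ := o₁ ::ₘ o₂ ::ₘ Γ) (c := c) (by simpa using hP)
      (apart_iff.2 (by simp at hA; grind))
    simpa using this
  have hA' : Apart (⟨.contr e o₁ o₂, ∅⟩ ::ₘ (P + (C + G))) Q := by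
    rw [apart_iff]
    simp only [mem_edgeNames_cons, mem_boxNames_cons, hn, hb]
    simp only [mem_edgeNames_cons, mem_boxNames_cons, mem_edgeNames_add, mem_boxNames_add] at hA
    grind
  rw [add_comm Δ, ← add_assoc]
  refine (evt_box_contr hI hP' hl₁ hl₂ hQ hde hA' (W := W) ?_ hR).bind ?_
  · rw [hW]; simp only [cutGraph, ← Multiset.singleton_add]; abel
  -- Shared by boxes with and without assumption; the inputs are ordered so that a contraction on
  -- the assumptions of the two copies can be put back.
  have key : ∀ {Q₁ Q₂ d₂ Δ₁ Δ₂}, BangBox I j Q₁ Δ₁ d → BangBox I j Q₂ Δ₂ d₂ → d₂.label = d.label →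
      Apart (P + (C + G)) (Q₁ + Q₂) → Apart Q₁ Q₂ →
      (∀ x ∈ Δ₁ + Δ₂, ∀ a ∈ eigenvars P, a ∉ x.label.fv) →
      Resp I (⟨.cut d o₁, ∅⟩ ::ₘ ⟨.cut d₂ o₂, ∅⟩ ::ₘ (P + (C + G) + (Q₁ + Q₂))) →
      Proves (⟨.cut d o₁, ∅⟩ ::ₘ ⟨.cut d₂ o₂, ∅⟩ ::ₘ (P + (C + G) + (Q₁ + Q₂)))
        (Δ₁ + Δ₂ + (Γ + Δ')) c ∧
      Evt I (Good I (j + 1)) (Δ₁ + Δ₂ + (Γ + Δ')) c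
        (⟨.cut d o₁, ∅⟩ ::ₘ ⟨.cut d₂ o₂, ∅⟩ ::ₘ (P + (C + G) + (Q₁ + Q₂))) := by
    intro Q₁ Q₂ d₂ Δ₁ Δ₂ h₁ h₂ hd hPQ hQQ ha' hR
    rw [apart_iff] at hPQ hQQ
    simp only [hn, hb, mem_edgeNames_add, mem_boxNames_add] at hPQ
    have hB := Boxes.cons h₁ (hde.trans hl₁.symm) (.cons h₂ (hd.trans (hde.trans hl₂.symm)) hG
      (apart_iff.2 (by grind))) (apart_iff.2 (by
        simp only [mem_edgeNames_add, mem_boxNames_add]; grind))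
    have hW' : (⟨.cut d o₁, ∅⟩ ::ₘ ⟨.cut d₂ o₂, ∅⟩ ::ₘ (P + (C + G) + (Q₁ + Q₂)) : Graph) =
        P + (⟨.cut d o₁, ∅⟩ ::ₘ ⟨.cut d₂ o₂, ∅⟩ ::ₘ C + (Q₁ + (Q₂ + G))) := by
      simp only [← Multiset.singleton_add]; abel
    have hΓ : Δ₁ + Δ₂ + (Γ + Δ') = Γ + (Δ₁ + (Δ₂ + Δ')) := by abel
    have hPG : Apart P (Q₁ + (Q₂ + G)) := apart_iff.2 (by
      simp only [mem_edgeNames_add, mem_boxNames_add]; simp at hA; grind)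
    rw [hW'] at hR ⊢
    rw [hΓ]
    refine ⟨hB.proves (by simpa using hP) hPG, ih (by simp) hB hPG ?_ hR⟩
    intro x hx
    simp only [Multiset.mem_add] at hx ha ha'
    grind
  rintro _ hN ⟨Q₁, Q₂, d₂, Δ₁, Δ₂, _, h₁, h₂, hd, hPQ, hQQ, rfl, ⟨rfl, rfl, rfl, rfl⟩ |
    ⟨i, i₁, i₂, rfl, rfl, rfl, hr, hi₁, hi₂, hi, rfl⟩⟩
  · simpa using (key h₁ h₂ hd hPQ hQQ (by simp) hN.2).2
  · have hN' := hN.2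
    rw [resp_cons] at hN'
    have := key h₁ h₂ hd hPQ hQQ (by simpa [hi₁, hi₂] using ha i (by simp)) hN'.2
    rw [add_comm _ ({i} : Multiset Edge), Multiset.singleton_add]
    refine (Evt.left hr this.1 hi hN'.1 this.2).mono ?_
    rintro _ - ⟨P₁, rfl, -, -, h⟩
    simpa [Node.Above] using h

/-- The last rule of the structure introduces an input that is cut with a box. The label is a
`!`-formula, or arbitrary for a weakening, so the rule is a contraction, a weakening or a plain
`!`-left node. The box is dealt with by the corresponding exponential or garbage step, and the rest
of the family by the induction hypothesis. -/
theorem evt_boxes_left (hI : Recurrent I) (hr : LeftRule n e A)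
    (hP : Proves P (A + (E + Γ)) c)
    (hQ : BangBox I j Q Δ d) (hde : d.label = e.label) {Δ' : Multiset Edge}
    (hG : Boxes I j E C G Δ') (hQG : Apart Q G)
    (hA : Apart (⟨n, ∅⟩ ::ₘ P) (Q + G))
    (ha : ∀ x ∈ Δ + Δ', ∀ a ∈ eigenvars P, a ∉ x.label.fv)
    (ih : Absorbs I j P (A + (E + Γ)) c) {W : Graph}
    (hW : W = ⟨n, ∅⟩ ::ₘ P + (⟨.cut d e, ∅⟩ ::ₘ C + (Q + G))) (hR : Resp I W) :
    Evt I (Good I (j + 1)) (Γ + (Δ + Δ')) c W := by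
  have hE : ∀ n ∈ namesOf E, n ∈ edgeNames P := fun n h => hP.mem_names (by simp [h])
  have hn := hG.mem_edgeNames hE
  have hb := hG.mem_boxNames (P := P)
  have hA₀ := hA
  rw [apart_iff] at hA₀ hQG
  have hPG : Apart P G := apart_iff.2 (by simp at hA₀; grind)
  have hP' : Proves (P + (C + G)) (A + Γ + Δ') c :=
    hG.proves (by rwa [add_left_comm] at hP) hPG
  have hA' : Apart (⟨n, ∅⟩ ::ₘ (P + (C + G))) Q := by
    rw [apart_iff]
    simp only [mem_edgeNames_cons, mem_boxNames_cons, hn, hb]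
    simp only [mem_edgeNames_cons, mem_boxNames_cons, mem_edgeNames_add, mem_boxNames_add] at hA₀
    grind
  have hW' : W = cutGraph d e (⟨n, ∅⟩ ::ₘ (P + (C + G))) Q := by
    rw [hW]; simp only [cutGraph, ← Multiset.singleton_add]; abel
  have ha' : ∀ x ∈ Δ', ∀ a ∈ eigenvars P, a ∉ x.label.fv := fun x hx =>
    ha x (Multiset.mem_add.2 (Or.inr hx))
  have head : e.label.head = 4 := hde ▸ hQ.head
  cases hr with
  | contr hl hl₁ hl₂ =>
    exact evt_boxes_contr hI (hl₁.trans hl.symm) (hl₂.trans hl.symm) (by simpa using hP) hQ hde hG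
      (apart_iff.2 hQG) hA ha (by simpa using ih) hW hR
  | tensorL hl => simp [hl] at head
  | allL hl => simp [hl] at head
  | parL hl => simp [hl] at head
  | weak =>
    rw [zero_add] at hP'
    rw [add_comm Δ, ← add_assoc]
    refine (evt_box_weak hP' hQ hA' hW' hR).bind ?_
    rintro _ hN (⟨rfl, rfl⟩ | ⟨i, rfl, rfl, hi⟩)
    · rw [add_zero]
      exact ih (zero_add _) hG hPG ha' hN.2
    · have hN' := hN.2
      rw [resp_cons] at hN'
      rw [add_comm _ ({i} : Multiset Edge), Multiset.singleton_add]
      refine (Evt.left (.weak i) (by rwa [zero_add]) hi hN'.1 (Φ := Good I (j + 1)) ?_).mono ?_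
      · rw [zero_add]
        exact ih (zero_add _) hG hPG ha' hN'.2
      · rintro _ - ⟨P₁, rfl, -, -, h⟩
        simpa [Node.Above] using h
  | @bangL _ o hl =>
    rw [add_assoc, Multiset.singleton_add] at hP'
    rw [add_comm Δ, ← add_assoc]
    refine (evt_box_bang hP' hl hQ hde hA' hW' hR).bind ?_
    rintro _ hN ⟨c₁, X, rfl, hX, hPX, hcl, hXg, hj⟩
    have hN' := hN.2
    rw [resp_cons, resp_add] at hN'
    refine (Evt.cutL hP' hX.1 hX.2 hPX hcl hN'.1 (Φ := Good I (j + 1)) ?_).mono ?_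
    · rw [← Multiset.cons_add, ← Multiset.singleton_add]
      exact ih (add_left_comm _ _ _) hG hPG ha' hN'.2.1
    · rintro _ - ⟨P₁, rfl, -, -, h⟩
      simp [Node.Above, *]

/-- Induction on `P`, all boxes of the family rising together. They are distributed among the
premises of a rule, and each one is consumed at the rule that introduces its input. A box of `P` is
not entered: its single input is handled by merging. Since `P` has no cut at level `j`, no other cut
has to be reduced on the way. -/
theorem Proves.absorbs (hI : Recurrent I) (hP : Proves P Γ c) :
    Good I (j + 1) P → Absorbs I j P Γ c := by
  induction hP using Proves.rules with
  | ax hn hl =>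
    intro hg E Γ C G Δ hE hB hA ha hR
    rcases add_eq_cons (u := 0) hE.symm with ⟨E', rfl, h⟩ | ⟨Γ', rfl, h⟩
    · obtain ⟨rfl, rfl⟩ := add_eq_zero.1 h.symm
      obtain ⟨d, Q, Δ₁, C₂, G₂, Δ₂, hQ, hde, hB', -, rfl, rfl, rfl⟩ := hB.split_cons
      obtain ⟨rfl, rfl, rfl⟩ := hB'.eq_zero
      rw [add_zero] at hA
      rw [zero_add, add_zero]
      -- The low cut vanishes with the axiom, and what remains is the box, whose cuts are all above
      -- `j`.
      refine (evt_axR hl hQ.proves hA hde ?_ hR).mono fun P' _ h => h.2 _ hQ.good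
      simp only [cutGraph, ← Multiset.singleton_add]; abel
    · obtain ⟨rfl, rfl⟩ := add_eq_zero.1 h.symm
      obtain ⟨rfl, rfl, rfl⟩ := hB.eq_zero
      simp only [add_zero] at hR ⊢
      exact .pure ⟨.ax hn hl, hR⟩ hg
  | daemon o =>
    intro hg E Γ C G Δ hE hB hA ha hR
    obtain ⟨rfl, rfl⟩ := add_eq_zero.1 hE.symm
    obtain ⟨rfl, rfl, rfl⟩ := hB.eq_zero
    simp only [add_zero] at hR ⊢
    exact .pure ⟨.daemon o, hR⟩ hg
  | @left n i A P Γ₀ c hr hP hi ih =>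
    intro hg E Γ C G Δ hE hB hA ha hR
    rw [good_cons] at hg
    have ha' : ∀ x ∈ Δ, ∀ a ∈ eigenvars P, a ∉ x.label.fv := fun x hx a h =>
      ha x hx a (by simp [h])
    rcases add_eq_cons hE.symm with ⟨E', rfl, rfl⟩ | ⟨Γ', rfl, rfl⟩
    · obtain ⟨d, Q, Δ₁, C₂, G₂, Δ₂, hQ, hde, hB', hQG, rfl, rfl, rfl⟩ := hB.split_cons
      exact evt_boxes_left hI hr hP hQ hde hB' hQG hA ha' (ih hg.2) rfl hR
    · have hn := hB.mem_edgeNames (P := P) fun n h => hP.mem_names (by simp [h])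
      rw [apart_iff] at hA
      have hPG : Apart P G := apart_iff.2 (by simp at hA; grind)
      have hP' : Proves (P + (C + G)) (A + (Γ' + Δ)) c := by
        rw [← add_assoc A]
        exact hB.proves (by rwa [add_left_comm] at hP) hPG
      rw [Multiset.cons_add (⟨n, ∅⟩ : Cell), resp_cons] at hR
      have := ih hg.2 (add_left_comm _ _ _) hB hPG ha' hR.2
      rw [add_assoc] at this
      rw [Multiset.cons_add (⟨n, ∅⟩ : Cell), Multiset.cons_add i]
      refine (Evt.left hr hP' ?_ hR.1 this).mono ?_
      · have := hA.1 i.name (by simp [hr.mem_names])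
        rw [hn]; grind
      · rintro _ - ⟨P₁, rfl, -, -, h⟩
        exact (good_cons ..).2 ⟨hg.1, h⟩
  | @right n A c o P Γ₀ hr hP ho ha₀ ih =>
    intro hg E Γ C G Δ hE hB hA ha hR
    subst hE
    rw [good_cons] at hg
    have ha' : ∀ x ∈ Δ, ∀ a ∈ eigenvars P, a ∉ x.label.fv := fun x hx a h =>
      ha x hx a (by simp [h])
    have hn := hB.mem_edgeNames (P := P) fun n h => hP.mem_names (by simp [h])
    rw [apart_iff] at hA
    have hPG : Apart P G := apart_iff.2 (by simp at hA; grind)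
    have hP' : Proves (P + (C + G)) (A + (Γ + Δ)) c := by
      rw [← add_assoc A]
      exact hB.proves (by rwa [add_left_comm] at hP) hPG
    rw [Multiset.cons_add (⟨n, ∅⟩ : Cell), resp_cons] at hR
    have := ih hg.2 (add_left_comm _ _ _) hB hPG ha' hR.2
    rw [add_assoc] at this
    rw [Multiset.cons_add (⟨n, ∅⟩ : Cell)]
    refine (Evt.right hr hP' ?_ ?_ hR.1 this).mono ?_
    · rw [hn]; simp [hr.mem_names] at hA; grind
    · intro a h x hx
      rcases Multiset.mem_add.1 hx with hx | hx
      · exact ha₀ a h x (by simp [hx])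
      · exact ha x hx a (by simp [h])
    · rintro _ - ⟨P₁, rfl, -, -, h⟩
      exact (good_cons ..).2 ⟨hg.1, h⟩
  | @cut P Q Γ₁ Γ₂ c d e hP hQ hPQ hl ihP ihQ =>
    intro hg E Γ C G Δ hE hB hA ha hR
    obtain ⟨E₁, E₂, v₁, v₂, rfl, rfl, rfl, rfl⟩ := add_eq_add hE
    obtain ⟨C₁, G₁, Δ₁, C₂, G₂, Δ₂, hB₁, hB₂, hGG, rfl, rfl, rfl⟩ := hB.split rfl
    rw [good_cons, good_add] at hg
    have hn₁ := hB₁.mem_edgeNames (P := P) fun n h => hP.mem_names (by simp [h])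
    have hn₂ := hB₂.mem_edgeNames (P := Q) fun n h => hQ.mem_names (by simp [h])
    have hb₁ := hB₁.mem_boxNames (P := P)
    have hb₂ := hB₂.mem_boxNames (P := Q)
    rw [apart_iff] at hA hPQ hGG
    simp only [mem_edgeNames_cons, mem_boxNames_cons, mem_edgeNames_add, mem_boxNames_add] at hA
    have hA₁ : Apart P G₁ := apart_iff.2 (by grind)
    have hA₂ : Apart Q G₂ := apart_iff.2 (by grind)
    have hPQ' : Apart (P + (C₁ + G₁)) (Q + (C₂ + G₂)) := by
      rw [apart_iff]; simp only [hn₁, hn₂, hb₁, hb₂]; grind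
    have hW : (⟨.cut d e, ∅⟩ ::ₘ (P + Q) + (C₁ + C₂ + (G₁ + G₂)) : Graph) =
        ⟨.cut d e, ∅⟩ ::ₘ (P + (C₁ + G₁) + (Q + (C₂ + G₂))) := by
      simp only [← Multiset.singleton_add]; abel
    rw [← Multiset.add_cons] at hP ihP
    rw [hW, resp_cons, resp_add] at hR
    rw [hW, add_add_add_comm]
    have h₁ := ihP hg.2.1 rfl hB₁ hA₁ (fun x hx a h => ha x (by simp [hx]) a (by simp [h])) hR.2.1
    have h₂ := ihQ hg.2.2 rfl hB₂ hA₂ (fun x hx a h => ha x (by simp [hx]) a (by simp [h])) hR.2.2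
    have hP' := hB₁.proves hP hA₁
    rw [Multiset.cons_add] at h₁ hP'
    refine (Evt.cut ⟨hP', hR.2.1⟩ ⟨hB₂.proves hQ hA₂, hR.2.2⟩ hPQ' hl hR.1 h₁ h₂).mono ?_
    rintro _ - ⟨P₁, Q₁, rfl, -, -, -, h, h'⟩
    exact (good_cons ..).2 ⟨hg.1, (good_add ..).2 ⟨h, h'⟩⟩
  | @tensorR P Q Γ₁ Γ₂ c d o hP hQ hPQ ho hl ihP ihQ =>
    intro hg E Γ C G Δ hE hB hA ha hR
    obtain ⟨E₁, E₂, v₁, v₂, rfl, rfl, rfl, rfl⟩ := add_eq_add hE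
    obtain ⟨C₁, G₁, Δ₁, C₂, G₂, Δ₂, hB₁, hB₂, hGG, rfl, rfl, rfl⟩ := hB.split rfl
    rw [good_cons, good_add] at hg
    have hn₁ := hB₁.mem_edgeNames (P := P) fun n h => hP.mem_names (by simp [h])
    have hn₂ := hB₂.mem_edgeNames (P := Q) fun n h => hQ.mem_names (by simp [h])
    have hb₁ := hB₁.mem_boxNames (P := P)
    have hb₂ := hB₂.mem_boxNames (P := Q)
    rw [apart_iff] at hA hPQ hGG
    simp only [mem_edgeNames_cons, mem_boxNames_cons, mem_edgeNames_add, mem_boxNames_add] at hA ho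
    have hA₁ : Apart P G₁ := apart_iff.2 (by grind)
    have hA₂ : Apart Q G₂ := apart_iff.2 (by grind)
    have hPQ' : Apart (P + (C₁ + G₁)) (Q + (C₂ + G₂)) := by
      rw [apart_iff]; simp only [hn₁, hn₂, hb₁, hb₂]; grind
    have ho' : o.name ∉ edgeNames (P + (C₁ + G₁) + (Q + (C₂ + G₂))) := by
      have := hA.1 o.name (by simp)
      rw [mem_edgeNames_add, hn₁, hn₂]; grind
    have hW : (⟨.tensorR c d o, ∅⟩ ::ₘ (P + Q) + (C₁ + C₂ + (G₁ + G₂)) : Graph) =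
        ⟨.tensorR c d o, ∅⟩ ::ₘ (P + (C₁ + G₁) + (Q + (C₂ + G₂))) := by
      simp only [← Multiset.singleton_add]; abel
    rw [hW, resp_cons, resp_add] at hR
    rw [hW, add_add_add_comm]
    have h₁ := ihP hg.2.1 rfl hB₁ hA₁ (fun x hx a h => ha x (by simp [hx]) a (by simp [h])) hR.2.1
    have h₂ := ihQ hg.2.2 rfl hB₂ hA₂ (fun x hx a h => ha x (by simp [hx]) a (by simp [h])) hR.2.2
    refine (Evt.tensorR ⟨hB₁.proves hP hA₁, hR.2.1⟩ ⟨hB₂.proves hQ hA₂, hR.2.2⟩ hPQ' ho' hl hR.1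
      h₁ h₂).mono ?_
    rintro _ - ⟨P₁, Q₁, rfl, -, -, -, -, h, h'⟩
    exact (good_cons ..).2 ⟨hg.1, (good_add ..).2 ⟨h, h'⟩⟩
  | @impL P Q Γ₁ Γ₂ c d e f hP hQ hPQ hf hl ihP ihQ =>
    intro hg E Γ C G Δ hE hB hA ha hR
    rcases add_eq_cons hE.symm with ⟨E', rfl, -⟩ | ⟨Γ', rfl, hE'⟩
    -- The input introduced by `⊸`-left cannot be cut with a box, whose output is a `!`-formula.
    · obtain ⟨d', Q', Δ₁, C₂, G₂, Δ₂, hQ', hde, -⟩ := hB.split_cons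
      have := hQ'.head
      simp [hde, hl] at this
    obtain ⟨E₁, E₂, v₁, v₂, rfl, rfl, rfl, rfl⟩ := add_eq_add hE'
    obtain ⟨C₁, G₁, Δ₁, C₂, G₂, Δ₂, hB₁, hB₂, hGG, rfl, rfl, rfl⟩ := hB.split rfl
    rw [good_cons, good_add] at hg
    have hn₁ := hB₁.mem_edgeNames (P := P) fun n h => hP.mem_names (by simp [h])
    have hn₂ := hB₂.mem_edgeNames (P := Q) fun n h => hQ.mem_names (by simp [h])
    have hb₁ := hB₁.mem_boxNames (P := P)
    have hb₂ := hB₂.mem_boxNames (P := Q)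
    rw [apart_iff] at hA hPQ hGG
    simp only [mem_edgeNames_cons, mem_boxNames_cons, mem_edgeNames_add, mem_boxNames_add] at hA hf
    have hA₁ : Apart P G₁ := apart_iff.2 (by grind)
    have hA₂ : Apart Q G₂ := apart_iff.2 (by grind)
    have hPQ' : Apart (P + (C₁ + G₁)) (Q + (C₂ + G₂)) := by
      rw [apart_iff]; simp only [hn₁, hn₂, hb₁, hb₂]; grind
    have hf' : f.name ∉ edgeNames (P + (C₁ + G₁) + (Q + (C₂ + G₂))) := by
      have := hA.1 f.name (by simp)
      rw [mem_edgeNames_add, hn₁, hn₂]; grind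
    have hW : (⟨.impL f d e, ∅⟩ ::ₘ (P + Q) + (C₁ + C₂ + (G₁ + G₂)) : Graph) =
        ⟨.impL f d e, ∅⟩ ::ₘ (P + (C₁ + G₁) + (Q + (C₂ + G₂))) := by
      simp only [← Multiset.singleton_add]; abel
    rw [← Multiset.add_cons] at hP ihP
    rw [hW, resp_cons, resp_add] at hR
    rw [hW, Multiset.cons_add, add_add_add_comm]
    have h₁ := ihP hg.2.1 rfl hB₁ hA₁ (fun x hx a h => ha x (by simp [hx]) a (by simp [h])) hR.2.1
    have h₂ := ihQ hg.2.2 rfl hB₂ hA₂ (fun x hx a h => ha x (by simp [hx]) a (by simp [h])) hR.2.2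
    have hP' := hB₁.proves hP hA₁
    rw [Multiset.cons_add] at h₁ hP'
    refine (Evt.impL ⟨hP', hR.2.1⟩ ⟨hB₂.proves hQ hA₂, hR.2.2⟩ hPQ' hf' hl hR.1 h₁ h₂).mono ?_
    rintro _ - ⟨P₁, Q₁, rfl, -, -, -, -, h, h'⟩
    exact (good_cons ..).2 ⟨hg.1, (good_add ..).2 ⟨h, h'⟩⟩
  | box₀ hP ho hl hb ih =>
    intro hg E Γ C G Δ hE hB hA ha hR
    obtain ⟨rfl, rfl⟩ := add_eq_zero.1 hE.symm
    obtain ⟨rfl, rfl, rfl⟩ := hB.eq_zero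
    simp only [add_zero] at hR ⊢
    exact .pure ⟨.box₀ hP ho hl hb, hR⟩ hg
  | box₁ hP ho hl hi hio hl' hb ih =>
    intro hg E Γ C G Δ hE hB hA ha hR
    rcases add_eq_cons (u := 0) hE.symm with ⟨E', rfl, h⟩ | ⟨Γ', rfl, h⟩
    · obtain ⟨rfl, rfl⟩ := add_eq_zero.1 h.symm
      obtain ⟨d, Q, Δ₁, C₂, G₂, Δ₂, hQ, hde, hB', -, rfl, rfl, rfl⟩ := hB.split_cons
      obtain ⟨rfl, rfl, rfl⟩ := hB'.eq_zero
      rw [add_zero] at hA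
      rw [zero_add, add_zero]
      refine evt_box_box hP ho hl hb hl' ?_ hQ hde hA ?_ hR
      · simpa [Node.Above] using hg
      · simp only [cutGraph, ← Multiset.singleton_add]; abel
    · obtain ⟨rfl, rfl⟩ := add_eq_zero.1 h.symm
      obtain ⟨rfl, rfl, rfl⟩ := hB.eq_zero
      simp only [add_zero] at hR ⊢
      exact .pure ⟨.box₁ hP ho hl hi hio hl' hb, hR⟩ hg
end

/-! ### Raising the lowest level of the cuts -/

section
variable {I : ℕ → ℤ} {j : ℤ} {A Γ Δ : Multiset Edge} {c d e o : Edge} {P Q R S : Graph} {n : Node}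
  {x : Cell}

theorem BangOut.mem_edgeNames (h : BangOut P d) : d.name ∈ edgeNames P := by
  obtain ⟨x, hx, c, b, hn⟩ := h
  exact (LALL.mem_edgeNames _ _).2 ⟨x, hx, by simp [hn]⟩

theorem bangOut_add : BangOut (P + Q) d ↔ BangOut P d ∨ BangOut Q d := by
  simp [BangOut, or_and_right, exists_or]

theorem bangOut_cons : BangOut (x ::ₘ P) d ↔ (∃ c b, x.node = .bangR c d b) ∨ BangOut P d := by
  simp [BangOut]

theorem bangOut_inside {K : Finset ℕ} : BangOut (inside K P) d ↔ BangOut P d := by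
  simp [BangOut, Graph.inside]

/-- The box that provides the output for a cut of `P` contains an edge of `P`, so by disjointness it
cannot lie in `R`. -/
theorem BangCuts.of_add (h : BangCuts (P + R)) (hA : ∀ n ∈ edgeNames P, n ∉ edgeNames R) :
    BangCuts P := by
  intro x hx d e hn
  have hd : d.name ∈ edgeNames P := (mem_edgeNames _ _).2 ⟨x, hx, by simp [hn]⟩
  rcases bangOut_add.1 (h x (Multiset.mem_add.2 (Or.inl hx)) d e hn) with h | h
  · exact h
  · exact absurd h.mem_edgeNames (hA _ hd)

theorem BangCuts.of_cons (h : BangCuts (x ::ₘ P)) (hx : ∀ c d b, x.node = .bangR c d b →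
    d.name ∉ edgeNames P) : BangCuts P := by
  intro y hy d e hn
  have hd : d.name ∈ edgeNames P := (mem_edgeNames _ _).2 ⟨y, hy, by simp [hn]⟩
  rcases bangOut_cons.1 (h y (Multiset.mem_cons_of_mem hy) d e hn) with ⟨c, b, h⟩ | h
  · exact absurd hd (hx c d b h)
  · exact h

theorem BangCuts.of_inside {K : Finset ℕ} (h : BangCuts (Graph.inside K P)) : BangCuts P := by
  intro x hx d e hn
  exact bangOut_inside.1 (h ⟨x.node, x.boxes ∪ K⟩ (Multiset.mem_map_of_mem _ hx) d e hn)

theorem LeftRule.ne_bangR {i : Edge} (h : LeftRule n i A) (c d : Edge) (b : ℕ) :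
    n ≠ .bangR c d b := by cases h <;> simp
theorem RightRule.ne_bangR (h : RightRule n A c o) (c' d : Edge) (b : ℕ) :
    n ≠ .bangR c' d b := by cases h <;> simp

/-- The case of a family with one member. Renaming the eigenvariables of `P` away from the inputs of
the box provides the side condition of `Absorbs`, and does not lower any cut. -/
theorem evt_cut_bangBox (hI : Recurrent I) (hP : Proves P (e ::ₘ Γ) c) (hg : Good I (j + 1) P)
    (hQ : BangBox I j Q Δ d) (hl : d.label = e.label) (hPQ : Apart P Q)
    (hR : Resp I (cutGraph d e P Q)) :
    Evt I (Good I (j + 1)) (Γ + Δ) c (cutGraph d e P Q) := by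
  rw [resp_cons, resp_add] at hR
  refine (Evt.cutL hP hQ.proves hR.2.2 hPQ hl hR.1
    (hP.evt_eigenvars hR.2.1 _ (finite_fvs Δ))).bind ?_
  rintro _ hN ⟨P₁, rfl, hP₁, hPQ, hG, -, hg₁⟩
  have hW : (⟨.cut d e, ∅⟩ ::ₘ (P₁ + Q) : Graph) = P₁ + (⟨.cut d e, ∅⟩ ::ₘ 0 + (Q + 0)) := by
    simp only [← Multiset.singleton_add]; abel
  have hN' := hN.2
  rw [hW] at hN' ⊢
  have hB := Boxes.cons hQ hl .nil (by simp [apart_iff])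
  have := hP₁.1.absorbs hI (hg₁ _ hg) (show e ::ₘ Γ = (e ::ₘ 0) + Γ by simp) hB (by simpa using hPQ)
    (fun x hx a ha ha' => hG a ha ⟨x, by simpa using hx, ha'⟩) hN'
  rwa [add_zero Δ] at this

/-- The cuts of the lowest level can be eliminated if all cuts are cuts with `!`-boxes. -/
theorem Proves.evt_good (hI : Recurrent I) (hQ : Proves Q Δ d) :
    Good I j Q → BangCuts Q → Resp I Q → Evt I (Good I (j + 1)) Δ d Q ∧
      ∀ {P Γ e c}, Proves P (e ::ₘ Γ) c → Good I (j + 1) P → Apart P Q → d.label = e.label →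
        j ≤ I d.name → BangOut Q d → Resp I (cutGraph d e P Q) →
        Evt I (Good I (j + 1)) (Γ + Δ) c (cutGraph d e P Q) := by
  -- The two conclusions are proved together. The first alone does not suffice at a cut: after its
  -- left premise has been improved, the right premise must be cut with it although its output box
  -- may still contain cuts of level `j`, which is what the second conclusion permits.
  induction hQ using Proves.rules with
  | @ax i o hn hl =>
    intro hg hb hR
    refine ⟨.pure ⟨.ax hn hl, hR⟩ (by simp [Node.Above]), fun _ _ _ _ _ h => ?_⟩
    simp [BangOut] at h
  | daemon o =>
    intro hg hb hR
    refine ⟨.pure ⟨.daemon o, hR⟩ (by simp [Node.Above]), fun _ _ _ _ _ h => ?_⟩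
    simp [BangOut] at h
  | @left n i A Q Δ d hr hQ hi ih =>
    intro hg hb hRQ
    rw [good_cons] at hg
    rw [resp_cons] at hRQ
    have hb' : BangCuts Q := hb.of_cons fun c d b h => absurd h (hr.ne_bangR c d b)
    have ih := ih hg.2 hb' hRQ.2
    refine ⟨(Evt.left hr hQ hi hRQ.1 ih.1).mono ?_, ?_⟩
    · rintro _ - ⟨P₁, rfl, -, -, h⟩
      exact (good_cons ..).2 ⟨by cases hr <;> trivial, h⟩
    intro P Γ e c hP hgP hPQ hl hj hbd hR
    have hm := hP.mem_names (n := e.name) (by simp)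
    have hW : cutGraph d e P (⟨n, ∅⟩ ::ₘ Q) = ⟨n, ∅⟩ ::ₘ cutGraph d e P Q := by
      simp only [cutGraph, ← Multiset.singleton_add]; abel
    rw [hW, resp_cons] at hR
    have hdQ := hQ.mem_names (Or.inl rfl)
    have hi' := hPQ.symm.names (n := i.name) (by simp [hr.mem_names])
    rw [apart_iff] at hPQ
    -- A left rule below the box leaves its output unchanged, so it is moved below the new cut, as
    -- an identity of graphs.
    have hA : Apart P Q := apart_iff.2 (by simp at hPQ; grind)
    have := ih.2 hP hgP hA hl hj ((bangOut_cons.1 hbd).resolve_left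
      fun ⟨c, b, h⟩ => hr.ne_bangR c d b h) hR.2
    rw [add_left_comm] at this
    rw [hW, Multiset.add_cons]
    refine (Evt.left hr ?_ ?_ hR.1 this).mono ?_
    · rw [add_left_comm]; exact .cut hP hQ hA hl
    · simp; grind
    · rintro _ - ⟨P₁, rfl, -, -, h⟩
      exact (good_cons ..).2 ⟨by cases hr <;> trivial, h⟩
  | @right n A c₀ o Q Δ hr hQ ho ha ih =>
    intro hg hb hRQ
    rw [good_cons] at hg
    rw [resp_cons] at hRQ
    have hb' : BangCuts Q := hb.of_cons fun c d b h => absurd h (hr.ne_bangR c d b)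
    have ih := ih hg.2 hb' hRQ.2
    refine ⟨(Evt.right hr hQ ho ha hRQ.1 ih.1).mono ?_, fun _ _ _ _ _ h => ?_⟩
    · rintro _ - ⟨P₁, rfl, -, -, h⟩
      exact (good_cons ..).2 ⟨by cases hr <;> trivial, h⟩
    -- The output is new at a right rule, so it is not the output of a box above it; the second
    -- conclusion is vacuous here.
    · rcases bangOut_cons.1 h with ⟨c, b, h⟩ | h
      · exact absurd h (hr.ne_bangR c o b)
      · exact absurd h.mem_edgeNames ho
  | @cut Q₁ Q₂ Δ₁ Δ₂ d d₁ e₁ hQ₁ hQ₂ hQ hl₁ ih₁ ih₂ =>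
    intro hg hb hRQ
    rw [good_cons, good_add] at hg
    have hm₁ := hQ₁.mem_names (Or.inl rfl)
    have hm₂ := hQ₂.mem_names (Or.inl rfl)
    have hQ' := hQ
    rw [apart_iff] at hQ
    have hb' := hb.of_cons (by simp)
    have hb₁ : BangCuts Q₁ := hb'.of_add hQ.1
    have hb₂ : BangCuts Q₂ := by
      rw [add_comm] at hb'; exact hb'.of_add fun n h h' => hQ.1 n h' h
    -- All cuts are with boxes, and `d₁` is an edge of `Q₂` only, so the box of this cut lies in
    -- `Q₂`.
    have hbd₁ : BangOut Q₂ d₁ := by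
      rcases bangOut_cons.1 (hb _ (Multiset.mem_cons_self _ _) d₁ e₁ rfl) with ⟨c, b, h⟩ | h
      · simp at h
      · exact (bangOut_add.1 h).resolve_left fun h => hQ.1 _ h.mem_edgeNames hm₂
    have hRQ' := hRQ
    rw [resp_cons, resp_add] at hRQ
    have ih₁ := ih₁ hg.2.1 hb₁ hRQ.2.1
    have ih₂ := ih₂ hg.2.2 hb₂ hRQ.2.2
    refine ⟨(Evt.cutL hQ₁ hQ₂ hRQ.2.2 hQ' hl₁ hRQ.1 ih₁.1).bind ?_, ?_⟩
    · rintro _ hN ⟨P₁, rfl, hP₁, hA, hgP⟩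
      -- Once the left premise has no cut at level `j`, the right premise is absorbed by it through
      -- the second induction hypothesis.
      exact ih₂.2 hP₁.1 hgP hA hl₁ hg.1 hbd₁ hN.2
    intro P Γ e c hP hgP hPQ hl hj hbd hR
    have hm := hP.mem_names (n := e.name) (by simp)
    have hW : cutGraph d e P (cutGraph d₁ e₁ Q₁ Q₂) = cutGraph d₁ e₁ (cutGraph d e P Q₁) Q₂ := by
      simp only [cutGraph, ← Multiset.singleton_add]; abel
    rw [hW] at hR ⊢
    rw [apart_iff] at hPQ
    have hA₁ : Apart P Q₁ := apart_iff.2 (by simp at hPQ; grind)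
    have hA : Apart (cutGraph d e P Q₁) Q₂ := by
      rw [apart_iff]
      simp [Node.owns] at *
      grind
    have hbd' : BangOut Q₁ d := by
      rcases bangOut_cons.1 hbd with ⟨c, b, h⟩ | h
      · simp at h
      · exact (bangOut_add.1 h).resolve_right fun h => hQ.1 _ hm₁ h.mem_edgeNames
    rw [resp_cons, resp_add] at hR
    have := ih₁.2 hP hgP hA₁ hl hj hbd' hR.2.1
    rw [Multiset.add_cons] at this
    rw [← add_assoc]
    refine (Evt.cutL (by
      rw [← Multiset.add_cons]; exact .cut hP hQ₁ hA₁ hl) hQ₂ hR.2.2 hA hl₁ hR.1 this).bind ?_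
    -- The outer structure is first merged with `Q₁`, which carries the box of `d`; the good result
    -- then absorbs `Q₂` along the inner cut.
    rintro _ hN ⟨P', rfl, hP', hA', hgP'⟩
    exact ih₂.2 hP'.1 hgP' hA' hl₁ hg.1 hbd₁ hN.2
  | @tensorR Q₁ Q₂ Δ₁ Δ₂ c₁ d₁ o hQ₁ hQ₂ hQ ho hl₁ ih₁ ih₂ =>
    intro hg hb hRQ
    rw [good_cons, good_add] at hg
    have hQ' := hQ
    rw [apart_iff] at hQ
    have hb' := hb.of_cons (by simp)
    have hb₁ : BangCuts Q₁ := hb'.of_add hQ.1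
    have hb₂ : BangCuts Q₂ := by
      rw [add_comm] at hb'; exact hb'.of_add fun n h h' => hQ.1 n h' h
    rw [resp_cons, resp_add] at hRQ
    have ih₁ := ih₁ hg.2.1 hb₁ hRQ.2.1
    have ih₂ := ih₂ hg.2.2 hb₂ hRQ.2.2
    refine ⟨(Evt.tensorR ⟨hQ₁, hRQ.2.1⟩ ⟨hQ₂, hRQ.2.2⟩ hQ' ho hl₁ hRQ.1 ih₁.1 ih₂.1).mono ?_,
      fun _ _ _ _ _ h => ?_⟩
    · rintro _ - ⟨P₁, Q₁, rfl, -, -, -, -, h, h'⟩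
      exact (good_cons ..).2 ⟨trivial, (good_add ..).2 ⟨h, h'⟩⟩
    · rcases bangOut_cons.1 h with ⟨c, b, h⟩ | h
      · simp at h
      · exact absurd h.mem_edgeNames ho
  | @impL Q₁ Q₂ Δ₁ Δ₂ d d₁ e₁ f hQ₁ hQ₂ hQ hf hl₁ ih₁ ih₂ =>
    intro hg hb hRQ
    rw [good_cons, good_add] at hg
    have hm₁ := hQ₁.mem_names (Or.inl rfl)
    have hQ' := hQ
    rw [apart_iff] at hQ
    have hb' := hb.of_cons (by simp)
    have hb₁ : BangCuts Q₁ := hb'.of_add hQ.1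
    have hb₂ : BangCuts Q₂ := by
      rw [add_comm] at hb'; exact hb'.of_add fun n h h' => hQ.1 n h' h
    rw [resp_cons, resp_add] at hRQ
    have ih₁ := ih₁ hg.2.1 hb₁ hRQ.2.1
    have ih₂ := ih₂ hg.2.2 hb₂ hRQ.2.2
    refine ⟨(Evt.impL ⟨hQ₁, hRQ.2.1⟩ ⟨hQ₂, hRQ.2.2⟩ hQ' hf hl₁ hRQ.1 ih₁.1 ih₂.1).mono ?_, ?_⟩
    · rintro _ - ⟨P₁, Q₁, rfl, -, -, -, -, h, h'⟩
      exact (good_cons ..).2 ⟨trivial, (good_add ..).2 ⟨h, h'⟩⟩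
    intro P Γ e c hP hgP hPQ hl hj hbd hR
    have hm := hP.mem_names (n := e.name) (by simp)
    have hW : cutGraph d e P (⟨.impL f d₁ e₁, ∅⟩ ::ₘ (Q₁ + Q₂)) =
        ⟨.impL f d₁ e₁, ∅⟩ ::ₘ (cutGraph d e P Q₁ + Q₂) := by
      simp only [cutGraph, ← Multiset.singleton_add]; abel
    rw [hW] at hR ⊢
    have hf' := hPQ.symm.names (n := f.name) (by simp)
    rw [apart_iff] at hPQ
    have hA₁ : Apart P Q₁ := apart_iff.2 (by simp at hPQ; grind)
    have hA : Apart (cutGraph d e P Q₁) Q₂ := by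
      rw [apart_iff]
      simp [Node.owns] at *
      grind
    have hbd' : BangOut Q₁ d := by
      rcases bangOut_cons.1 hbd with ⟨c, b, h⟩ | h
      · simp at h
      · exact (bangOut_add.1 h).resolve_right fun h => hQ.1 _ hm₁ h.mem_edgeNames
    rw [resp_cons, resp_add] at hR
    have := ih₁.2 hP hgP hA₁ hl hj hbd' hR.2.1
    rw [Multiset.add_cons] at this
    rw [Multiset.add_cons, ← add_assoc Γ]
    refine (Evt.impL ⟨by rw [← Multiset.add_cons]; exact .cut hP hQ₁ hA₁ hl, hR.2.1⟩
      ⟨hQ₂, hR.2.2⟩ hA ?_ hl₁ hR.1 this ih₂.1).mono ?_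
    · simp at *; grind
    · rintro _ - ⟨P₁, Q₁, rfl, -, -, -, -, h, h'⟩
      exact (good_cons ..).2 ⟨trivial, (good_add ..).2 ⟨h, h'⟩⟩
  | @box₀ X c₁ o b hX ho hl₁ hb₁ ih =>
    intro hg hb hRQ
    rw [good_cons, good_inside] at hg
    rw [resp_cons, resp_inside] at hRQ
    -- The output of the box is not an edge of its content, so the cuts inside are with boxes that
    -- lie inside.
    have hbX : BangCuts X := (hb.of_cons fun c d b' h => by
      obtain ⟨-, rfl, -⟩ := Node.bangR.inj h; simpa using ho).of_inside
    have := Evt.box₀ hX ho hl₁ hb₁ hRQ.1 (ih hg.2 hbX hRQ.2).1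
    refine ⟨this.mono ?_, ?_⟩
    · rintro _ - ⟨P₁, rfl, -, -, -, h⟩
      exact (good_cons ..).2 ⟨trivial, (good_inside ..).2 h⟩
    intro P Γ e c hP hgP hPQ hl hj _ hR
    have hR' := hR
    rw [resp_cons, resp_add] at hR
    -- The content is cleared of its cuts of level `j` before the box is pushed into `P`, so that no
    -- copy of the box carries such a cut.
    refine (Evt.cutR hP hR.2.1 (.box₀ hX ho hl₁ hb₁) hPQ hl hR.1 this).bind ?_
    rintro _ hN ⟨_, rfl, -, hA, X₁, rfl, hX₁, ho', hb', hg'⟩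
    exact evt_cut_bangBox hI hP hgP (.box₀ hX₁.1 ho' hl₁ hb' hg' hj) hl hA hN.2
  | @box₁ X c₁ o i x b hX ho hl₁ hi hio hl₂ hb₁ ih =>
    intro hg hb hRQ
    simp only [good_cons, good_inside] at hg
    simp only [resp_cons, resp_inside] at hRQ
    have hbX : BangCuts X := ((hb.of_cons fun c d b' h => by
      obtain ⟨-, rfl, -⟩ := Node.bangR.inj h
      have := hX.mem_names (n := x.name) (by simp)
      simp; grind).of_cons (by simp)).of_inside
    have := Evt.box₁ hX ho hl₁ hi hio hl₂ hb₁ hRQ.1 hRQ.2.1 (ih hg.2.2 hbX hRQ.2.2).1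
    refine ⟨this.mono ?_, ?_⟩
    · rintro _ - ⟨P₁, rfl, -, -, -, -, h⟩
      simpa [Node.Above]
    intro P Γ e c hP hgP hPQ hl hj _ hR
    have hR' := hR
    rw [resp_cons, resp_add] at hR
    refine (Evt.cutR hP hR.2.1 (.box₁ hX ho hl₁ hi hio hl₂ hb₁) hPQ hl hR.1 this).bind ?_
    rintro _ hN ⟨_, rfl, -, hA, X₁, rfl, hX₁, ho', hi', hb', hg'⟩
    exact evt_cut_bangBox hI hP hgP (.box₁ hX₁.1 ho' hl₁ hi' hio hl₂ hb' hg' hj) hl hA hN.2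

/-- The cuts of the lowest level can be eliminated. -/
theorem Net.evt_good (hI : Recurrent I) (hP : Net I P Γ c) (hj : Good I j P) :
    Evt I (Good I (j + 1)) Γ c P :=
  (hP.evt_bangCuts hI hj).bind fun _ hP' h => (hP'.1.evt_good hI h.1 h.2 hP'.2).1

theorem Net.evt_good_add (hI : Recurrent I) (hP : Net I P Γ c) (hj : Good I j P) (n : ℕ) :
    Evt I (Good I (j + n)) Γ c P := by
  induction n with
  | zero => exact .pure hP (by simpa using hj)
  | succ n ih =>
    refine ih.bind fun P' hP' h => ?_
    have := hP'.evt_good hI h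
    rwa [add_assoc, ← Nat.cast_succ] at this
end

/-! ### Periodic indexings and conclusion -/

theorem recurrent_mod (I : ℕ → ℤ) {N : ℕ} (hN : 0 < N) : Recurrent fun n => I (n % N) :=
  ⟨N, hN, fun n => by simp⟩

theorem isCtx_zero (Γ : Multiset Edge) (c : Edge) : IsCtx ∅ 0 Γ c Γ c :=
  ⟨fun P hP _ => by simpa using hP, fun _ h => Or.inl h⟩

theorem Evt.reduces {I : ℕ → ℤ} {Φ : Graph → Prop} {Γ : Multiset Edge} {c : Edge} {P : Graph}
    (h : Evt I Φ Γ c P) (hI : ∀ e ∈ Γ, I e.name = I c.name) :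
    ∃ P', Net I P' Γ c ∧ Φ P' ∧ Reduces Γ c P P' := by
  obtain ⟨P', hP', -, hΦ, hr⟩ := h ∅ 0 Γ c (isCtx_zero Γ c) (by simp) hI ⟨by simp, by simp⟩
  exact ⟨P', hP', hΦ, by simpa using hr⟩

/-- An indexing may be assumed to be periodic. -/
theorem IsIndexing.mod {P : Graph} {Γ : Multiset Edge} {c : Edge} {I : ℕ → ℤ} {N : ℕ}
    (h : IsIndexing P Γ c I) (hP : Proves P Γ c) (hN : ∀ n ∈ edgeNames P, n < N) :
    IsIndexing P Γ c fun n => I (n % N) := by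
  have key : ∀ n ∈ edgeNames P, I (n % N) = I n := fun n hn => by
    rw [Nat.mod_eq_of_lt (hN n hn)]
  refine ⟨fun x hx => ?_, fun e he => ?_⟩
  · have h₁ := h.respects x hx
    have h₂ : ∀ n ∈ x.node.names, I (n % N) = I n := fun n hn =>
      key n ((mem_edgeNames _ _).2 ⟨x, hx, hn⟩)
    generalize x.node = m at h₁ h₂
    cases m <;> simp [Node.Respects, Node.edges] at h₁ h₂ ⊢ <;> grind
  · rw [key _ (hP.mem_names (Or.inr ⟨e, he, rfl⟩)), key _ (hP.mem_names (Or.inl rfl))]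
    exact h.input e he

/-- A periodic indexing takes finitely many values, so the levels are bounded once for all names,
including those of edges created later. Raising the lower bound on the cuts beyond the upper bound
on all levels leaves no cut. -/
theorem IsNet.exists_reduces_cutFree {P : Graph} {Γ : Multiset Edge} {c : Edge} (h : IsNet P Γ c) :
    ∃ P', Reduces Γ c P P' ∧ IsNet P' Γ c ∧ P'.CutFree := by
  obtain ⟨hP, I, hI⟩ := h
  obtain ⟨M, hM⟩ := (finite_edgeNames P).bddAbove
  obtain ⟨J, hJ, hrec, B, hB⟩ : ∃ J, IsIndexing P Γ c J ∧ Recurrent J ∧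
      ∃ B : ℕ, ∀ n, (J n).natAbs ≤ B := by
    -- The period exceeds every name of the net, so the levels of its edges are unchanged; the sum
    -- of the absolute values over one period bounds all levels.
    refine ⟨_, hI.mod hP (N := M + 1) fun n hn => Nat.lt_succ_of_le (hM hn),
      recurrent_mod I (N := M + 1) (by omega), ∑ n ∈ Finset.range (M + 1), (I n).natAbs, fun n => ?_⟩
    exact Finset.single_le_sum (f := fun n => (I n).natAbs) (fun _ _ => Nat.zero_le _)
      (Finset.mem_range.2 (Nat.mod_lt n (by omega)))
  have hg : Good J (-B) P := by
    intro x _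
    generalize x.node = m
    cases m with
    | cut d e => have := hB d.name; simp only [Node.Above]; omega
    | _ => trivial
  -- From `-B`, this many increments reach `B + 1`, the first value above every level.
  obtain ⟨P', hP', hg', hr⟩ := (Net.evt_good_add hrec ⟨hP, hJ.respects⟩ hg (2 * B + 1)).reduces
    hJ.input
  refine ⟨P', hr, ⟨hP'.1, J, hP'.2, hJ.input⟩, fun x hx d e h => ?_⟩
  have h₁ := hg' x hx
  have h₂ := hB d.name
  simp only [h, Node.Above] at h₁
  push_cast at h₁
  omega

end LALL

theorem mainTheorem3 (P : LALL.Graph) (Γ : Multiset LALL.Edge) (c : LALL.Edge)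
    (hP : LALL.IsNet P Γ c) :
    ∃ P' : LALL.Graph, LALL.Reduces Γ c P P' ∧ LALL.IsNet P' Γ c ∧ P'.CutFree :=
  hP.exists_reduces_cutFree
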